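/- Consider the equations $$L:\quad v_t=v_{xx}+F(x)v_x+\varepsilon e^{v}+H(x),\qquad \varepsilon=\pm1,$$ where $F,H$ are real $C^\infty$ functions on a nonempty open interval $I\subseteq\mathbb R$. Let $A^{\max}(L)$ be the maximal Lie invariance algebra of $L$, i.e. the space of smooth vector fields $Q=\tau\partial_t+\xi\partial_x+\eta\partial_v$ on $\mathbb R\times I\times\mathbb R$ whose second prolongation annihilates the equation on its solution manifold. It always contains $\partial_t$. A (local) point transformation from $L$ to $L'$ (with data $I',F',H',\varepsilon'$) is a $C^\infty$ diffeomorphism $\Phi$ from a nonempty open set $U\subseteq\mathbb R\times I\times\mathbb R$ onto an open set $U'\subseteq\mathbb R\times I'\times\mathbb R$ of the $(t,x,v)$-spaces whose second prolongation maps $L$ to $L'$. It is called full if $U=\mathbb R\times I\times\mathbb R$ and $U'$ projects onto $I'$. Consider the following cases: * Case 0: $A^{\max}=\langle\partial_t\rangle$. * Case 2: $F=\alpha x^{-1}$, $H=\beta x^{-2}$, with $(\alpha,\beta)\ne(0,0)$, $0\notin I$; basis of $A^{\max}$: $\partial_t,\ 2t\partial_t+x\partial_x-2\partial_v$. * Case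 3: $F=\mu x$, $H=\gamma$, with $\mu=\pm1$, $\gamma\neq2\mu$; basis: $\partial_t,\ e^{-\mu t}\partial_x$. * Case $4_{\lambda=0}$: $F=0$, $H=\gamma$, with $\gamma\ne0$; basis: $\partial_t,\ \partial_x$. * Case $6_{\lambda=0}$: $F=0$, $H=0$; basis: $\partial_t,\ \partial_x,\ 2t\partial_t+x\partial_x-2\partial_v$. **Theorem.** Up to point equivalence, the cases of Lie symmetry extension in this class are exhausted by cases 0, 2, 3, $4_{\lambda=0}$ and $6_{\lambda=0}$, and these are inequivalent. Precisely: 1. For the equations of cases 2, 3, $4_{\lambda=0}$, $6_{\lambda=0}$, on any nonempty open interval $I$ (with $0\notin I$ in case 2), the algebra $A^{\max}$ has the listed basis. 2. Every equation $L$ of the class either belongs to case 0 or is mapped by a full point transformation to an equation of one of the cases 2, 3, $4_{\lambda=0}$, $6_{\lambda=0}$ (on some nonempty open interval) with the same $\varepsilon$. 3. The map $\tilde t=\frac1{2\mu}e^{2\mu t}$, $\tilde x=e^{\mu t}x$, $\tilde v=v-2\mu t$ ($\mu\ne0$) is a full point transformation, preserving $\varepsilon$, from $F=\alpha x^{-1}+\mu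 x$, $H=\beta x^{-2}+2\mu$ with $(\alpha,\beta)\ne(0,0)$, $0\notin I$ (case 1) to case 2 with the same $\alpha,\beta$, and from $F=\mu x$, $H=2\mu$ (case 5) to case $6_{\lambda=0}$. The map $\tilde t=t$, $\tilde x=x+\lambda t$, $\tilde v=v$ is a full point transformation, preserving $\varepsilon$, from $F=\lambda$, $H=\gamma$ to $F=0$, $H=\gamma$ (case 4 to case $4_{\lambda=0}$ if $\gamma\neq0$, case 6 to case $6_{\lambda=0}$ if $\gamma=0$). In each instance the target equation is posed on a suitable nonempty open interval. 4. If there is a local point transformation between two equations, each of one of the cases 2, 3, $4_{\lambda=0}$, $6_{\lambda=0}$, then both are of the same case, have the same $\varepsilon$, and have the same parameters ($\alpha,\beta$ in case 2; $\mu,\gamma$ in case 3), except that in case $4_{\lambda=0}$ the parameters are related by $\tilde\gamma=\delta^{-2}\gamma$ for some real $\delta\ne0$. 5. Let $L$ belong to case 0 and let $\Phi$ be a point transformation from $L$ to an equation $L'$ of the class whose domain $U$ is connected and projects onto $I$. Then $L'$ is not of any of the cases 2, 3, $4_{\lambda=0}$, $6_{\lambda=0}$, and $\Phi$ comes from the equivalence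 group: there are constants $\delta_1\neq0,\delta_2,\delta_3$ such that on $U$ $$\tilde t=\delta_1^2t+\delta_2,\quad \tilde x=\delta_1x+\delta_3,\quad \tilde v=v-\ln\delta_1^2,$$ and $\varepsilon'=\varepsilon$, $\delta_1I+\delta_3\subseteq I'$, $F'(\delta_1x+\delta_3)=\delta_1^{-1}F(x)$, $H'(\delta_1x+\delta_3)=\delta_1^{-2}H(x)$ for all $x\in I$. -/

import Mathlib

open Set
open scoped ContDiff

noncomputable section

namespace ReactionDiffusion

/-- Points `(t, x, v)` of the space of independent and dependent variables. -/
abbrev Pt : Type := ℝ × ℝ × ℝ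

/-- Derivatives of order one and two of a function `v` of `(t, x)` at a point. -/
structure Jet where
  vt : ℝ
  vx : ℝ
  vtt : ℝ
  vtx : ℝ
  vxx : ℝ

/-- Partial derivatives with respect to `t`, `x` and `v`. -/
def pdt (φ : Pt → ℝ) (p : Pt) : ℝ := fderiv ℝ φ p (1, 0, 0)

def pdx (φ : Pt → ℝ) (p : Pt) : ℝ := fderiv ℝ φ p (0, 1, 0)

def pdv (φ : Pt → ℝ) (p : Pt) : ℝ := fderiv ℝ φ p (0, 0, 1)

/-- Total derivatives `D_t φ`, `D_x φ`, `D_t² φ`, `D_t D_x φ`, `D_x² φ` of a function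
`φ (t, x, v)`, evaluated at the point `p` and the jet `j`. -/
def Dt (φ : Pt → ℝ) (p : Pt) (j : Jet) : ℝ := pdt φ p + j.vt * pdv φ p

def Dx (φ : Pt → ℝ) (p : Pt) (j : Jet) : ℝ := pdx φ p + j.vx * pdv φ p

def Dtt (φ : Pt → ℝ) (p : Pt) (j : Jet) : ℝ :=
  pdt (pdt φ) p + 2 * j.vt * pdt (pdv φ) p + j.vt ^ 2 * pdv (pdv φ) p + j.vtt * pdv φ p

def Dtx (φ : Pt → ℝ) (p : Pt) (j : Jet) : ℝ :=
  pdt (pdx φ) p + j.vx * pdt (pdv φ) p + j.vt * pdx (pdv φ) p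
    + j.vt * j.vx * pdv (pdv φ) p + j.vtx * pdv φ p

def Dxx (φ : Pt → ℝ) (p : Pt) (j : Jet) : ℝ :=
  pdx (pdx φ) p + 2 * j.vx * pdx (pdv φ) p + j.vx ^ 2 * pdv (pdv φ) p + j.vxx * pdv φ p

/-- An equation `v_t = v_xx + F(x) v_x + ε e^v + H(x)` of the class: `F` and `H` are smooth
functions on a nonempty open interval `I` and `ε = ±1`. -/
structure Equation where
  I : Set ℝ
  isOpen_I : IsOpen I
  isConnected_I : IsConnected I
  F : ℝ → ℝ
  H : ℝ → ℝ
  smooth_F : ContDiffOn ℝ ∞ F I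
  smooth_H : ContDiffOn ℝ ∞ H I
  ε : ℝ
  sign_ε : ε = 1 ∨ ε = -1

/-- Vector fields `τ ∂_t + ξ ∂_x + η ∂_v`, written as the triple `(τ, ξ, η)`. -/
abbrev VField : Type := Pt → ℝ × ℝ × ℝ

namespace VField

def τ (Q : VField) (p : Pt) : ℝ := (Q p).1

def ξ (Q : VField) (p : Pt) : ℝ := (Q p).2.1

def η (Q : VField) (p : Pt) : ℝ := (Q p).2.2

/-- Coefficients of `∂_{v_t}`, `∂_{v_x}` and `∂_{v_xx}` in the second prolongation of `Q`. -/
def ηt (Q : VField) (p : Pt) (j : Jet) : ℝ :=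
  Dt Q.η p j - j.vt * Dt Q.τ p j - j.vx * Dt Q.ξ p j

def ηx (Q : VField) (p : Pt) (j : Jet) : ℝ :=
  Dx Q.η p j - j.vt * Dx Q.τ p j - j.vx * Dx Q.ξ p j

def ηxx (Q : VField) (p : Pt) (j : Jet) : ℝ :=
  Dxx Q.η p j - j.vt * Dxx Q.τ p j - j.vx * Dxx Q.ξ p j
    - 2 * j.vtx * Dx Q.τ p j - 2 * j.vxx * Dx Q.ξ p j

/-- The vector field `∂_t`. -/
def dt : VField := fun _ => (1, 0, 0)

/-- The vector field `∂_x`. -/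
def dx : VField := fun _ => (0, 1, 0)

/-- The vector field `2 t ∂_t + x ∂_x - 2 ∂_v`. -/
def scaling : VField := fun p => (2 * p.1, p.2.1, -2)

/-- The vector field `e^{-μ t} ∂_x`. -/
def expShift (μ : ℝ) : VField := fun p => (0, Real.exp (-μ * p.1), 0)

end VField

/-- The second prolongation of a map `Φ = (T, X, V)` of the `(t, x, v)`-space relates the jet `j`
at `p` to the jet `k` at `Φ p`: `Φ` maps graphs of functions with jet `j` at `p` to graphs with jet
`k` at `Φ p` (the equations are the chain rule applied to `ṽ(T, X) = V`). -/
def Prolongs (Φ : Pt → Pt) (p : Pt) (j k : Jet) : Prop :=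
  let T : Pt → ℝ := fun q => (Φ q).1
  let X : Pt → ℝ := fun q => (Φ q).2.1
  let V : Pt → ℝ := fun q => (Φ q).2.2
  Dt V p j = k.vt * Dt T p j + k.vx * Dt X p j ∧
  Dx V p j = k.vt * Dx T p j + k.vx * Dx X p j ∧
  Dtt V p j = k.vt * Dtt T p j + k.vx * Dtt X p j
    + k.vtt * Dt T p j ^ 2 + 2 * k.vtx * Dt T p j * Dt X p j + k.vxx * Dt X p j ^ 2 ∧
  Dtx V p j = k.vt * Dtx T p j + k.vx * Dtx X p j
    + k.vtt * Dt T p j * Dx T p j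
    + k.vtx * (Dt T p j * Dx X p j + Dx T p j * Dt X p j)
    + k.vxx * Dt X p j * Dx X p j ∧
  Dxx V p j = k.vt * Dxx T p j + k.vx * Dxx X p j
    + k.vtt * Dx T p j ^ 2 + 2 * k.vtx * Dx T p j * Dx X p j + k.vxx * Dx X p j ^ 2

/-- The image under `Φ` of a graph with jet `j` at `p` is a graph over the `(t, x)`-plane
near `Φ p`. -/
def Transversal (Φ : Pt → Pt) (p : Pt) (j : Jet) : Prop :=
  Dt (fun q => (Φ q).1) p j * Dx (fun q => (Φ q).2.1) p j
    - Dx (fun q => (Φ q).1) p j * Dt (fun q => (Φ q).2.1) p j ≠ 0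

namespace Equation

/-- The region `ℝ × I × ℝ` of the `(t, x, v)`-space. -/
def domain (L : Equation) : Set Pt := {p | p.2.1 ∈ L.I}

/-- The jet `j` at `p` satisfies the equation. -/
def Holds (L : Equation) (p : Pt) (j : Jet) : Prop :=
  j.vt = j.vxx + L.F p.2.1 * j.vx + L.ε * Real.exp p.2.2 + L.H p.2.1

/-- `Q` belongs to the maximal Lie invariance algebra `A^max` of `L`: it is smooth and its second
prolongation annihilates `v_t - v_xx - F v_x - ε e^v - H` on the solution manifold of the equation
in the jet space. -/
def IsLieSymmetry (L : Equation) (Q : VField) : Prop :=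
  ContDiffOn ℝ ∞ Q L.domain ∧
  ∀ p ∈ L.domain, ∀ j : Jet, L.Holds p j →
    Q.ηt p j - Q.ηxx p j - L.F p.2.1 * Q.ηx p j - Q.ξ p * deriv L.F p.2.1 * j.vx
      - L.ε * Real.exp p.2.2 * Q.η p - Q.ξ p * deriv L.H p.2.1 = 0

/-- The vector fields `B 0, …, B (n - 1)` form a basis of `A^max` (vector fields being considered
on `ℝ × I × ℝ`). -/
def IsBasisOfAmax (L : Equation) {n : ℕ} (B : Fin n → VField) : Prop :=
  (∀ Q : VField, L.IsLieSymmetry Q ↔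
    ∃ c : Fin n → ℝ, ∀ p ∈ L.domain, Q p = ∑ i, c i • B i p) ∧
  ∀ c : Fin n → ℝ, (∀ p ∈ L.domain, ∑ i, c i • B i p = 0) → c = 0

/-- `F = f` and `H = h` on `I`. -/
def HasCoeffs (L : Equation) (f h : ℝ → ℝ) : Prop := EqOn L.F f L.I ∧ EqOn L.H h L.I

/-- `Φ` is a local point transformation (a smooth diffeomorphism between nonempty open subsets
of `ℝ × I × ℝ` and `ℝ × I' × ℝ`) mapping the equation `L` to the equation `L'`. -/
def IsPointTransformation (L L' : Equation) (Φ : OpenPartialHomeomorph Pt Pt) : Prop :=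
  Φ.source.Nonempty ∧ Φ.source ⊆ L.domain ∧ Φ.target ⊆ L'.domain ∧
  ContDiffOn ℝ ∞ Φ Φ.source ∧ ContDiffOn ℝ ∞ Φ.symm Φ.target ∧
  ∀ p ∈ Φ.source, ∀ j k : Jet, Transversal Φ p j → Prolongs Φ p j k →
    (L.Holds p j ↔ L'.Holds (Φ p) k)

/-- A point transformation mapping `L` to `L'` that is defined on all of `ℝ × I × ℝ` and whose
image projects onto the whole interval of `L'`. -/
def IsFullPointTransformation (L L' : Equation) (Φ : OpenPartialHomeomorph Pt Pt) : Prop :=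
  L.IsPointTransformation L' Φ ∧ Φ.source = L.domain ∧ (fun p : Pt => p.2.1) '' Φ.target = L'.I

/-- Case 0: there is no extension of the kernel algebra `⟨∂_t⟩`. -/
def IsCase0 (L : Equation) : Prop := L.IsBasisOfAmax ![VField.dt]

end Equation

/-- The cases of extension in the reduced list, with their parameters. -/
inductive ExtCase where
  | case2 (α β : ℝ)
  | case3 (μ γ : ℝ)
  | case4 (γ : ℝ)
  | case6

/-- `L` is an equation of the given case of the list. -/
def Equation.IsOfCase (L : Equation) : ExtCase → Prop
  | .case2 α β => ¬(α = 0 ∧ β = 0) ∧ (0 : ℝ) ∉ L.I ∧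
      L.HasCoeffs (fun x => α * x⁻¹) (fun x => β * (x ^ 2)⁻¹)
  | .case3 μ γ => (μ = 1 ∨ μ = -1) ∧ γ ≠ 2 * μ ∧ L.HasCoeffs (fun x => μ * x) (fun _ => γ)
  | .case4 γ => γ ≠ 0 ∧ L.HasCoeffs (fun _ => 0) (fun _ => γ)
  | .case6 => L.HasCoeffs (fun _ => 0) (fun _ => 0)

/-- `A^max` has the basis listed for the given case. -/
def Equation.HasListedBasis (L : Equation) : ExtCase → Prop
  | .case2 _ _ => L.IsBasisOfAmax ![VField.dt, VField.scaling]
  | .case3 μ _ => L.IsBasisOfAmax ![VField.dt, VField.expShift μ]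
  | .case4 _ => L.IsBasisOfAmax ![VField.dt, VField.dx]
  | .case6 => L.IsBasisOfAmax ![VField.dt, VField.dx, VField.scaling]

/-- The same case, with parameters that agree up to the scalings of the equivalence group. -/
def ExtCase.SameClass : ExtCase → ExtCase → Prop
  | .case2 α β, .case2 α' β' => α' = α ∧ β' = β
  | .case3 μ γ, .case3 μ' γ' => μ' = μ ∧ γ' = γ
  | .case4 γ, .case4 γ' => ∃ δ : ℝ, δ ≠ 0 ∧ γ' = (δ ^ 2)⁻¹ * γ
  | .case6, .case6 => True
  | _, _ => False

/-- `(t, x, v) ↦ (e^{2μt} / (2μ), e^{μt} x, v - 2μt)`. -/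
def expMap (μ : ℝ) (p : Pt) : Pt :=
  (Real.exp (2 * μ * p.1) / (2 * μ), Real.exp (μ * p.1) * p.2.1, p.2.2 - 2 * μ * p.1)

/-- `(t, x, v) ↦ (t, x + λt, v)`. -/
def galileiMap (l : ℝ) (p : Pt) : Pt := (p.1, p.2.1 + l * p.1, p.2.2)

/-- The transformation `(t, x, v) ↦ (δ₁² t + δ₂, δ₁ x + δ₃, v - ln δ₁²)` of the equivalence
group. -/
def equivGroupMap (δ₁ δ₂ δ₃ : ℝ) (p : Pt) : Pt :=
  (δ₁ ^ 2 * p.1 + δ₂, δ₁ * p.2.1 + δ₃, p.2.2 - Real.log (δ₁ ^ 2))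

/-- `L` is mapped to `L'` (over the interval of `L`) by the transformation of the equivalence group
with the parameters `δ₁`, `δ₃` (the time shift does not act on `F` and `H`). -/
def Equation.EquivGroupRelated (L L' : Equation) (δ₁ δ₃ : ℝ) : Prop :=
  L'.ε = L.ε ∧ ∀ x ∈ L.I, δ₁ * x + δ₃ ∈ L'.I ∧
    L'.F (δ₁ * x + δ₃) = δ₁⁻¹ * L.F x ∧ L'.H (δ₁ * x + δ₃) = (δ₁ ^ 2)⁻¹ * L.H x

end ReactionDiffusion

end

/-!
The theorem rests on two computations with the second prolongation and on one classification
lemma that serves both.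

*Lie symmetries.* Splitting the infinitesimal invariance criterion with respect to the free
derivatives `vx`, `vtx`, `vxx` and then with respect to `v` (where `e^v` has to be matched against
affine functions of `v`) gives `Q = τ ∂_t + (s x + r) ∂_x - 2 s ∂_v` with `τ' = 2 s` and
functions `s`, `r` of `t` (`IsLieSymmetry.exists_form`). What remains are the conditions
`((s x + r) F)' = -(s' x + r')` and `2 s H + (s x + r) H' = -2 s'`; for fixed `t` they are an
instance of `SymRel`. For the coefficients of the list these equations are solved directly, by
comparing coefficients of polynomials in `x`.

*Point transformations.* The same splitting, applied to a map `(T, X, V)` between two equations of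
the class, gives `T_x = T_v = 0`, `X_v = 0`, `X_x² = T_t`, `V = v - ln T_t`, `ε' = ε`, together
with `F = X_t / X_x + X_x F'(X)` and `H = T_tt / T_t + X_x² H'(X)` (`transform_coeffs`). Locally
`X = δ(t) x + χ(t)`, and for the equations of the list a comparison of coefficients in `x` shows
that the cases are inequivalent. Since `F` and `H` do not depend on `t`, differentiation with
respect to `t` shows that `k = δ' / δ` and `l = χ' / δ` satisfy conditions of the same kind `SymRel`
as `s` and `r` do, with `2 k² - k'`, `2 k l - l'` in place of `-s'`, `-r'`.

*Classification.* A curve of such relations that is not identically zero forces, up to a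
translation of `x`, either `F = α / x + μ x`, `H = β / x² + 2 μ`, or `F` affine and `H` constant
(`hasSpecialForm_of_curve`). Relations whose centres `-r / s` differ can be combined to one with
`s = 0`; otherwise the common centre is the pole and the relations integrate to the first form.
Equations of these forms are mapped to the list by explicit maps `(θ(t), δ(t) x + χ(t), v - ν(t))`.

*Rigidity.* Let `L` have no symmetry besides `∂_t`, and let a point transformation be given on a
connected domain. The relations for `k` and `l` are a system of ordinary differential equations
with the solution `0`, so the set where `k = l = 0` is open and closed. If it is empty, `F` and
`H` have the special form near every point of `I`; then they are analytic, the special form holds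
on all of `I` by the identity theorem, and `L` has a further symmetry. Hence `k = l = 0`
everywhere, which means that the transformation belongs to the equivalence group.
-/

noncomputable section

namespace ReactionDiffusion

/-! ### Partial derivatives of functions of `(t, x, v)` -/

section PartialDerivatives

variable {φ ψ : Pt → ℝ} {U : Set Pt}

lemma contDiffOn_fderiv_apply (hU : IsOpen U) (h : ContDiffOn ℝ ∞ φ U) (e : Pt) :
    ContDiffOn ℝ ∞ (fun p => fderiv ℝ φ p e) U :=
  (h.fderiv_of_isOpen hU (m := ∞) (by simp)).clm_apply contDiffOn_const

lemma contDiffOn_pdt (hU : IsOpen U) (h : ContDiffOn ℝ ∞ φ U) : ContDiffOn ℝ ∞ (pdt φ) U :=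
  contDiffOn_fderiv_apply hU h _

lemma contDiffOn_pdx (hU : IsOpen U) (h : ContDiffOn ℝ ∞ φ U) : ContDiffOn ℝ ∞ (pdx φ) U :=
  contDiffOn_fderiv_apply hU h _

lemma contDiffOn_pdv (hU : IsOpen U) (h : ContDiffOn ℝ ∞ φ U) : ContDiffOn ℝ ∞ (pdv φ) U :=
  contDiffOn_fderiv_apply hU h _

lemma differentiableAt_of_contDiffOn (hU : IsOpen U) (h : ContDiffOn ℝ ∞ φ U) {p : Pt}
    (hp : p ∈ U) : DifferentiableAt ℝ φ p :=
  ((h p hp).contDiffAt (hU.mem_nhds hp)).differentiableAt (by simp)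

/-- Symmetry of second derivatives, for derivatives in the directions `e` and `f`. -/
lemma fderiv_apply_comm (hU : IsOpen U) (h : ContDiffOn ℝ ∞ φ U) (e f : Pt) :
    EqOn (fun p => fderiv ℝ (fun q => fderiv ℝ φ q e) p f)
      (fun p => fderiv ℝ (fun q => fderiv ℝ φ q f) p e) U := by
  intro p hp
  have hc : ContDiffAt ℝ ∞ φ p := (h p hp).contDiffAt (hU.mem_nhds hp)
  have hd : DifferentiableAt ℝ (fderiv ℝ φ) p :=
    (hc.fderiv_right (m := ∞) (by simp)).differentiableAt (by simp)
  have hs : IsSymmSndFDerivAt ℝ φ p := hc.isSymmSndFDerivAt (by simpa using ENat.LEInfty.out)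
  have key : ∀ a b : Pt, fderiv ℝ (fun q => fderiv ℝ φ q a) p b
      = fderiv ℝ (fderiv ℝ φ) p b a := by
    intro a b
    rw [fderiv_clm_apply hd (differentiableAt_const a)]
    simp
  simp only [key]
  exact hs.eq f e

lemma pdv_pdt (hU : IsOpen U) (h : ContDiffOn ℝ ∞ φ U) : EqOn (pdv (pdt φ)) (pdt (pdv φ)) U :=
  fderiv_apply_comm hU h _ _

lemma pdv_pdx (hU : IsOpen U) (h : ContDiffOn ℝ ∞ φ U) : EqOn (pdv (pdx φ)) (pdx (pdv φ)) U :=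
  fderiv_apply_comm hU h _ _

lemma pdx_pdt (hU : IsOpen U) (h : ContDiffOn ℝ ∞ φ U) : EqOn (pdx (pdt φ)) (pdt (pdx φ)) U :=
  fderiv_apply_comm hU h _ _

lemma fderiv_eqOn (hU : IsOpen U) (h : EqOn φ ψ U) : EqOn (fderiv ℝ φ) (fderiv ℝ ψ) U :=
  fun _ hp => (h.eventuallyEq_of_mem (hU.mem_nhds hp)).fderiv_eq

lemma pdt_eqOn (hU : IsOpen U) (h : EqOn φ ψ U) : EqOn (pdt φ) (pdt ψ) U :=
  fun _ hp => by simp only [pdt, fderiv_eqOn hU h hp]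

lemma pdx_eqOn (hU : IsOpen U) (h : EqOn φ ψ U) : EqOn (pdx φ) (pdx ψ) U :=
  fun _ hp => by simp only [pdx, fderiv_eqOn hU h hp]

lemma pdv_eqOn (hU : IsOpen U) (h : EqOn φ ψ U) : EqOn (pdv φ) (pdv ψ) U :=
  fun _ hp => by simp only [pdv, fderiv_eqOn hU h hp]

lemma pdt_eqOn_zero (hU : IsOpen U) {c : ℝ} (h : ∀ p ∈ U, φ p = c) : ∀ p ∈ U, pdt φ p = 0 := by
  intro p hp
  rw [pdt_eqOn hU (ψ := fun _ => c) h hp]; simp [pdt]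

lemma pdx_eqOn_zero (hU : IsOpen U) {c : ℝ} (h : ∀ p ∈ U, φ p = c) : ∀ p ∈ U, pdx φ p = 0 := by
  intro p hp
  rw [pdx_eqOn hU (ψ := fun _ => c) h hp]; simp [pdx]

lemma pdv_eqOn_zero (hU : IsOpen U) {c : ℝ} (h : ∀ p ∈ U, φ p = c) : ∀ p ∈ U, pdv φ p = 0 := by
  intro p hp
  rw [pdv_eqOn hU (ψ := fun _ => c) h hp]; simp [pdv]

lemma fderiv_eq_pd (φ : Pt → ℝ) (p : Pt) (a b c : ℝ) :
    fderiv ℝ φ p (a, b, c) = a * pdt φ p + b * pdx φ p + c * pdv φ p := by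
  have : ((a, b, c) : Pt) = a • ((1, 0, 0) : Pt) + b • ((0, 1, 0) : Pt) + c • ((0, 0, 1) : Pt) := by
    simp
  rw [this, map_add, map_add, map_smul, map_smul, map_smul]
  rfl

lemma hasDerivAt_slice_t {t x v : ℝ} (h : DifferentiableAt ℝ φ (t, x, v)) :
    HasDerivAt (fun s => φ (s, x, v)) (pdt φ (t, x, v)) t :=
  h.hasFDerivAt.comp_hasDerivAt (f := fun s : ℝ => ((s, x, v) : Pt)) t
    ((hasDerivAt_id t).prodMk (hasDerivAt_const t (x, v)))

lemma hasDerivAt_slice_x {t x v : ℝ} (h : DifferentiableAt ℝ φ (t, x, v)) :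
    HasDerivAt (fun s => φ (t, s, v)) (pdx φ (t, x, v)) x :=
  h.hasFDerivAt.comp_hasDerivAt (f := fun s : ℝ => ((t, s, v) : Pt)) x
    ((hasDerivAt_const x t).prodMk ((hasDerivAt_id x).prodMk (hasDerivAt_const x v)))

lemma hasDerivAt_slice_v {t x v : ℝ} (h : DifferentiableAt ℝ φ (t, x, v)) :
    HasDerivAt (fun s => φ (t, x, s)) (pdv φ (t, x, v)) v :=
  h.hasFDerivAt.comp_hasDerivAt (f := fun s : ℝ => ((t, x, s) : Pt)) v
    ((hasDerivAt_const v t).prodMk ((hasDerivAt_const v x).prodMk (hasDerivAt_id v)))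

section Box

variable {K J M : Set ℝ}

lemma isOpen_box (hK : IsOpen K) (hJ : IsOpen J) (hM : IsOpen M) :
    IsOpen (K ×ˢ J ×ˢ M : Set Pt) := hK.prod (hJ.prod hM)

/-- On a box, a function whose `v`-derivative vanishes does not depend on `v`. -/
lemma eq_of_pdv_eq_zero (hM : IsOpen M) (hM' : IsPreconnected M)
    (hd : ∀ p ∈ (K ×ˢ J ×ˢ M : Set Pt), DifferentiableAt ℝ φ p)
    (h0 : ∀ p ∈ (K ×ˢ J ×ˢ M : Set Pt), pdv φ p = 0) {t x v w : ℝ}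
    (ht : t ∈ K) (hx : x ∈ J) (hv : v ∈ M) (hw : w ∈ M) : φ (t, x, v) = φ (t, x, w) := by
  have hs : ∀ u ∈ M, HasDerivAt (fun u => φ (t, x, u)) 0 u := fun u hu => by
    have := hasDerivAt_slice_v (hd (t, x, u) ⟨ht, hx, hu⟩)
    rwa [h0 _ ⟨ht, hx, hu⟩] at this
  exact hM.is_const_of_deriv_eq_zero hM'
    (fun u hu => (hs u hu).differentiableAt.differentiableWithinAt)
    (fun u hu => (hs u hu).deriv) hv hw

/-- On a box, a function whose `x`- and `v`-derivatives vanish is a function of `t`. -/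
lemma eq_of_pdx_pdv_eq_zero (hJ : IsOpen J) (hJ' : IsPreconnected J)
    (hM : IsOpen M) (hM' : IsPreconnected M)
    (hd : ∀ p ∈ (K ×ˢ J ×ˢ M : Set Pt), DifferentiableAt ℝ φ p)
    (hx0 : ∀ p ∈ (K ×ˢ J ×ˢ M : Set Pt), pdx φ p = 0)
    (hv0 : ∀ p ∈ (K ×ˢ J ×ˢ M : Set Pt), pdv φ p = 0) {t x v y w : ℝ}
    (ht : t ∈ K) (hx : x ∈ J) (hv : v ∈ M) (hy : y ∈ J) (hw : w ∈ M) :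
    φ (t, x, v) = φ (t, y, w) := by
  have hs : ∀ u ∈ J, HasDerivAt (fun u => φ (t, u, v)) 0 u := fun u hu => by
    have := hasDerivAt_slice_x (hd (t, u, v) ⟨ht, hu, hv⟩)
    rwa [hx0 _ ⟨ht, hu, hv⟩] at this
  have h1 : φ (t, x, v) = φ (t, y, v) := hJ.is_const_of_deriv_eq_zero hJ'
    (fun u hu => (hs u hu).differentiableAt.differentiableWithinAt)
    (fun u hu => (hs u hu).deriv) hx hy
  rw [h1]
  exact eq_of_pdv_eq_zero hM hM' hd hv0 ht hy hv hw

/-- On a box, a function with vanishing second `v`-derivative is affine in `v`. -/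
lemma eq_affine_of_pdv_pdv_eq_zero (hM : IsOpen M) (hM' : IsPreconnected M)
    (hd : ∀ p ∈ (K ×ˢ J ×ˢ M : Set Pt), DifferentiableAt ℝ φ p)
    (hd' : ∀ p ∈ (K ×ˢ J ×ˢ M : Set Pt), DifferentiableAt ℝ (pdv φ) p)
    (h0 : ∀ p ∈ (K ×ˢ J ×ˢ M : Set Pt), pdv (pdv φ) p = 0) {t x v w : ℝ}
    (ht : t ∈ K) (hx : x ∈ J) (hv : v ∈ M) (hw : w ∈ M) :
    φ (t, x, w) = φ (t, x, v) + pdv φ (t, x, v) * (w - v) := by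
  have hs : ∀ u ∈ M,
      HasDerivAt (fun u => φ (t, x, u) - pdv φ (t, x, v) * (u - v)) 0 u := fun u hu => by
    have h1 := hasDerivAt_slice_v (hd (t, x, u) ⟨ht, hx, hu⟩)
    rw [eq_of_pdv_eq_zero hM hM' hd' h0 ht hx hu hv] at h1
    simpa using h1.fun_sub (((hasDerivAt_id u).sub_const v).const_mul (pdv φ (t, x, v)))
  have := hM.is_const_of_deriv_eq_zero hM'
    (fun u hu => (hs u hu).differentiableAt.differentiableWithinAt)
    (fun u hu => (hs u hu).deriv) hw hv
  simp only [sub_self, mul_zero, sub_zero] at this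
  linarith

end Box

/-- Partial derivatives of the functions `a(t) x + b(t) + m v`. -/
lemma pd_eqOn_affine (hU : IsOpen U) {a a' b b' : ℝ → ℝ} {m : ℝ}
    (ha : ∀ t, HasDerivAt a (a' t) t) (hb : ∀ t, HasDerivAt b (b' t) t)
    (h : EqOn φ (fun p => a p.1 * p.2.1 + b p.1 + m * p.2.2) U) :
    EqOn (pdt φ) (fun p => a' p.1 * p.2.1 + b' p.1) U ∧ EqOn (pdx φ) (fun p => a p.1) U ∧
      EqOn (pdv φ) (fun _ => m) U := by
  have hd : ∀ p : Pt, DifferentiableAt ℝ (fun p : Pt => a p.1 * p.2.1 + b p.1 + m * p.2.2) p := by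
    intro p
    have h1 : DifferentiableAt ℝ (fun p : Pt => a p.1) p :=
      (ha p.1).differentiableAt.comp p differentiableAt_fst
    have h2 : DifferentiableAt ℝ (fun p : Pt => b p.1) p :=
      (hb p.1).differentiableAt.comp p differentiableAt_fst
    exact ((h1.mul (by fun_prop)).add h2).add (by fun_prop)
  refine ⟨?_, ?_, ?_⟩
  · rintro ⟨t, x, v⟩ hp
    rw [pdt_eqOn hU h hp]
    refine (hasDerivAt_slice_t (hd (t, x, v))).unique ?_
    exact ((((ha t).mul_const x).fun_add (hb t)).add_const (m * v))
  · rintro ⟨t, x, v⟩ hp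
    rw [pdx_eqOn hU h hp]
    refine (hasDerivAt_slice_x (hd (t, x, v))).unique ?_
    simpa using ((((hasDerivAt_id x).const_mul (a t)).add_const (b t)).add_const (m * v))
  · rintro ⟨t, x, v⟩ hp
    rw [pdv_eqOn hU h hp]
    refine (hasDerivAt_slice_v (hd (t, x, v))).unique ?_
    simpa using (((hasDerivAt_id v).const_mul m).const_add (a t * x + b t))

end PartialDerivatives

/-! ### Determining equations of Lie symmetries -/

/-- The linear conditions on the coefficients of `(s x + r) ∂_x` that both the Lie symmetries and
the time-dependent affine point transformations impose on `F` and `H`: on `J`,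
`((s x + r) F)' = a x + b` and `2 s H + (s x + r) H' = 2 a`. -/
def SymRel (F H : ℝ → ℝ) (J : Set ℝ) (s r a b : ℝ) : Prop :=
  ∀ x ∈ J, s * (F x + x * deriv F x) + r * deriv F x = a * x + b ∧
    s * (2 * H x + x * deriv H x) + r * deriv H x = 2 * a

/-- Linear independence of `u`, `1`, `e^u` and `u e^u`, as far as it concerns the last two. -/
lemma eq_zero_of_affine_add_exp_mul {A B C D : ℝ}
    (h : ∀ u : ℝ, A * u + B + Real.exp u * (C - D * u) = 0) : C = 0 ∧ D = 0 := by
  have d1 : ∀ u : ℝ, A + Real.exp u * (C - D - D * u) = 0 := by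
    intro u
    have h1 : HasDerivAt (fun u => A * u + B + Real.exp u * (C - D * u))
        (A * 1 + (Real.exp u * (C - D * u) + Real.exp u * (-(D * 1)))) u :=
      (((hasDerivAt_id u).const_mul A).add_const B).fun_add
        ((Real.hasDerivAt_exp u).fun_mul (((hasDerivAt_id u).const_mul D).const_sub C))
    rw [funext h] at h1
    linear_combination h1.unique (hasDerivAt_const u 0)
  have d2 : ∀ u : ℝ, Real.exp u * (C - 2 * D - D * u) = 0 := by
    intro u
    have h1 : HasDerivAt (fun u => A + Real.exp u * (C - D - D * u))
        (Real.exp u * (C - D - D * u) + Real.exp u * (-(D * 1))) u :=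
      ((Real.hasDerivAt_exp u).fun_mul
        (((hasDerivAt_id u).const_mul D).const_sub (C - D))).const_add A
    rw [funext d1] at h1
    linear_combination h1.unique (hasDerivAt_const u 0)
  have e0 := (mul_eq_zero.1 (d2 0)).resolve_left (Real.exp_ne_zero _)
  have e1 := (mul_eq_zero.1 (d2 1)).resolve_left (Real.exp_ne_zero _)
  constructor <;> linarith

namespace Equation

variable {L : Equation} {Q : VField}

lemma domain_eq (L : Equation) : L.domain = (univ ×ˢ L.I ×ˢ univ : Set Pt) := by
  ext p; simp [domain]

lemma isOpen_domain (L : Equation) : IsOpen L.domain := by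
  rw [domain_eq]; exact isOpen_box isOpen_univ L.isOpen_I isOpen_univ

lemma ε_ne_zero (L : Equation) : L.ε ≠ 0 := by
  rcases L.sign_ε with h | h <;> rw [h] <;> norm_num

namespace IsLieSymmetry

lemma smooth_τ (h : L.IsLieSymmetry Q) : ContDiffOn ℝ ∞ Q.τ L.domain := h.1.fst

lemma smooth_ξ (h : L.IsLieSymmetry Q) : ContDiffOn ℝ ∞ Q.ξ L.domain := h.1.snd.fst

lemma smooth_η (h : L.IsLieSymmetry Q) : ContDiffOn ℝ ∞ Q.η L.domain := h.1.snd.snd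

/-- The infinitesimal invariance criterion as a polynomial identity in the parametric derivatives
`vx`, `vtx`, `vxx`. -/
lemma criterion (h : L.IsLieSymmetry Q) {p : Pt} (hp : p ∈ L.domain) (vx vtx vxx : ℝ) :
    let vt := vxx + L.F p.2.1 * vx + L.ε * Real.exp p.2.2 + L.H p.2.1
    let j : Jet := ⟨vt, vx, 0, vtx, vxx⟩
    Q.ηt p j - Q.ηxx p j - L.F p.2.1 * Q.ηx p j - Q.ξ p * deriv L.F p.2.1 * vx
      - L.ε * Real.exp p.2.2 * Q.η p - Q.ξ p * deriv L.H p.2.1 = 0 :=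
  h.2 p hp _ rfl

lemma pd_τ (h : L.IsLieSymmetry Q) {p : Pt} (hp : p ∈ L.domain) :
    pdx Q.τ p = 0 ∧ pdv Q.τ p = 0 := by
  have h0 := h.criterion hp 0 0 0
  have h1 := h.criterion hp 0 1 0
  have h2 := h.criterion hp 1 0 0
  have h3 := h.criterion hp 1 1 0
  simp only [VField.ηt, VField.ηx, VField.ηxx, Dt, Dx, Dxx] at h0 h1 h2 h3
  constructor <;> linarith

lemma pd_ξ (h : L.IsLieSymmetry Q) {p : Pt} (hp : p ∈ L.domain) :
    pdv Q.ξ p = 0 ∧ pdx Q.ξ p = pdt Q.τ p / 2 := by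
  have h0 := h.criterion hp 0 0 0
  have h1 := h.criterion hp 0 0 1
  have h2 := h.criterion hp 1 0 0
  have h3 := h.criterion hp 1 0 1
  have z1 := pdx_eqOn_zero L.isOpen_domain (fun q hq => (h.pd_τ hq).1) p hp
  have z2 := pdx_eqOn_zero L.isOpen_domain (fun q hq => (h.pd_τ hq).2) p hp
  have z3 := pdv_eqOn_zero L.isOpen_domain (fun q hq => (h.pd_τ hq).2) p hp
  simp only [VField.ηt, VField.ηx, VField.ηxx, Dt, Dx, Dxx, h.pd_τ hp, z1, z2, z3]
    at h0 h1 h2 h3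
  constructor <;> linarith

/-- `ξ_x = τ_t / 2` does not depend on `x`. -/
lemma pdx_pdx_ξ (h : L.IsLieSymmetry Q) {p : Pt} (hp : p ∈ L.domain) : pdx (pdx Q.ξ) p = 0 := by
  have hU := L.isOpen_domain
  have h1 : pdx (pdt Q.τ) p = 0 := by
    rw [pdx_pdt hU h.smooth_τ hp]
    exact pdt_eqOn_zero hU (fun q hq => (h.pd_τ hq).1) p hp
  rw [pdx_eqOn hU (ψ := fun q => pdt Q.τ q / 2) (fun q hq => (h.pd_ξ hq).2) hp]
  have hd := differentiableAt_of_contDiffOn hU (contDiffOn_pdt hU h.smooth_τ) hp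
  have : (fun q => pdt Q.τ q / 2) = fun q => (1 / 2 : ℝ) * pdt Q.τ q := by ext; ring
  rw [this, pdx, fderiv_const_mul hd]
  simp only [smul_apply, smul_eq_mul]
  rw [pdx] at h1
  rw [h1, mul_zero]

/-- The coefficients of `vx²`, `vx` and `1` in the invariance criterion. -/
lemma coeffs (h : L.IsLieSymmetry Q) {p : Pt} (hp : p ∈ L.domain) :
    pdv (pdv Q.η) p = 0 ∧
    pdt Q.ξ p + L.F p.2.1 * pdx Q.ξ p + 2 * pdx (pdv Q.η) p + Q.ξ p * deriv L.F p.2.1 = 0 ∧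
    pdt Q.η p + (L.ε * Real.exp p.2.2 + L.H p.2.1) * (pdv Q.η p - pdt Q.τ p)
      - pdx (pdx Q.η) p - L.F p.2.1 * pdx Q.η p - L.ε * Real.exp p.2.2 * Q.η p
      - Q.ξ p * deriv L.H p.2.1 = 0 := by
  have hU := L.isOpen_domain
  have h0 := h.criterion hp 0 0 0
  have h1 := h.criterion hp 1 0 0
  have h2 := h.criterion hp (-1) 0 0
  have z1 := pdx_eqOn_zero hU (fun q hq => (h.pd_τ hq).1) p hp
  have z2 := pdx_eqOn_zero hU (fun q hq => (h.pd_τ hq).2) p hp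
  have z3 := pdv_eqOn_zero hU (fun q hq => (h.pd_τ hq).2) p hp
  have z4 := pdx_eqOn_zero hU (fun q hq => (h.pd_ξ hq).1) p hp
  have z5 := pdv_eqOn_zero hU (fun q hq => (h.pd_ξ hq).1) p hp
  have z6 := h.pdx_pdx_ξ hp
  simp only [VField.ηt, VField.ηx, VField.ηxx, Dt, Dx, Dxx, h.pd_τ hp, z1, z2, z3, z4, z5, z6,
    (h.pd_ξ hp).1] at h0 h1 h2
  have z7 := (h.pd_ξ hp).2
  refine ⟨by linarith, ?_, ?_⟩
  · have : pdt Q.τ p = 2 * pdx Q.ξ p := by linarith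
    rw [this] at h0 h1 h2
    linarith
  · linarith

/-- Along a line parallel to the `v`-axis the last of the equations `coeffs` has the form
`A v + B + e^v (C - D v) = 0`. -/
lemma η_eq (h : L.IsLieSymmetry Q) {p : Pt} (hp : p ∈ L.domain) : Q.η p = -pdt Q.τ p := by
  obtain ⟨t, x, v⟩ := p
  have hU := L.isOpen_domain
  have sη := h.smooth_η
  have sv := contDiffOn_pdv hU sη
  have hvv : ∀ p ∈ L.domain, pdv (pdv Q.η) p = 0 := fun p hp => (h.coeffs hp).1
  have hx : x ∈ L.I := hp
  have aff : ∀ φ : Pt → ℝ, ContDiffOn ℝ ∞ φ L.domain → (∀ p ∈ L.domain, pdv (pdv φ) p = 0) →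
      ∀ u, φ (t, x, u) = φ (t, x, 0) + pdv φ (t, x, 0) * u := by
    intro φ hφ h0 u
    have e := L.domain_eq
    have := eq_affine_of_pdv_pdv_eq_zero (K := univ) (J := L.I) (M := univ) (φ := φ) isOpen_univ
      isPreconnected_univ
      (fun p hp => differentiableAt_of_contDiffOn hU hφ (e ▸ hp))
      (fun p hp => differentiableAt_of_contDiffOn hU (contDiffOn_pdv hU hφ) (e ▸ hp))
      (fun p hp => h0 p (e ▸ hp)) (mem_univ t) hx (mem_univ 0) (mem_univ u)
    simpa using this
  have ht : ∀ p ∈ L.domain, pdv (pdv (pdt Q.η)) p = 0 := fun p hp => by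
    rw [pdv_eqOn hU (pdv_pdt hU sη) hp, pdv_pdt hU sv hp]
    exact pdt_eqOn_zero hU hvv p hp
  have hx1 : ∀ p ∈ L.domain, pdv (pdv (pdx Q.η)) p = 0 := fun p hp => by
    rw [pdv_eqOn hU (pdv_pdx hU sη) hp, pdv_pdx hU sv hp]
    exact pdx_eqOn_zero hU hvv p hp
  have sx := contDiffOn_pdx hU sη
  have hx2 : ∀ p ∈ L.domain, pdv (pdv (pdx (pdx Q.η))) p = 0 := fun p hp => by
    rw [pdv_eqOn hU (pdv_pdx hU sx) hp, pdv_pdx hU (contDiffOn_pdv hU sx) hp]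
    exact pdx_eqOn_zero hU hx1 p hp
  have cst : ∀ φ : Pt → ℝ, ContDiffOn ℝ ∞ φ L.domain → (∀ p ∈ L.domain, pdv φ p = 0) →
      ∀ u, φ (t, x, u) = φ (t, x, 0) := by
    intro φ hφ h0 u
    have e := L.domain_eq
    exact eq_of_pdv_eq_zero (K := univ) (J := L.I) (M := univ) (φ := φ) isOpen_univ
      isPreconnected_univ
      (fun p hp => differentiableAt_of_contDiffOn hU hφ (e ▸ hp))
      (fun p hp => h0 p (e ▸ hp)) (mem_univ t) hx (mem_univ u) (mem_univ 0)
  have cτ := cst _ (contDiffOn_pdt hU h.smooth_τ) fun p hp => by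
    rw [pdv_pdt hU h.smooth_τ hp]
    exact pdt_eqOn_zero hU (fun q hq => (h.pd_τ hq).2) p hp
  have cξ := cst _ h.smooth_ξ fun p hp => (h.pd_ξ hp).1
  have cv := cst _ sv hvv
  obtain ⟨hC, hD⟩ := eq_zero_of_affine_add_exp_mul
    (A := pdv (pdt Q.η) (t, x, 0) - pdv (pdx (pdx Q.η)) (t, x, 0)
      - L.F x * pdv (pdx Q.η) (t, x, 0))
    (B := pdt Q.η (t, x, 0) + L.H x * (pdv Q.η (t, x, 0) - pdt Q.τ (t, x, 0))
      - pdx (pdx Q.η) (t, x, 0) - L.F x * pdx Q.η (t, x, 0) - Q.ξ (t, x, 0) * deriv L.H x)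
    (C := L.ε * (pdv Q.η (t, x, 0) - pdt Q.τ (t, x, 0) - Q.η (t, x, 0)))
    (D := L.ε * pdv Q.η (t, x, 0))
    (fun u => by
      have key := (h.coeffs (p := (t, x, u)) hx).2.2
      rw [aff _ sη hvv u, aff _ (contDiffOn_pdt hU sη) ht u, aff _ sx hx1 u,
        aff _ (contDiffOn_pdx hU sx) hx2 u, cτ u, cξ u, cv u] at key
      linear_combination key)
  have hD' := (mul_eq_zero.1 hD).resolve_left L.ε_ne_zero
  have hC' := (mul_eq_zero.1 hC).resolve_left L.ε_ne_zero
  rw [aff _ sη hvv, cτ, hD']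
  rw [hD'] at hC'
  linarith

/-- Every Lie symmetry has the form `τ ∂_t + (s x + r) ∂_x - 2 s ∂_v` with functions `τ`, `s`, `r`
of `t` such that `τ' = 2 s`. -/
theorem exists_form (h : L.IsLieSymmetry Q) :
    ∃ τ s r s' r' : ℝ → ℝ, (∀ t, HasDerivAt τ (2 * s t) t) ∧ (∀ t, HasDerivAt s (s' t) t) ∧
      (∀ t, HasDerivAt r (r' t) t) ∧
      (∀ p ∈ L.domain, Q p = (τ p.1, s p.1 * p.2.1 + r p.1, -2 * s p.1)) ∧
      ∀ t, SymRel L.F L.H L.I (s t) (r t) (-s' t) (-r' t) := by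
  obtain ⟨x₀, hx₀⟩ := L.isConnected_I.nonempty
  have hU := L.isOpen_domain
  have e := L.domain_eq
  have sτt := contDiffOn_pdt hU h.smooth_τ
  have hm : ∀ t x v, x ∈ L.I → ((t, x, v) : Pt) ∈ L.domain := fun t x v hx => hx
  have onlyt : ∀ φ : Pt → ℝ, ContDiffOn ℝ ∞ φ L.domain → (∀ p ∈ L.domain, pdx φ p = 0) →
      (∀ p ∈ L.domain, pdv φ p = 0) → ∀ t x v, x ∈ L.I → φ (t, x, v) = φ (t, x₀, 0) := by
    intro φ hφ h1 h2 t x v hx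
    exact eq_of_pdx_pdv_eq_zero (K := univ) (M := univ) L.isOpen_I L.isConnected_I.isPreconnected
      isOpen_univ isPreconnected_univ
      (fun p hp => differentiableAt_of_contDiffOn hU hφ (e ▸ hp)) (fun p hp => h1 p (e ▸ hp))
      (fun p hp => h2 p (e ▸ hp)) (mem_univ t) hx (mem_univ v) hx₀ (mem_univ 0)
  have xτt : ∀ p ∈ L.domain, pdx (pdt Q.τ) p = 0 := fun p hp => by
    rw [pdx_pdt hU h.smooth_τ hp]
    exact pdt_eqOn_zero hU (fun q hq => (h.pd_τ hq).1) p hp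
  have vτt : ∀ p ∈ L.domain, pdv (pdt Q.τ) p = 0 := fun p hp => by
    rw [pdv_pdt hU h.smooth_τ hp]
    exact pdt_eqOn_zero hU (fun q hq => (h.pd_τ hq).2) p hp
  have oτ := onlyt _ h.smooth_τ (fun p hp => (h.pd_τ hp).1) fun p hp => (h.pd_τ hp).2
  have oτt := onlyt _ sτt xτt vτt
  have hξ : ∀ t x v, x ∈ L.I → Q.ξ (t, x, v)
      = pdt Q.τ (t, x₀, 0) / 2 * x + (Q.ξ (t, x₀, 0) - pdt Q.τ (t, x₀, 0) / 2 * x₀) := by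
    intro t x v hx
    have h1 : Q.ξ (t, x, v) = Q.ξ (t, x, 0) :=
      eq_of_pdv_eq_zero (K := univ) (J := L.I) (M := univ) isOpen_univ isPreconnected_univ
        (fun p hp => differentiableAt_of_contDiffOn hU h.smooth_ξ (e ▸ hp))
        (fun p hp => (h.pd_ξ (e ▸ hp)).1) (mem_univ t) hx (mem_univ v) (mem_univ 0)
    have hs : ∀ u ∈ L.I, HasDerivAt
        (fun u => Q.ξ (t, u, 0) - pdt Q.τ (t, x₀, 0) / 2 * (u - x₀)) 0 u := fun u hu => by
      have h2 := hasDerivAt_slice_x (differentiableAt_of_contDiffOn hU h.smooth_ξ (hm t u 0 hu))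
      rw [(h.pd_ξ (hm t u 0 hu)).2, oτt t u 0 hu] at h2
      simpa using h2.fun_sub
        (((hasDerivAt_id u).sub_const x₀).const_mul (pdt Q.τ (t, x₀, 0) / 2))
    have h3 := L.isOpen_I.is_const_of_deriv_eq_zero L.isConnected_I.isPreconnected
      (fun u hu => (hs u hu).differentiableAt.differentiableWithinAt)
      (fun u hu => (hs u hu).deriv) hx hx₀
    simp only [sub_self, mul_zero, sub_zero] at h3
    rw [h1]; linarith
  have dτ : ∀ t, HasDerivAt (fun t => Q.τ (t, x₀, 0)) (pdt Q.τ (t, x₀, 0)) t := fun t =>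
    hasDerivAt_slice_t (differentiableAt_of_contDiffOn hU h.smooth_τ (hm t x₀ 0 hx₀))
  have dτt : ∀ t, HasDerivAt (fun t => pdt Q.τ (t, x₀, 0)) (pdt (pdt Q.τ) (t, x₀, 0)) t :=
    fun t => hasDerivAt_slice_t (differentiableAt_of_contDiffOn hU sτt (hm t x₀ 0 hx₀))
  have dξ : ∀ t, HasDerivAt (fun t => Q.ξ (t, x₀, 0)) (pdt Q.ξ (t, x₀, 0)) t := fun t =>
    hasDerivAt_slice_t (differentiableAt_of_contDiffOn hU h.smooth_ξ (hm t x₀ 0 hx₀))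
  have dr : ∀ t, HasDerivAt (fun t => Q.ξ (t, x₀, 0) - pdt Q.τ (t, x₀, 0) / 2 * x₀)
      (pdt Q.ξ (t, x₀, 0) - pdt (pdt Q.τ) (t, x₀, 0) / 2 * x₀) t :=
    fun t => (dξ t).fun_sub (((dτt t).div_const 2).mul_const x₀)
  refine ⟨fun t => Q.τ (t, x₀, 0), fun t => pdt Q.τ (t, x₀, 0) / 2,
    fun t => Q.ξ (t, x₀, 0) - pdt Q.τ (t, x₀, 0) / 2 * x₀,
    fun t => pdt (pdt Q.τ) (t, x₀, 0) / 2,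
    fun t => pdt Q.ξ (t, x₀, 0) - pdt (pdt Q.τ) (t, x₀, 0) / 2 * x₀, ?_, ?_, dr, ?_, ?_⟩
  · intro t; convert dτ t using 1; ring
  · exact fun t => (dτt t).div_const 2
  · rintro ⟨t, x, v⟩ hp
    have h1 : Q.η (t, x, v) = _ := h.η_eq hp
    rw [oτt t x v hp] at h1
    refine Prod.ext (oτ t x v hp) (Prod.ext (hξ t x v hp) ?_)
    change Q.η (t, x, v) = _
    rw [h1]; ring
  · intro t x hx
    have hp := hm t x 0 hx
    obtain ⟨-, hF, hH⟩ := h.coeffs hp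
    have ξt : pdt Q.ξ (t, x, 0) = pdt (pdt Q.τ) (t, x₀, 0) / 2 * x
        + (pdt Q.ξ (t, x₀, 0) - pdt (pdt Q.τ) (t, x₀, 0) / 2 * x₀) := by
      have h1 := hasDerivAt_slice_t (differentiableAt_of_contDiffOn hU h.smooth_ξ hp)
      rw [funext fun s => hξ s x 0 hx] at h1
      exact h1.unique ((((dτt t).div_const 2).mul_const x).fun_add (dr t))
    have ηv : ∀ q ∈ L.domain, pdv Q.η q = 0 := fun q hq => by
      rw [pdv_eqOn hU (ψ := fun q => -pdt Q.τ q) (fun q hq => h.η_eq hq) hq]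
      have := vτt q hq
      simp only [pdv, fderiv_fun_neg, neg_apply, neg_eq_zero] at this ⊢
      exact this
    have ηx : ∀ q ∈ L.domain, pdx Q.η q = 0 := fun q hq => by
      rw [pdx_eqOn hU (ψ := fun q => -pdt Q.τ q) (fun q hq => h.η_eq hq) hq]
      have := xτt q hq
      simp only [pdx, fderiv_fun_neg, neg_apply, neg_eq_zero] at this ⊢
      exact this
    have ηt : pdt Q.η (t, x, 0) = -pdt (pdt Q.τ) (t, x₀, 0) := by
      have h1 := hasDerivAt_slice_t (differentiableAt_of_contDiffOn hU h.smooth_η hp)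
      have : (fun s => Q.η (s, x, 0)) = fun s => -pdt Q.τ (s, x₀, 0) := by
        ext s; rw [h.η_eq (hm s x 0 hx), oτt s x 0 hx]
      rw [this] at h1
      exact h1.unique (dτt t).fun_neg
    rw [ξt, (h.pd_ξ hp).2, oτt t x 0 hx, hξ t x 0 hx, pdx_eqOn_zero hU ηv _ hp] at hF
    rw [ηt, ηv _ hp, oτt t x 0 hx, ηx _ hp, pdx_eqOn_zero hU ηx _ hp, h.η_eq hp, oτt t x 0 hx,
      hξ t x 0 hx] at hH
    constructor <;> linarith

end IsLieSymmetry

/-- Converse of `IsLieSymmetry.exists_form`. -/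
theorem isLieSymmetry_of_form {τ s r s' r' : ℝ → ℝ} (cτ : ContDiff ℝ ∞ τ) (cs : ContDiff ℝ ∞ s)
    (cr : ContDiff ℝ ∞ r) (dτ : ∀ t, HasDerivAt τ (2 * s t) t)
    (ds : ∀ t, HasDerivAt s (s' t) t) (dr : ∀ t, HasDerivAt r (r' t) t)
    (hQ : ∀ p ∈ L.domain, Q p = (τ p.1, s p.1 * p.2.1 + r p.1, -2 * s p.1))
    (hR : ∀ t, SymRel L.F L.H L.I (s t) (r t) (-s' t) (-r' t)) : L.IsLieSymmetry Q := by
  have hU := L.isOpen_domain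
  refine ⟨ContDiffOn.congr (f := fun p : Pt => (τ p.1, s p.1 * p.2.1 + r p.1, -2 * s p.1)) ?_ hQ,
    ?_⟩
  · have h1 : ContDiff ℝ ∞ fun p : Pt => τ p.1 := cτ.comp contDiff_fst
    have h2 : ContDiff ℝ ∞ fun p : Pt => s p.1 := cs.comp contDiff_fst
    have h3 : ContDiff ℝ ∞ fun p : Pt => r p.1 := cr.comp contDiff_fst
    exact (h1.prodMk (((h2.mul contDiff_snd.fst).add h3).prodMk
      (contDiff_const.mul h2))).contDiffOn
  intro p hp j hj
  have z : ∀ t : ℝ, HasDerivAt (fun _ : ℝ => (0 : ℝ)) 0 t := fun t => hasDerivAt_const t 0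
  obtain ⟨t1, t2, t3⟩ := pd_eqOn_affine hU (φ := Q.τ) (a := fun _ => 0) (m := 0) z dτ
    (fun q hq => by simp [VField.τ, hQ q hq])
  obtain ⟨x1, x2, x3⟩ := pd_eqOn_affine hU (φ := Q.ξ) (m := 0) ds dr
    (fun q hq => by simp [VField.ξ, hQ q hq])
  obtain ⟨e1, e2, e3⟩ := pd_eqOn_affine hU (φ := Q.η) (a := fun _ => 0) (m := 0) z
    (fun t => (ds t).const_mul (-2)) (fun q hq => by simp [VField.η, hQ q hq])
  obtain ⟨-, t22, -⟩ := pd_eqOn_affine hU (φ := pdx Q.τ) (a := fun _ => 0) (b := fun _ => 0)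
    (m := 0) z z (fun q hq => by simp [t2 hq])
  obtain ⟨-, x22, -⟩ := pd_eqOn_affine hU (φ := pdx Q.ξ) (a := fun _ => 0) (m := 0) z ds
    (fun q hq => by simp [x2 hq])
  obtain ⟨-, e22, -⟩ := pd_eqOn_affine hU (φ := pdx Q.η) (a := fun _ => 0) (b := fun _ => 0)
    (m := 0) z z (fun q hq => by simp [e2 hq])
  have t32 := pdx_eqOn_zero hU t3 p hp
  have t33 := pdv_eqOn_zero hU t3 p hp
  have x32 := pdx_eqOn_zero hU x3 p hp
  have x33 := pdv_eqOn_zero hU x3 p hp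
  have e32 := pdx_eqOn_zero hU e3 p hp
  have e33 := pdv_eqOn_zero hU e3 p hp
  have hξ : Q.ξ p = s p.1 * p.2.1 + r p.1 := by simp [VField.ξ, hQ p hp]
  have hη : Q.η p = -2 * s p.1 := by simp [VField.η, hQ p hp]
  obtain ⟨hF, hH⟩ := hR p.1 p.2.1 hp
  have hj' : j.vt = _ := hj
  simp only [VField.ηt, VField.ηx, VField.ηxx, Dt, Dx, Dxx, t1 hp, t2 hp, t3 hp, x1 hp, x2 hp,
    x3 hp, e1 hp, e2 hp, e3 hp, t22 hp, x22 hp, e22 hp, t32, t33, x32, x33, e32, e33, hξ, hη, hj']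
  linear_combination (-j.vx) * hF - hH

end Equation

/-! ### Coefficients of equations with symmetry extensions -/

/-- The form that `F` and `H` have on `J` when the Lie symmetry algebra is larger than `⟨∂_t⟩`:
up to a translation of `x`, either `F = α / x + μ x` and `H = β / x² + 2 μ`, or `F` is affine and
`H` is constant. -/
def HasSpecialForm (F H : ℝ → ℝ) (J : Set ℝ) : Prop :=
  (∃ c α β μ : ℝ, ∀ x ∈ J, x + c ≠ 0 ∧ F x = α * (x + c)⁻¹ + μ * (x + c) ∧
    H x = β * ((x + c) ^ 2)⁻¹ + 2 * μ) ∨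
  ∃ μ l γ : ℝ, ∀ x ∈ J, F x = μ * x + l ∧ H x = γ

lemma cubic_coeffs_eq_zero {J : Set ℝ} (hJ : IsOpen J) (hne : J.Nonempty) {a b c d : ℝ}
    (h : ∀ x ∈ J, a * x ^ 3 + b * x ^ 2 + c * x + d = 0) : a = 0 ∧ b = 0 ∧ c = 0 ∧ d = 0 := by
  have h0 : (Cubic.mk a b c d).toPoly = 0 := by
    refine Polynomial.eq_zero_of_infinite_isRoot _ ?_
    obtain ⟨x, hx⟩ := hne
    refine Set.Infinite.mono ?_ (infinite_of_mem_nhds x (hJ.mem_nhds hx))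
    intro y hy
    simpa [Cubic.toPoly, Polynomial.IsRoot] using h y hy
  have h1 : (Cubic.mk a b c d) = 0 := (Cubic.toPoly_eq_zero_iff _).1 h0
  injection h1 with h2 h3 h4 h5
  exact ⟨h2, h3, h4, h5⟩

lemma eq_add_mul_of_hasDerivAt_const {f : ℝ → ℝ} {c : ℝ} (h : ∀ t, HasDerivAt f c t) (t : ℝ) :
    f t = f 0 + c * t := by
  have h1 : ∀ t, HasDerivAt (fun t => f t - c * t) 0 t := fun t => by
    simpa using (h t).fun_sub ((hasDerivAt_id t).const_mul c)
  have := is_const_of_deriv_eq_zero (fun t => (h1 t).differentiableAt) (fun t => (h1 t).deriv) t 0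
  simp only [mul_zero, sub_zero] at this
  linarith

lemma exists_const_of_hasDerivAt_zero {J : Set ℝ} (hJ : IsOpen J) (hJ' : IsConnected J)
    {f : ℝ → ℝ} (h : ∀ x ∈ J, HasDerivAt f 0 x) : ∃ c, ∀ x ∈ J, f x = c := by
  obtain ⟨x₀, hx₀⟩ := hJ'.nonempty
  exact ⟨f x₀, fun x hx => hJ.is_const_of_deriv_eq_zero hJ'.isPreconnected
    (fun u hu => (h u hu).differentiableAt.differentiableWithinAt)
    (fun u hu => (h u hu).deriv) hx hx₀⟩

section Classification

variable {F H : ℝ → ℝ} {J : Set ℝ} {s r a b : ℝ}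

lemma SymRel.comb {s₁ r₁ a₁ b₁ s₂ r₂ a₂ b₂ : ℝ} (h₁ : SymRel F H J s₁ r₁ a₁ b₁)
    (h₂ : SymRel F H J s₂ r₂ a₂ b₂) (m n : ℝ) :
    SymRel F H J (m * s₁ + n * s₂) (m * r₁ + n * r₂) (m * a₁ + n * a₂) (m * b₁ + n * b₂) := by
  intro x hx
  obtain ⟨e₁, f₁⟩ := h₁ x hx
  obtain ⟨e₂, f₂⟩ := h₂ x hx
  constructor
  · linear_combination m * e₁ + n * e₂
  · linear_combination m * f₁ + n * f₂

/-- The equations `((x + c) F)' = a (x + c)` and `((x + c)² H)' = 2 a (x + c)`, integrated. -/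
lemma SymRel.hasSpecialForm_of_scaling
    (hJ : IsOpen J) (hJ' : IsConnected J) (dF : ∀ x ∈ J, DifferentiableAt ℝ F x)
    (dH : ∀ x ∈ J, DifferentiableAt ℝ H x)
    {c : ℝ} (h : SymRel F H J 1 c a (c * a)) :
    HasSpecialForm F H J := by
  obtain ⟨α, hα⟩ := exists_const_of_hasDerivAt_zero hJ hJ'
    (f := fun x => (x + c) * F x - a / 2 * (x + c) ^ 2) fun x hx => by
      have h1 := (((hasDerivAt_id x).add_const c).fun_mul (dF x hx).hasDerivAt).fun_sub
        ((((hasDerivAt_id x).add_const c).fun_pow 2).const_mul (a / 2))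
      refine h1.congr_deriv ?_
      simp only [id, Nat.cast_ofNat]
      linear_combination (h x hx).1
  obtain ⟨β, hβ⟩ := exists_const_of_hasDerivAt_zero hJ hJ'
    (f := fun x => (x + c) ^ 2 * H x - a * (x + c) ^ 2) fun x hx => by
      have h1 := ((((hasDerivAt_id x).add_const c).fun_pow 2).fun_mul
        (dH x hx).hasDerivAt).fun_sub
        ((((hasDerivAt_id x).add_const c).fun_pow 2).const_mul a)
      refine h1.congr_deriv ?_
      simp only [id, Nat.cast_ofNat]
      linear_combination (x + c) * (h x hx).2
  by_cases hc : -c ∈ J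
  · -- the pole lies in `J`, so its coefficients vanish
    right
    have hα0 := hα _ hc
    have hβ0 := hβ _ hc
    have hc1 := (h _ hc).1
    have hc2 := (h _ hc).2
    simp only [neg_add_cancel, zero_mul] at hα0 hβ0
    refine ⟨a / 2, a / 2 * c, a, fun x hx => ?_⟩
    by_cases hxc : x + c = 0
    · obtain rfl : x = -c := by linarith
      constructor <;> linarith
    · have e1 := hα x hx
      have e2 := hβ x hx
      constructor
      · apply mul_left_cancel₀ hxc; linear_combination e1 - hα0
      · apply mul_left_cancel₀ (pow_ne_zero 2 hxc); linear_combination e2 - hβ0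
  · left
    refine ⟨c, α, β, a / 2, fun x hx => ?_⟩
    have hxc : x + c ≠ 0 := fun h0 => hc (by rwa [← eq_neg_of_add_eq_zero_left h0])
    have e1 := hα x hx
    have e2 := hβ x hx
    refine ⟨hxc, ?_, ?_⟩
    · field_simp; linear_combination 2 * e1
    · field_simp; linear_combination e2

lemma hasSpecialForm_of_deriv_eq_const
    (hJ : IsOpen J) (hJ' : IsConnected J) (dF : ∀ x ∈ J, DifferentiableAt ℝ F x)
    (dH : ∀ x ∈ J, DifferentiableAt ℝ H x)
    (h : ∀ x ∈ J, deriv F x = b ∧ deriv H x = 0) :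
    HasSpecialForm F H J := by
  obtain ⟨l, hl⟩ := exists_const_of_hasDerivAt_zero hJ hJ' (f := fun x => F x - b * x)
    fun x hx => by
      refine ((dF x hx).hasDerivAt.fun_sub ((hasDerivAt_id x).const_mul b)).congr_deriv ?_
      rw [(h x hx).1]; ring
  obtain ⟨γ, hγ⟩ := exists_const_of_hasDerivAt_zero hJ hJ' (f := H) fun x hx => by
    rw [← (h x hx).2]; exact (dH x hx).hasDerivAt
  exact Or.inr ⟨b, l, γ, fun x hx => ⟨by linarith [hl x hx], hγ x hx⟩⟩

/-- Two relations with different centres: then `F' = a₀ x + b₀`, and differentiating the relation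
for `F` once more shows `a₀ = 0`. -/
lemma SymRel.hasSpecialForm_of_translation
    (hJ : IsOpen J) (hJ' : IsConnected J) (dF : ∀ x ∈ J, DifferentiableAt ℝ F x)
    (dH : ∀ x ∈ J, DifferentiableAt ℝ H x)
    {a₀ b₀ : ℝ} (h : SymRel F H J s r a b) (hs : s ≠ 0)
    (h₀ : SymRel F H J 0 1 a₀ b₀) : HasSpecialForm F H J := by
  have hF' : ∀ x ∈ J, deriv F x = a₀ * x + b₀ := fun x hx => by linarith [(h₀ x hx).1]
  have hH' : ∀ x ∈ J, deriv H x = 2 * a₀ := fun x hx => by linarith [(h₀ x hx).2]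
  have ha₀ : a₀ = 0 := by
    have h3 : ∀ x ∈ J, 0 * x ^ 3 + 0 * x ^ 2 + 3 * s * a₀ * x + (2 * s * b₀ + r * a₀ - a) = 0 := by
      intro x hx
      have d1 := ((dF x hx).hasDerivAt.const_mul s).fun_add
        (((hasDerivAt_id x).const_mul s).fun_add (hasDerivAt_const x r) |>.fun_mul
          (((hasDerivAt_id x).const_mul a₀).add_const b₀))
      have d2 : HasDerivAt (fun x => s * F x + (s * id x + r) * (a₀ * id x + b₀)) a x := by
        have : HasDerivAt (fun x => a * x + b) a x := by
          simpa using ((hasDerivAt_id x).const_mul a).add_const b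
        refine this.congr_of_eventuallyEq ?_
        filter_upwards [hJ.mem_nhds hx] with y hy
        have := (h y hy).1
        rw [hF' y hy] at this
        simp only [id]
        linear_combination this
      have := d1.unique d2
      rw [hF' x hx] at this
      simp only [id] at this
      linear_combination this
    have := (cubic_coeffs_eq_zero hJ hJ'.nonempty h3).2.2.1
    simpa [hs] using this
  subst ha₀
  exact hasSpecialForm_of_deriv_eq_const hJ hJ' dF dH (b := b₀)
    fun x hx => ⟨by rw [hF' x hx]; ring, by rw [hH' x hx]; ring⟩

/-- A curve of relations `SymRel` of the kind produced by Lie symmetries (`κ = 0`) and by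
point transformations (`κ = 2`) forces the special form of `F` and `H`. -/
theorem hasSpecialForm_of_curve
    (hJ : IsOpen J) (hJ' : IsConnected J) (dF : ∀ x ∈ J, DifferentiableAt ℝ F x)
    (dH : ∀ x ∈ J, DifferentiableAt ℝ H x)
    {K : Set ℝ} (hK : IsOpen K) {s r s' r' : ℝ → ℝ} (κ : ℝ)
    (ds : ∀ t ∈ K, HasDerivAt s (s' t) t) (dr : ∀ t ∈ K, HasDerivAt r (r' t) t)
    (h : ∀ t ∈ K, SymRel F H J (s t) (r t) (κ * s t ^ 2 - s' t) (κ * s t * r t - r' t))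
    {t₀ : ℝ} (ht₀ : t₀ ∈ K) (hne : s t₀ ≠ 0 ∨ r t₀ ≠ 0) : HasSpecialForm F H J := by
  by_cases hs : ∀ t ∈ K, s t = 0
  · have hs' : s' t₀ = 0 := by
      refine (ds t₀ ht₀).unique ((hasDerivAt_const t₀ (0 : ℝ)).congr_of_eventuallyEq ?_)
      filter_upwards [hK.mem_nhds ht₀] with t ht using hs t ht
    have hr : r t₀ ≠ 0 := hne.resolve_left fun h => h (hs t₀ ht₀)
    refine hasSpecialForm_of_deriv_eq_const hJ hJ' dF dH (b := -r' t₀ / r t₀) fun x hx => ?_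
    have := h t₀ ht₀ x hx
    rw [hs', hs t₀ ht₀] at this
    obtain ⟨e1, e2⟩ := this
    constructor
    · field_simp; linear_combination e1
    · apply mul_left_cancel₀ hr; linear_combination e2
  · push Not at hs
    obtain ⟨t₁, ht₁, hs₁⟩ := hs
    by_cases hp : ∀ t ∈ K, s t₁ * r t = s t * r t₁
    · -- all centres agree: `r = c s` with a constant `c`
      have hr : ∀ t ∈ K, r t = r t₁ / s t₁ * s t := fun t ht => by
        field_simp; linear_combination hp t ht
      have hr' : r' t₁ = r t₁ / s t₁ * s' t₁ := by
        refine (dr t₁ ht₁).unique (((ds t₁ ht₁).const_mul _).congr_of_eventuallyEq ?_)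
        filter_upwards [hK.mem_nhds ht₁] with t ht using hr t ht
      have h1 := (h t₁ ht₁).comb (h t₁ ht₁) (s t₁)⁻¹ 0
      refine SymRel.hasSpecialForm_of_scaling hJ hJ' dF dH (c := r t₁ / s t₁)
        (a := (s t₁)⁻¹ * (κ * s t₁ ^ 2 - s' t₁)) ?_
      convert h1 using 1
      · field_simp; ring
      · field_simp; ring
      · ring
      · rw [hr']; field_simp; ring
    · push Not at hp
      obtain ⟨t₂, ht₂, hp⟩ := hp
      have hd : s t₁ * r t₂ - s t₂ * r t₁ ≠ 0 := sub_ne_zero.2 hp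
      have h1 := (h t₂ ht₂).comb (h t₁ ht₁) (s t₁ / (s t₁ * r t₂ - s t₂ * r t₁))
        (-s t₂ / (s t₁ * r t₂ - s t₂ * r t₁))
      -- this combination of the relations at `t₁` and `t₂` has `s = 0` and `r = 1`
      have e1 : s t₁ / (s t₁ * r t₂ - s t₂ * r t₁) * s t₂
          + -s t₂ / (s t₁ * r t₂ - s t₂ * r t₁) * s t₁ = 0 := by ring
      have e2 : s t₁ / (s t₁ * r t₂ - s t₂ * r t₁) * r t₂
          + -s t₂ / (s t₁ * r t₂ - s t₂ * r t₁) * r t₁ = 1 := by field_simp; ring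
      rw [e1, e2] at h1
      exact (h t₁ ht₁).hasSpecialForm_of_translation hJ hJ' dF dH hs₁ h1

end Classification

namespace Equation

variable {L : Equation}

lemma differentiableAt_F (L : Equation) {x : ℝ} (hx : x ∈ L.I) : DifferentiableAt ℝ L.F x :=
  ((L.smooth_F x hx).contDiffAt (L.isOpen_I.mem_nhds hx)).differentiableAt (by simp)

lemma differentiableAt_H (L : Equation) {x : ℝ} (hx : x ∈ L.I) : DifferentiableAt ℝ L.H x :=
  ((L.smooth_H x hx).contDiffAt (L.isOpen_I.mem_nhds hx)).differentiableAt (by simp)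

lemma deriv_F_eq {f : ℝ → ℝ} (h : EqOn L.F f L.I) {x f' : ℝ} (hx : x ∈ L.I)
    (hf : HasDerivAt f f' x) : deriv L.F x = f' :=
  (h.eventuallyEq_of_mem (L.isOpen_I.mem_nhds hx)).deriv_eq.trans hf.deriv

lemma deriv_H_eq {f : ℝ → ℝ} (h : EqOn L.H f L.I) {x f' : ℝ} (hx : x ∈ L.I)
    (hf : HasDerivAt f f' x) : deriv L.H x = f' :=
  (h.eventuallyEq_of_mem (L.isOpen_I.mem_nhds hx)).deriv_eq.trans hf.deriv

lemma isLieSymmetry_of_const (c : ℝ) {Q : VField} (hQ : ∀ p ∈ L.domain, Q p = (c, 0, 0)) :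
    L.IsLieSymmetry Q := by
  refine isLieSymmetry_of_form (τ := fun _ => c) (s := fun _ => 0) (r := fun _ => 0)
    (s' := fun _ => 0) (r' := fun _ => 0) contDiff_const contDiff_const contDiff_const
    (fun t => by simpa using hasDerivAt_const t c) (fun t => hasDerivAt_const t 0)
    (fun t => hasDerivAt_const t 0) (fun p hp => by simp [hQ p hp]) (fun t x hx => by simp)

/-- A Lie symmetry that is not a multiple of `∂_t` yields a nonzero curve of relations. -/
theorem isCase0_or_hasSpecialForm (L : Equation) : L.IsCase0 ∨ HasSpecialForm L.F L.H L.I := by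
  by_contra! hcon
  obtain ⟨h0, hS⟩ := hcon
  refine h0 ⟨fun Q => ⟨fun hQ => ?_, ?_⟩, ?_⟩
  · obtain ⟨τ, s, r, s', r', dτ, ds, dr, hform, hR⟩ := hQ.exists_form
    have hz : ∀ t, s t = 0 ∧ r t = 0 := by
      intro t
      by_contra hne
      refine hS (hasSpecialForm_of_curve L.isOpen_I L.isConnected_I
        (fun x hx => L.differentiableAt_F hx) (fun x hx => L.differentiableAt_H hx) isOpen_univ 0
        (fun t _ => ds t) (fun t _ => dr t) (fun t _ => ?_) (mem_univ t) (by tauto))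
      simpa using hR t
    refine ⟨fun _ => τ 0, fun p hp => ?_⟩
    have hτ := eq_add_mul_of_hasDerivAt_const (f := τ) (c := 0)
      (fun t => by simpa [(hz t).1] using dτ t) p.1
    simp [hform p hp, hz, VField.dt, hτ]
  · rintro ⟨c, hc⟩
    exact isLieSymmetry_of_const (c 0) fun p hp => by simp [hc p hp, VField.dt]
  · intro c hc
    obtain ⟨x, hx⟩ := L.isConnected_I.nonempty
    have := hc (0, x, 0) hx
    ext i; fin_cases i
    simpa [VField.dt] using this

lemma not_isCase0_of_form {τ s r s' r' : ℝ → ℝ} (cτ : ContDiff ℝ ∞ τ) (cs : ContDiff ℝ ∞ s)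
    (cr : ContDiff ℝ ∞ r) (dτ : ∀ t, HasDerivAt τ (2 * s t) t)
    (ds : ∀ t, HasDerivAt s (s' t) t) (dr : ∀ t, HasDerivAt r (r' t) t)
    (hR : ∀ t, SymRel L.F L.H L.I (s t) (r t) (-s' t) (-r' t)) (hne : s 0 ≠ 0 ∨ r 0 ≠ 0) :
    ¬L.IsCase0 := by
  intro h0
  obtain ⟨c, hc⟩ := (h0.1 (fun p => (τ p.1, s p.1 * p.2.1 + r p.1, -2 * s p.1))).1
    (isLieSymmetry_of_form cτ cs cr dτ ds dr (fun p _ => rfl) hR)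
  obtain ⟨x, hx⟩ := L.isConnected_I.nonempty
  have := hc (0, x, 0) hx
  simp only [Fin.sum_univ_one, VField.dt, Matrix.cons_val_zero, Prod.smul_mk, smul_eq_mul,
    mul_zero, Prod.mk.injEq] at this
  obtain ⟨-, h1, h2⟩ := this
  have hs : s 0 = 0 := by linarith
  rw [hs] at h1
  rcases hne with h | h
  · exact h hs
  · exact h (by linarith)

lemma hasDerivAt_exp_mul (m t : ℝ) :
    HasDerivAt (fun t => Real.exp (m * t)) (m * Real.exp (m * t)) t := by
  simpa [mul_comm] using ((hasDerivAt_id t).const_mul m).exp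

lemma contDiff_exp_mul (m : ℝ) : ContDiff ℝ ∞ fun t => Real.exp (m * t) :=
  (contDiff_const.mul contDiff_id).exp

/-- Coefficients of the special form admit the additional symmetry with `s = e^{-2 μ t}`, `r = c s`
in the presence of a pole at `-c`, and with `s = 0`, `r = e^{-μ t}` in the affine case. -/
theorem not_isCase0_of_hasSpecialForm (h : HasSpecialForm L.F L.H L.I) : ¬L.IsCase0 := by
  rcases h with ⟨c, α, β, μ, h⟩ | ⟨μ, l, γ, h⟩
  · have hF : ∀ x ∈ L.I, deriv L.F x = -α * ((x + c) ^ 2)⁻¹ + μ := fun x hx => by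
      refine deriv_F_eq (fun y hy => (h y hy).2.1) hx ?_
      have h1 := (hasDerivAt_id x).add_const c
      refine (((h1.fun_inv (h x hx).1).const_mul α).fun_add (h1.const_mul μ)).congr_deriv ?_
      simp only [id]; field_simp
    have hH : ∀ x ∈ L.I, deriv L.H x = -2 * β * ((x + c) ^ 3)⁻¹ := fun x hx => by
      refine deriv_H_eq (fun y hy => (h y hy).2.2) hx ?_
      have h1 := ((hasDerivAt_id x).add_const c).fun_pow 2
      have hxc := (h x hx).1
      refine (((h1.fun_inv (pow_ne_zero 2 hxc)).const_mul β).add_const _).congr_deriv ?_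
      simp only [id]; field_simp; simp; ring
    have hR : ∀ k : ℝ, SymRel L.F L.H L.I k (c * k) (2 * μ * k) (2 * μ * c * k) := by
      intro k x hx
      obtain ⟨hxc, e1, e2⟩ := h x hx
      rw [hF x hx, hH x hx, e1, e2]
      constructor
      · field_simp; ring
      · field_simp; ring
    by_cases hμ : μ = 0
    · subst hμ
      refine not_isCase0_of_form (τ := fun t => 2 * t) (s := fun _ => 1) (r := fun _ => c)
        (s' := fun _ => 0) (r' := fun _ => 0) (contDiff_const.mul contDiff_id) contDiff_const
        contDiff_const (fun t => by simpa using (hasDerivAt_id t).const_mul 2)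
        (fun t => hasDerivAt_const t _) (fun t => hasDerivAt_const t _) (fun t => ?_) (by simp)
      simpa using hR 1
    · refine not_isCase0_of_form (τ := fun t => -μ⁻¹ * Real.exp (-2 * μ * t))
        (s := fun t => Real.exp (-2 * μ * t)) (r := fun t => c * Real.exp (-2 * μ * t))
        (contDiff_const.mul (contDiff_exp_mul _)) (contDiff_exp_mul _)
        (contDiff_const.mul (contDiff_exp_mul _))
        (fun t => ((hasDerivAt_exp_mul _ t).const_mul _).congr_deriv (by field_simp))
        (hasDerivAt_exp_mul _) (fun t => (hasDerivAt_exp_mul _ t).const_mul _) (fun t => ?_)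
        (by simp)
      convert hR (Real.exp (-2 * μ * t)) using 1 <;> ring
  · have hF : ∀ x ∈ L.I, deriv L.F x = μ := fun x hx => by
      refine deriv_F_eq (fun y hy => (h y hy).1) hx ?_
      simpa using ((hasDerivAt_id x).const_mul μ).add_const l
    have hH : ∀ x ∈ L.I, deriv L.H x = 0 := fun x hx =>
      deriv_H_eq (fun y hy => (h y hy).2) hx (hasDerivAt_const x γ)
    refine not_isCase0_of_form (τ := fun t => 0) (s := fun t => 0)
        (r := fun t => Real.exp (-μ * t)) (s' := fun _ => 0) contDiff_const contDiff_const
        (contDiff_exp_mul _) (fun t => by simpa using hasDerivAt_const t (0 : ℝ))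
        (fun t => hasDerivAt_const t _) (hasDerivAt_exp_mul _) (fun t x hx => ?_) (by simp)
    rw [hF x hx, hH x hx]
    constructor <;> ring

/-! ### The listed symmetry algebras -/

theorem hasListedBasis_case2 {α β : ℝ} (h : L.IsOfCase (.case2 α β)) :
    L.IsBasisOfAmax ![VField.dt, VField.scaling] := by
  obtain ⟨hαβ, h0, hF, hH⟩ := h
  have hx0 : ∀ x ∈ L.I, x ≠ 0 := fun x hx hx0 => h0 (hx0 ▸ hx)
  have dF : ∀ x ∈ L.I, deriv L.F x = -α * (x ^ 2)⁻¹ := fun x hx => by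
    refine deriv_F_eq hF hx (((hasDerivAt_inv (hx0 x hx)).const_mul α).congr_deriv ?_)
    ring
  have dH : ∀ x ∈ L.I, deriv L.H x = -2 * β * (x ^ 3)⁻¹ := fun x hx => by
    have hx' := hx0 x hx
    refine deriv_H_eq hH hx
      ((((hasDerivAt_pow 2 x).fun_inv (pow_ne_zero 2 hx')).const_mul β).congr_deriv ?_)
    field_simp; simp; ring
  have hR : ∀ s r a b : ℝ, SymRel L.F L.H L.I s r a b ↔ a = 0 ∧ b = 0 ∧ r = 0 := by
    intro s r a b
    constructor
    · intro h
      obtain ⟨ha, hb, -, hα⟩ := cubic_coeffs_eq_zero L.isOpen_I L.isConnected_I.nonempty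
        (a := a) (b := b) (c := 0) (d := r * α) fun x hx => by
          have e := (h x hx).1
          have hx' := hx0 x hx
          rw [dF x hx, hF hx] at e
          field_simp at e
          linear_combination -e
      obtain ⟨x, hx⟩ := L.isConnected_I.nonempty
      have e := (h x hx).2
      have hx' := hx0 x hx
      rw [dH x hx, hH hx, ha] at e
      have hβ : r * β = 0 := by
        field_simp at e
        ring_nf at e
        linarith
      refine ⟨ha, hb, ?_⟩
      by_contra hr
      exact hαβ ⟨(mul_eq_zero.1 hα).resolve_left hr, (mul_eq_zero.1 hβ).resolve_left hr⟩
    · rintro ⟨rfl, rfl, rfl⟩ x hx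
      have hx' := hx0 x hx
      rw [dF x hx, hF hx, dH x hx, hH hx]
      constructor
      · field_simp; ring
      · field_simp; ring
  refine ⟨fun Q => ⟨fun hQ => ?_, ?_⟩, ?_⟩
  · obtain ⟨τ, s, r, s', r', dτ, ds, dr, hform, hR'⟩ := hQ.exists_form
    simp only [hR, neg_eq_zero] at hR'
    have hs : ∀ t, s t = s 0 := fun t => by
      simpa using eq_add_mul_of_hasDerivAt_const (c := 0) (fun t => by
        simpa [(hR' t).1] using ds t) t
    have hτ : ∀ t, τ t = τ 0 + 2 * s 0 * t := eq_add_mul_of_hasDerivAt_const fun t => by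
      rw [← hs t]; exact dτ t
    refine ⟨![τ 0, s 0], fun p hp => ?_⟩
    rw [hform p hp, hs, (hR' p.1).2.2, hτ]
    simp [Fin.sum_univ_two, VField.dt, VField.scaling]
    constructor <;> ring
  · rintro ⟨c, hc⟩
    refine isLieSymmetry_of_form (τ := fun t => c 0 + 2 * c 1 * t) (s := fun _ => c 1)
      (r := fun _ => 0) (s' := fun _ => 0) (r' := fun _ => 0)
      (contDiff_const.add (contDiff_const.mul contDiff_id)) contDiff_const contDiff_const
      (fun t => by simpa using ((hasDerivAt_id t).const_mul (2 * c 1)).const_add (c 0))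
      (fun t => hasDerivAt_const t _) (fun t => hasDerivAt_const t _) (fun p hp => ?_)
      (fun t => (hR _ _ _ _).2 (by simp))
    rw [hc p hp]
    simp [Fin.sum_univ_two, VField.dt, VField.scaling]
    constructor <;> ring
  · intro c hc
    obtain ⟨x, hx⟩ := L.isConnected_I.nonempty
    have := hc (0, x, 0) hx
    simp [Fin.sum_univ_two, VField.dt, VField.scaling] at this
    ext i; fin_cases i
    · exact this.1
    · exact this.2.2

/-- The relations satisfied by `F = m x + l`, `H = γ`. -/
lemma symRel_of_affine {m l γ : ℝ} (h : L.HasCoeffs (fun x => m * x + l) fun _ => γ)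
    (s r a b : ℝ) :
    SymRel L.F L.H L.I s r a b ↔ a = 2 * m * s ∧ b = l * s + m * r ∧ a = γ * s := by
  have dF : ∀ x ∈ L.I, deriv L.F x = m := fun x hx => by
    refine deriv_F_eq h.1 hx ?_
    simpa using ((hasDerivAt_id x).const_mul m).add_const l
  have dH : ∀ x ∈ L.I, deriv L.H x = 0 := fun x hx => deriv_H_eq h.2 hx (hasDerivAt_const x γ)
  constructor
  · intro hR
    obtain ⟨-, -, h1, h2⟩ := cubic_coeffs_eq_zero L.isOpen_I L.isConnected_I.nonempty
        (a := 0) (b := 0) (c := 2 * m * s - a) (d := l * s + m * r - b) fun x hx => by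
          have e := (hR x hx).1
          rw [dF x hx, h.1 hx] at e
          linear_combination e
    obtain ⟨x, hx⟩ := L.isConnected_I.nonempty
    have e := (hR x hx).2
    rw [dH x hx, h.2 hx] at e
    exact ⟨by linarith, by linarith, by linarith⟩
  · rintro ⟨h1, h2, h3⟩ x hx
    rw [dF x hx, h.1 hx, dH x hx, h.2 hx]
    constructor
    · linear_combination -x * h1 - h2
    · linear_combination -2 * h3

theorem hasListedBasis_case3 {μ γ : ℝ} (h : L.IsOfCase (.case3 μ γ)) :
    L.IsBasisOfAmax ![VField.dt, VField.expShift μ] := by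
  obtain ⟨-, hγ, hL⟩ := h
  have hR := symRel_of_affine (L := L) (m := μ) (l := 0) (γ := γ) (by simpa using hL)
  refine ⟨fun Q => ⟨fun hQ => ?_, ?_⟩, ?_⟩
  · obtain ⟨τ, s, r, s', r', dτ, ds, dr, hform, hR'⟩ := hQ.exists_form
    simp only [hR] at hR'
    have hs : ∀ t, s t = 0 := fun t => by
      have : (γ - 2 * μ) * s t = 0 := by linarith [(hR' t).1, (hR' t).2.2]
      exact (mul_eq_zero.1 this).resolve_left (sub_ne_zero.2 hγ)
    have hτ : ∀ t, τ t = τ 0 := fun t => by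
      simpa using eq_add_mul_of_hasDerivAt_const (c := 0) (fun t => by
        simpa [hs t] using dτ t) t
    have hr : ∀ t, r t = r 0 * Real.exp (-μ * t) := fun t => by
      have := eq_add_mul_of_hasDerivAt_const (f := fun t => r t * Real.exp (μ * t)) (c := 0)
        (fun t => ((dr t).fun_mul (hasDerivAt_exp_mul μ t)).congr_deriv (by
          have h1 := (hR' t).2.1
          linear_combination (-Real.exp (μ * t)) * h1)) t
      simp only [mul_zero, Real.exp_zero, mul_one, zero_mul, add_zero] at this
      rw [← this, mul_assoc, ← Real.exp_add]
      simp
    refine ⟨![τ 0, r 0], fun p hp => ?_⟩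
    rw [hform p hp, hs, hτ, hr]
    simp [Fin.sum_univ_two, VField.dt, VField.expShift]
  · rintro ⟨c, hc⟩
    refine isLieSymmetry_of_form (τ := fun t => c 0) (s := fun _ => 0)
      (r := fun t => c 1 * Real.exp (-μ * t)) (s' := fun _ => 0)
      contDiff_const contDiff_const (contDiff_const.mul (contDiff_exp_mul _))
      (fun t => by simpa using hasDerivAt_const t (c 0))
      (fun t => hasDerivAt_const t _) (fun t => (hasDerivAt_exp_mul _ t).const_mul _)
      (fun p hp => ?_) (fun t => (hR _ _ _ _).2 ⟨by ring, by ring, by ring⟩)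
    rw [hc p hp]
    simp [Fin.sum_univ_two, VField.dt, VField.expShift]
  · intro c hc
    obtain ⟨x, hx⟩ := L.isConnected_I.nonempty
    have := hc (0, x, 0) hx
    simp [Fin.sum_univ_two, VField.dt, VField.expShift] at this
    ext i; fin_cases i
    · exact this.1
    · exact this.2

theorem hasListedBasis_case4 {γ : ℝ} (h : L.IsOfCase (.case4 γ)) :
    L.IsBasisOfAmax ![VField.dt, VField.dx] := by
  obtain ⟨hγ, hL⟩ := h
  have hR := symRel_of_affine (L := L) (m := 0) (l := 0) (γ := γ) (by simpa using hL)
  refine ⟨fun Q => ⟨fun hQ => ?_, ?_⟩, ?_⟩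
  · obtain ⟨τ, s, r, s', r', dτ, ds, dr, hform, hR'⟩ := hQ.exists_form
    simp only [hR] at hR'
    have hs : ∀ t, s t = 0 := fun t => by
      have : γ * s t = 0 := by linarith [(hR' t).1, (hR' t).2.2]
      exact (mul_eq_zero.1 this).resolve_left hγ
    have hτ : ∀ t, τ t = τ 0 := fun t => by
      simpa using eq_add_mul_of_hasDerivAt_const (c := 0) (fun t => by
        simpa [hs t] using dτ t) t
    have hr : ∀ t, r t = r 0 := fun t => by
      simpa using eq_add_mul_of_hasDerivAt_const (c := 0) (fun t => by
        have h1 : r' t = 0 := by linarith [(hR' t).2.1]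
        simpa [h1] using dr t) t
    refine ⟨![τ 0, r 0], fun p hp => ?_⟩
    rw [hform p hp, hs, hτ, hr]
    simp [Fin.sum_univ_two, VField.dt, VField.dx]
  · rintro ⟨c, hc⟩
    refine isLieSymmetry_of_form (τ := fun t => c 0) (s := fun _ => 0)
      (r := fun t => c 1) (s' := fun _ => 0) (r' := fun _ => 0)
      contDiff_const contDiff_const contDiff_const
      (fun t => by simpa using hasDerivAt_const t (c 0))
      (fun t => hasDerivAt_const t _) (fun t => hasDerivAt_const t _)
      (fun p hp => ?_) (fun t => (hR _ _ _ _).2 ⟨by ring, by ring, by ring⟩)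
    rw [hc p hp]
    simp [Fin.sum_univ_two, VField.dt, VField.dx]
  · intro c hc
    obtain ⟨x, hx⟩ := L.isConnected_I.nonempty
    have := hc (0, x, 0) hx
    simp [Fin.sum_univ_two, VField.dt, VField.dx] at this
    ext i; fin_cases i
    · exact this.1
    · exact this.2

theorem hasListedBasis_case6 (h : L.IsOfCase .case6) :
    L.IsBasisOfAmax ![VField.dt, VField.dx, VField.scaling] := by
  have hL : L.HasCoeffs (fun _ => 0) (fun _ => 0) := h
  have hR := symRel_of_affine (L := L) (m := 0) (l := 0) (γ := 0) (by simpa using hL)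
  refine ⟨fun Q => ⟨fun hQ => ?_, ?_⟩, ?_⟩
  · obtain ⟨τ, s, r, s', r', dτ, ds, dr, hform, hR'⟩ := hQ.exists_form
    simp only [hR] at hR'
    have hs : ∀ t, s t = s 0 := fun t => by
      simpa using eq_add_mul_of_hasDerivAt_const (c := 0) (fun t => by
        have h1 : s' t = 0 := by linarith [(hR' t).1]
        simpa [h1] using ds t) t
    have hτ : ∀ t, τ t = τ 0 + 2 * s 0 * t := eq_add_mul_of_hasDerivAt_const fun t => by
      rw [← hs t]; exact dτ t
    have hr : ∀ t, r t = r 0 := fun t => by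
      simpa using eq_add_mul_of_hasDerivAt_const (c := 0) (fun t => by
        have h1 : r' t = 0 := by linarith [(hR' t).2.1]
        simpa [h1] using dr t) t
    refine ⟨![τ 0, r 0, s 0], fun p hp => ?_⟩
    rw [hform p hp, hs, hτ, hr]
    simp [Fin.sum_univ_three, VField.dt, VField.dx, VField.scaling]
    exact ⟨by ring, by ring, by ring⟩
  · rintro ⟨c, hc⟩
    refine isLieSymmetry_of_form (τ := fun t => c 0 + 2 * c 2 * t) (s := fun _ => c 2)
      (r := fun _ => c 1) (s' := fun _ => 0) (r' := fun _ => 0)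
      (contDiff_const.add (contDiff_const.mul contDiff_id)) contDiff_const contDiff_const
      (fun t => by simpa using ((hasDerivAt_id t).const_mul (2 * c 2)).const_add (c 0))
      (fun t => hasDerivAt_const t _) (fun t => hasDerivAt_const t _) (fun p hp => ?_)
      (fun t => (hR _ _ _ _).2 ⟨by ring, by ring, by ring⟩)
    rw [hc p hp]
    simp [Fin.sum_univ_three, VField.dt, VField.dx, VField.scaling]
    exact ⟨by ring, by ring, by ring⟩
  · intro c hc
    obtain ⟨x, hx⟩ := L.isConnected_I.nonempty
    have := hc (0, x, 0) hx
    simp [Fin.sum_univ_three, VField.dt, VField.dx, VField.scaling] at this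
    obtain ⟨h0, h1, h2⟩ := this
    ext i; fin_cases i
    · exact h0
    · simpa [h2] using h1
    · exact h2

theorem hasListedBasis {c : ExtCase} (h : L.IsOfCase c) : L.HasListedBasis c := by
  cases c with
  | case2 α β => exact hasListedBasis_case2 h
  | case3 μ γ => exact hasListedBasis_case3 h
  | case4 γ => exact hasListedBasis_case4 h
  | case6 => exact hasListedBasis_case6 h

end Equation

/-! ### Construction of full point transformations -/

namespace Equation

/-- The map `(t, x, v) ↦ (θ(t), δ(t) x + χ(t), v - ν(t))` with `θ' = δ² = e^ν` is a full point
transformation from `L` to the equation with coefficients `F'`, `H'` as soon as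
`F = (δ' x + χ') / δ + δ F'(δ x + χ)` and `H = 2 δ' / δ + δ² H'(δ x + χ)`. Here `θi` is the inverse
of `θ`. -/
theorem exists_isFullPointTransformation (L : Equation) {θ θi δ δ' χ χ' ν F' H' : ℝ → ℝ}
    (cθ : ContDiff ℝ ∞ θ) (cδ : ContDiff ℝ ∞ δ) (cχ : ContDiff ℝ ∞ χ) (cν : ContDiff ℝ ∞ ν)
    (hΩ : IsOpen (range θ)) (cθi : ContDiffOn ℝ ∞ θi (range θ)) (hinv : ∀ t, θi (θ t) = t)
    (dθ : ∀ t, HasDerivAt θ (δ t ^ 2) t) (hδ : ∀ t, δ t ≠ 0)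
    (dδ : ∀ t, HasDerivAt δ (δ' t) t) (dχ : ∀ t, HasDerivAt χ (χ' t) t)
    (hν : ∀ t, Real.exp (ν t) = δ t ^ 2)
    (cF : ContDiffOn ℝ ∞ F' {y | ∃ t, ∃ x ∈ L.I, y = δ t * x + χ t})
    (cH : ContDiffOn ℝ ∞ H' {y | ∃ t, ∃ x ∈ L.I, y = δ t * x + χ t})
    (hF : ∀ t, ∀ x ∈ L.I, L.F x = (δ' t * x + χ' t) / δ t + δ t * F' (δ t * x + χ t))
    (hH : ∀ t, ∀ x ∈ L.I, L.H x = 2 * δ' t / δ t + δ t ^ 2 * H' (δ t * x + χ t)) :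
    ∃ (L' : Equation) (Φ : OpenPartialHomeomorph Pt Pt), L'.F = F' ∧ L'.H = H' ∧ L'.ε = L.ε ∧
      L'.I = {y | ∃ t, ∃ x ∈ L.I, y = δ t * x + χ t} ∧ L.IsFullPointTransformation L' Φ ∧
      ∀ p, Φ p = (θ p.1, δ p.1 * p.2.1 + χ p.1, p.2.2 - ν p.1) := by
  have hU := L.isOpen_domain
  have dν : ∀ t, HasDerivAt ν (2 * δ' t / δ t) t := fun t => by
    have h1 : ν = fun t => Real.log (δ t ^ 2) := by
      ext s; rw [← hν s, Real.log_exp]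
    rw [h1]
    refine (((dδ t).fun_pow 2).log (pow_ne_zero 2 (hδ t))).congr_deriv ?_
    have := hδ t
    field_simp
    simp; ring
  let f : Pt → Pt := fun p => (θ p.1, δ p.1 * p.2.1 + χ p.1, p.2.2 - ν p.1)
  let g : Pt → Pt := fun q => (θi q.1, (q.2.1 - χ (θi q.1)) / δ (θi q.1), q.2.2 + ν (θi q.1))
  have cf : ContDiff ℝ ∞ f := by
    have h1 : ContDiff ℝ ∞ fun p : Pt => θ p.1 := cθ.comp contDiff_fst
    have h2 : ContDiff ℝ ∞ fun p : Pt => δ p.1 := cδ.comp contDiff_fst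
    have h3 : ContDiff ℝ ∞ fun p : Pt => χ p.1 := cχ.comp contDiff_fst
    have h4 : ContDiff ℝ ∞ fun p : Pt => ν p.1 := cν.comp contDiff_fst
    exact h1.prodMk (((h2.mul contDiff_snd.fst).add h3).prodMk (contDiff_snd.snd.sub h4))
  have cg : ContDiffOn ℝ ∞ g {q | q.1 ∈ range θ} := by
    have h0 : ContDiffOn ℝ ∞ (fun q : Pt => θi q.1) {q | q.1 ∈ range θ} :=
      cθi.comp contDiff_fst.contDiffOn fun q hq => hq
    have h2 := cδ.comp_contDiffOn h0
    have h3 := cχ.comp_contDiffOn h0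
    have h4 := cν.comp_contDiffOn h0
    exact h0.prodMk (((contDiff_snd.fst.contDiffOn.sub h3).div h2 fun q _ => hδ _).prodMk
      (contDiff_snd.snd.contDiffOn.add h4))
  have hΩ' : IsOpen {q : Pt | q.1 ∈ range θ} := hΩ.preimage continuous_fst
  have gf : ∀ p, g (f p) = p := by
    rintro ⟨t, x, v⟩
    simp only [f, g, hinv]
    have := hδ t
    refine Prod.ext rfl (Prod.ext ?_ ?_)
    · simp only; field_simp; ring
    · simp only; ring
  have fg : ∀ q : Pt, q.1 ∈ range θ → f (g q) = q := by
    rintro ⟨T, X, V⟩ ⟨t, ht⟩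
    simp only at ht
    subst ht
    simp only [f, g, hinv]
    have := hδ t
    refine Prod.ext rfl (Prod.ext ?_ ?_)
    · simp only; field_simp; ring
    · simp only; ring
  have memf : ∀ p, (f p).1 ∈ range θ := fun p => ⟨p.1, rfl⟩
  let Φ : OpenPartialHomeomorph Pt Pt :=
    { toFun := f
      invFun := g
      source := L.domain
      target := {q | q.1 ∈ range θ} ∩ g ⁻¹' L.domain
      map_source' := fun p hp => ⟨memf p, by simpa only [mem_preimage, gf p] using hp⟩
      map_target' := fun q hq => hq.2
      left_inv' := fun p _ => gf p
      right_inv' := fun q hq => fg q hq.1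
      open_source := hU
      open_target := cg.continuousOn.isOpen_inter_preimage hΩ' hU
      continuousOn_toFun := cf.continuous.continuousOn
      continuousOn_invFun := cg.continuousOn.mono inter_subset_left }
  have himg : (fun p : Pt => p.2.1) '' Φ.target = {y | ∃ t, ∃ x ∈ L.I, y = δ t * x + χ t} := by
    ext y
    constructor
    · rintro ⟨q, hq, rfl⟩
      have h1 := fg q hq.1
      exact ⟨(g q).1, (g q).2.1, hq.2, by rw [← h1]; simp only [f, h1]⟩
    · rintro ⟨t, x, hx, rfl⟩
      exact ⟨f (t, x, 0), Φ.map_source (x := (t, x, 0)) hx, rfl⟩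
  have hopen : IsOpen {y | ∃ t, ∃ x ∈ L.I, y = δ t * x + χ t} := by
    rw [← himg]
    have h1 : IsOpenMap fun p : Pt => p.2.1 := isOpenMap_fst.comp isOpenMap_snd
    exact h1 _ Φ.open_target
  have hconn : IsConnected {y | ∃ t, ∃ x ∈ L.I, y = δ t * x + χ t} := by
    have h1 : IsConnected (univ ×ˢ L.I : Set (ℝ × ℝ)) := isConnected_univ.prod L.isConnected_I
    have h2 : Continuous fun p : ℝ × ℝ => δ p.1 * p.2 + χ p.1 :=
      ((cδ.continuous.comp continuous_fst).mul continuous_snd).add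
        (cχ.continuous.comp continuous_fst)
    convert h1.image _ h2.continuousOn using 1
    ext y
    constructor
    · rintro ⟨t, x, hx, rfl⟩
      exact ⟨(t, x), ⟨mem_univ _, hx⟩, rfl⟩
    · rintro ⟨⟨t, x⟩, ⟨-, hx⟩, rfl⟩
      exact ⟨t, x, hx, rfl⟩
  let L' : Equation := ⟨_, hopen, hconn, F', H', cF, cH, L.ε, L.sign_ε⟩
  refine ⟨L', Φ, rfl, rfl, rfl, rfl, ⟨⟨?_, subset_rfl, ?_, cf.contDiffOn, cg.mono inter_subset_left,
    ?_⟩, rfl, himg⟩, fun p => rfl⟩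
  · obtain ⟨x, hx⟩ := L.isConnected_I.nonempty
    exact ⟨(0, x, 0), hx⟩
  · intro q hq
    change q.2.1 ∈ {y | ∃ t, ∃ x ∈ L.I, y = δ t * x + χ t}
    rw [← himg]
    exact ⟨q, hq, rfl⟩
  intro p hp j k _ hk
  have z : ∀ t : ℝ, HasDerivAt (fun _ : ℝ => (0 : ℝ)) 0 t := fun t => hasDerivAt_const t 0
  obtain ⟨t1, t2, t3⟩ := pd_eqOn_affine hU (φ := fun q => (Φ q).1) (a := fun _ => 0) (m := 0) z dθ
    (fun q _ => by change θ q.1 = _; ring)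
  obtain ⟨x1, x2, x3⟩ := pd_eqOn_affine hU (φ := fun q => (Φ q).2.1) (m := 0) dδ dχ
    (fun q _ => by change δ q.1 * q.2.1 + χ q.1 = _; ring)
  obtain ⟨e1, e2, e3⟩ := pd_eqOn_affine hU (φ := fun q => (Φ q).2.2) (a := fun _ => 0)
    (b := fun t => -ν t) (m := 1) z (fun t => (dν t).fun_neg)
    (fun q _ => by change q.2.2 - ν q.1 = _; ring)
  obtain ⟨-, x22, -⟩ := pd_eqOn_affine hU (φ := pdx fun q => (Φ q).2.1) (a := fun _ => 0) (m := 0)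
    z dδ (fun q hq => by simp [x2 hq])
  have t22 := pdx_eqOn_zero hU t2 p hp
  have e22 := pdx_eqOn_zero hU e2 p hp
  have t32 := pdx_eqOn_zero hU t3 p hp
  have t33 := pdv_eqOn_zero hU t3 p hp
  have x32 := pdx_eqOn_zero hU x3 p hp
  have x33 := pdv_eqOn_zero hU x3 p hp
  have e32 := pdx_eqOn_zero hU e3 p hp
  have e33 := pdv_eqOn_zero hU e3 p hp
  obtain ⟨h1, h2, -, -, h5⟩ := hk
  simp only [Dt, Dx, Dxx, t1 hp, t2 hp, t3 hp, x1 hp, x2 hp, x3 hp, e1 hp, e2 hp, e3 hp, t22,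
    x22 hp, e22, t32, x32, e32, t33, x33, e33] at h1 h2 h5
  have hF1 := hF p.1 p.2.1 hp
  have hH1 := hH p.1 p.2.1 hp
  have hexp : Real.exp (p.2.2 - ν p.1) * δ p.1 ^ 2 = Real.exp p.2.2 := by
    rw [← hν, ← Real.exp_add]; simp
  change j.vt = j.vxx + L.F p.2.1 * j.vx + L.ε * Real.exp p.2.2 + L.H p.2.1 ↔
    k.vt = k.vxx + F' (δ p.1 * p.2.1 + χ p.1) * k.vx + L.ε * Real.exp (p.2.2 - ν p.1)
      + H' (δ p.1 * p.2.1 + χ p.1)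
  have hd := hδ p.1
  -- `δ²` times the equation in the new variables is the old equation
  have key : (k.vt - (k.vxx + F' (δ p.1 * p.2.1 + χ p.1) * k.vx
      + L.ε * Real.exp (p.2.2 - ν p.1) + H' (δ p.1 * p.2.1 + χ p.1))) * δ p.1 ^ 2
      = j.vt - (j.vxx + L.F p.2.1 * j.vx + L.ε * Real.exp p.2.2 + L.H p.2.1) := by
    rw [hF1, hH1, ← hexp]
    have hvx : j.vx = k.vx * δ p.1 := by linarith
    have hvxx : j.vxx = k.vxx * δ p.1 ^ 2 := by linarith
    have hvt : j.vt = k.vt * δ p.1 ^ 2 + k.vx * (δ' p.1 * p.2.1 + χ' p.1)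
      + 2 * δ' p.1 / δ p.1 := by linarith
    rw [hvx, hvxx, hvt]
    field_simp
    ring
  rw [← sub_eq_zero, ← key, mul_eq_zero, sub_eq_zero]
  simp [hd]

/-- Affine changes of `t` and `x`, including the Galilean boosts `l t`. -/
lemma exists_affine_transformation (L : Equation) {d l e : ℝ} (hd : d ≠ 0) {F' H' : ℝ → ℝ}
    (cF : ContDiffOn ℝ ∞ F' {y | ∃ t, ∃ x ∈ L.I, y = d * x + (l * t + e)})
    (cH : ContDiffOn ℝ ∞ H' {y | ∃ t, ∃ x ∈ L.I, y = d * x + (l * t + e)})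
    (hF : ∀ t, ∀ x ∈ L.I, L.F x = l / d + d * F' (d * x + (l * t + e)))
    (hH : ∀ t, ∀ x ∈ L.I, L.H x = d ^ 2 * H' (d * x + (l * t + e))) :
    ∃ (L' : Equation) (Φ : OpenPartialHomeomorph Pt Pt), L'.F = F' ∧ L'.H = H' ∧ L'.ε = L.ε ∧
      L'.I = {y | ∃ t, ∃ x ∈ L.I, y = d * x + (l * t + e)} ∧ L.IsFullPointTransformation L' Φ ∧
      ∀ p, Φ p = (d ^ 2 * p.1, d * p.2.1 + (l * p.1 + e), p.2.2 - Real.log (d ^ 2)) := by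
  have hd2 : d ^ 2 ≠ 0 := pow_ne_zero 2 hd
  have hrange : range (fun t => d ^ 2 * t) = univ :=
    range_eq_univ.2 fun y => ⟨y / d ^ 2, mul_div_cancel₀ y hd2⟩
  refine L.exists_isFullPointTransformation (θ := fun t => d ^ 2 * t) (θi := fun y => y / d ^ 2)
    (δ := fun _ => d) (δ' := fun _ => 0) (χ := fun t => l * t + e) (χ' := fun _ => l)
    (ν := fun _ => Real.log (d ^ 2)) (contDiff_const.mul contDiff_id) contDiff_const
    ((contDiff_const.mul contDiff_id).add contDiff_const) contDiff_const
    (by rw [hrange]; exact isOpen_univ)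
    (contDiff_id.div_const _).contDiffOn (fun t => mul_div_cancel_left₀ t hd2)
    (fun t => by simpa using (hasDerivAt_id t).const_mul (d ^ 2)) (fun _ => hd)
    (fun t => hasDerivAt_const t d)
    (fun t => by simpa using ((hasDerivAt_id t).const_mul l).add_const e)
    (fun t => Real.exp_log (by positivity)) cF cH (fun t x hx => ?_) (fun t x hx => ?_)
  · rw [hF t x hx]; simp
  · rw [hH t x hx]; simp

/-- The transformations `expMap μ`, preceded by a translation of `x`. -/
lemma exists_exp_transformation (L : Equation) {μ c : ℝ} (hμ : μ ≠ 0) {F' H' : ℝ → ℝ}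
    (cF : ContDiffOn ℝ ∞ F'
      {y | ∃ t, ∃ x ∈ L.I, y = Real.exp (μ * t) * x + c * Real.exp (μ * t)})
    (cH : ContDiffOn ℝ ∞ H'
      {y | ∃ t, ∃ x ∈ L.I, y = Real.exp (μ * t) * x + c * Real.exp (μ * t)})
    (hF : ∀ t, ∀ x ∈ L.I, L.F x = μ * (x + c) +
      Real.exp (μ * t) * F' (Real.exp (μ * t) * x + c * Real.exp (μ * t)))
    (hH : ∀ t, ∀ x ∈ L.I, L.H x = 2 * μ +
      Real.exp (μ * t) ^ 2 * H' (Real.exp (μ * t) * x + c * Real.exp (μ * t))) :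
    ∃ (L' : Equation) (Φ : OpenPartialHomeomorph Pt Pt), L'.F = F' ∧ L'.H = H' ∧ L'.ε = L.ε ∧
      L'.I = {y | ∃ t, ∃ x ∈ L.I, y = Real.exp (μ * t) * x + c * Real.exp (μ * t)} ∧
      L.IsFullPointTransformation L' Φ ∧
      ∀ p, Φ p = (Real.exp (2 * μ * p.1) / (2 * μ),
        Real.exp (μ * p.1) * p.2.1 + c * Real.exp (μ * p.1), p.2.2 - 2 * μ * p.1) := by
  have hμ2 : 2 * μ ≠ 0 := mul_ne_zero two_ne_zero hμ
  have hsq : ∀ t, Real.exp (μ * t) ^ 2 = Real.exp (2 * μ * t) := fun t => by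
    rw [← Real.exp_nat_mul]; congr 1; push_cast; ring
  have hrange : range (fun t => Real.exp (2 * μ * t) / (2 * μ)) = {y | 0 < 2 * μ * y} := by
    ext y
    constructor
    · rintro ⟨t, rfl⟩
      simp only [mem_ofPred_eq]
      rw [mul_div_cancel₀ _ hμ2]
      positivity
    · intro hy
      refine ⟨Real.log (2 * μ * y) / (2 * μ), ?_⟩
      simp only
      rw [mul_div_cancel₀ _ hμ2, Real.exp_log hy]
      field_simp
  refine L.exists_isFullPointTransformation (θ := fun t => Real.exp (2 * μ * t) / (2 * μ))
    (θi := fun y => Real.log (2 * μ * y) / (2 * μ))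
    (δ := fun t => Real.exp (μ * t)) (δ' := fun t => μ * Real.exp (μ * t))
    (χ := fun t => c * Real.exp (μ * t)) (χ' := fun t => c * (μ * Real.exp (μ * t)))
    (ν := fun t => 2 * μ * t) ((contDiff_exp_mul _).div_const _) (contDiff_exp_mul _)
    (contDiff_const.mul (contDiff_exp_mul _)) (contDiff_const.mul contDiff_id)
    ?_ ?_ ?_ ?_ (fun _ => Real.exp_ne_zero _) (hasDerivAt_exp_mul _)
    (fun t => (hasDerivAt_exp_mul _ t).const_mul c) (fun t => (hsq t).symm) cF cH
    (fun t x hx => ?_) (fun t x hx => ?_)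
  · rw [hrange]
    exact isOpen_lt continuous_const (continuous_const.mul continuous_id)
  · rw [hrange]
    exact ((contDiff_const.mul contDiff_id).contDiffOn.log fun y hy => ne_of_gt hy).div_const _
  · intro t
    rw [mul_div_cancel₀ _ hμ2, Real.log_exp]
    field_simp
  · intro t
    rw [hsq]
    exact ((hasDerivAt_exp_mul (2 * μ) t).div_const _).congr_deriv (by field_simp)
  · rw [hF t x hx]
    have := Real.exp_ne_zero (μ * t)
    field_simp
  · rw [hH t x hx]
    have := Real.exp_ne_zero (μ * t)
    field_simp

lemma contDiffOn_const_mul_inv {α : ℝ} {S : Set ℝ} (h : ∀ y ∈ S, y ≠ 0) :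
    ContDiffOn ℝ ∞ (fun x => α * x⁻¹) S :=
  contDiffOn_const.mul (contDiffOn_id.inv h)

lemma contDiffOn_const_mul_sq_inv {β : ℝ} {S : Set ℝ} (h : ∀ y ∈ S, y ≠ 0) :
    ContDiffOn ℝ ∞ (fun x => β * (x ^ 2)⁻¹) S :=
  contDiffOn_const.mul ((contDiffOn_id.pow 2).inv fun y hy => pow_ne_zero 2 (h y hy))

/-- Removal of the linear part of `F` in the presence of a pole. -/
lemma exists_case2_of_exp (L : Equation) {α β μ c : ℝ} (hμ : μ ≠ 0) (hαβ : ¬(α = 0 ∧ β = 0))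
    (h : ∀ x ∈ L.I, x + c ≠ 0 ∧ L.F x = α * (x + c)⁻¹ + μ * (x + c) ∧
      L.H x = β * ((x + c) ^ 2)⁻¹ + 2 * μ) :
    ∃ (L' : Equation) (Φ : OpenPartialHomeomorph Pt Pt),
      L'.IsOfCase (.case2 α β) ∧ L'.ε = L.ε ∧ L.IsFullPointTransformation L' Φ ∧
      ∀ p, Φ p = (Real.exp (2 * μ * p.1) / (2 * μ),
        Real.exp (μ * p.1) * p.2.1 + c * Real.exp (μ * p.1), p.2.2 - 2 * μ * p.1) := by
  have h0 : ∀ y ∈ {y | ∃ t, ∃ x ∈ L.I, y = Real.exp (μ * t) * x + c * Real.exp (μ * t)},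
      y ≠ 0 := by
    rintro y ⟨t, x, hx, rfl⟩
    rw [show Real.exp (μ * t) * x + c * Real.exp (μ * t) = Real.exp (μ * t) * (x + c) by ring]
    exact mul_ne_zero (Real.exp_ne_zero _) (h x hx).1
  obtain ⟨L', Φ, eF, eH, eε, eI, hfull, hΦ⟩ := L.exists_exp_transformation (c := c) hμ
    (F' := fun x => α * x⁻¹) (H' := fun x => β * (x ^ 2)⁻¹) (contDiffOn_const_mul_inv h0)
    (contDiffOn_const_mul_sq_inv h0)
    (fun t x hx => by
      obtain ⟨hx0, e1, -⟩ := h x hx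
      have := Real.exp_ne_zero (μ * t)
      rw [e1, show Real.exp (μ * t) * x + c * Real.exp (μ * t) = Real.exp (μ * t) * (x + c) by ring]
      field_simp; ring)
    (fun t x hx => by
      obtain ⟨hx0, -, e2⟩ := h x hx
      have := Real.exp_ne_zero (μ * t)
      rw [e2, show Real.exp (μ * t) * x + c * Real.exp (μ * t) = Real.exp (μ * t) * (x + c) by ring]
      field_simp; ring)
  refine ⟨L', Φ, ⟨hαβ, fun h1 => ?_, ?_, ?_⟩, eε, hfull, hΦ⟩
  · rw [eI] at h1; exact h0 0 h1 rfl
  · rw [eF]; exact fun x _ => rfl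
  · rw [eH]; exact fun x _ => rfl

lemma exists_case6_of_exp (L : Equation) {μ c : ℝ} (hμ : μ ≠ 0)
    (h : ∀ x ∈ L.I, L.F x = μ * (x + c) ∧ L.H x = 2 * μ) :
    ∃ (L' : Equation) (Φ : OpenPartialHomeomorph Pt Pt),
      L'.IsOfCase .case6 ∧ L'.ε = L.ε ∧ L.IsFullPointTransformation L' Φ ∧
      ∀ p, Φ p = (Real.exp (2 * μ * p.1) / (2 * μ),
        Real.exp (μ * p.1) * p.2.1 + c * Real.exp (μ * p.1), p.2.2 - 2 * μ * p.1) := by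
  obtain ⟨L', Φ, eF, eH, eε, eI, hfull, hΦ⟩ := L.exists_exp_transformation (c := c) hμ
    (F' := fun _ => 0) (H' := fun _ => 0) contDiffOn_const contDiffOn_const
    (fun t x hx => by rw [(h x hx).1]; ring) (fun t x hx => by rw [(h x hx).2]; ring)
  refine ⟨L', Φ, ⟨?_, ?_⟩, eε, hfull, hΦ⟩
  · rw [eF]; exact fun x _ => rfl
  · rw [eH]; exact fun x _ => rfl

lemma exists_galilei (L : Equation) {l γ : ℝ} (h : L.HasCoeffs (fun _ => l) fun _ => γ) :
    ∃ (L' : Equation) (Φ : OpenPartialHomeomorph Pt Pt),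
      (γ ≠ 0 → L'.IsOfCase (.case4 γ)) ∧ (γ = 0 → L'.IsOfCase .case6) ∧ L'.ε = L.ε ∧
      L.IsFullPointTransformation L' Φ ∧ EqOn Φ (galileiMap l) Φ.source := by
  obtain ⟨L', Φ, eF, eH, eε, eI, hfull, hΦ⟩ := L.exists_affine_transformation (d := 1) (l := l)
    (e := 0) one_ne_zero (F' := fun _ => 0) (H' := fun _ => γ) contDiffOn_const contDiffOn_const
    (fun t x hx => by rw [h.1 hx]; ring) (fun t x hx => by rw [h.2 hx]; ring)
  have h1 : L'.HasCoeffs (fun _ => 0) fun _ => γ :=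
    ⟨by rw [eF]; exact fun x _ => rfl, by rw [eH]; exact fun x _ => rfl⟩
  refine ⟨L', Φ, fun hγ => ⟨hγ, h1⟩, ?_, eε, hfull, fun p _ => ?_⟩
  · rintro rfl; exact h1
  · rw [hΦ p]; simp [galileiMap]

/-- Equations with coefficients of the special form are mapped to the list. -/
theorem exists_transformation_of_hasSpecialForm (L : Equation)
    (h : HasSpecialForm L.F L.H L.I) :
    ∃ (c : ExtCase) (L' : Equation) (Φ : OpenPartialHomeomorph Pt Pt),
      L'.IsOfCase c ∧ L'.ε = L.ε ∧ L.IsFullPointTransformation L' Φ := by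
  have affine : ∀ μ l γ : ℝ, (∀ x ∈ L.I, L.F x = μ * x + l ∧ L.H x = γ) →
      ∃ (c : ExtCase) (L' : Equation) (Φ : OpenPartialHomeomorph Pt Pt),
        L'.IsOfCase c ∧ L'.ε = L.ε ∧ L.IsFullPointTransformation L' Φ := by
    intro μ l γ h
    by_cases hμ : μ = 0
    · obtain ⟨L', Φ, h4, h6, hε, hfull, -⟩ := L.exists_galilei (l := l) (γ := γ)
        ⟨fun x hx => by rw [(h x hx).1, hμ]; ring, fun x hx => (h x hx).2⟩
      by_cases hγ : γ = 0
      · exact ⟨_, L', Φ, h6 hγ, hε, hfull⟩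
      · exact ⟨_, L', Φ, h4 hγ, hε, hfull⟩
    by_cases hγ : γ = 2 * μ
    · obtain ⟨L', Φ, h6, hε, hfull, -⟩ := L.exists_case6_of_exp (c := l / μ) hμ
        fun x hx => ⟨by rw [(h x hx).1]; field_simp, by rw [(h x hx).2, hγ]⟩
      exact ⟨_, L', Φ, h6, hε, hfull⟩
    · -- the scaling with `δ² = |μ|` normalizes `μ` to its sign `|μ|⁻¹ μ`
      have habs : 0 < |μ| := abs_pos.2 hμ
      have hd : √|μ| ≠ 0 := (Real.sqrt_pos.2 habs).ne'
      have hd2 : √|μ| ^ 2 = |μ| := Real.sq_sqrt habs.le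
      obtain ⟨L', Φ, eF, eH, eε, eI, hfull, -⟩ := L.exists_affine_transformation (d := √|μ|)
        (l := 0) (e := √|μ| * (l / μ)) hd (F' := fun x => |μ|⁻¹ * μ * x)
        (H' := fun _ => |μ|⁻¹ * γ)
        (contDiffOn_const.mul contDiffOn_id) contDiffOn_const
        (fun t x hx => by
          have : √|μ| * (|μ|⁻¹ * μ * (√|μ| * x + (0 * t + √|μ| * (l / μ))))
              = √|μ| ^ 2 * |μ|⁻¹ * (μ * x + μ * (l / μ)) := by ring
          rw [(h x hx).1, this, hd2, mul_inv_cancel₀ habs.ne', mul_div_cancel₀ _ hμ]; ring)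
        (fun t x hx => by
          rw [(h x hx).2, hd2, mul_inv_cancel_left₀ habs.ne'])
      refine ⟨.case3 (|μ|⁻¹ * μ) (|μ|⁻¹ * γ), L', Φ, ⟨?_, ?_, ?_, ?_⟩, eε, hfull⟩
      · rcases lt_or_gt_of_ne hμ with h1 | h1
        · right; rw [abs_of_neg h1]; field_simp
        · left; rw [abs_of_pos h1]; field_simp
      · intro h1
        apply hγ
        have h2 : |μ|⁻¹ * γ = |μ|⁻¹ * (2 * μ) := by linarith
        exact mul_left_cancel₀ (inv_ne_zero habs.ne') h2
      · rw [eF]; exact fun x _ => rfl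
      · rw [eH]; exact fun x _ => rfl
  rcases h with ⟨c, α, β, μ, h⟩ | ⟨μ, l, γ, h⟩
  · by_cases hαβ : α = 0 ∧ β = 0
    · refine affine μ (μ * c) (2 * μ) fun x hx => ?_
      obtain ⟨-, e1, e2⟩ := h x hx
      rw [e1, e2, hαβ.1, hαβ.2]
      constructor <;> ring
    by_cases hμ : μ = 0
    · have h0 : ∀ y ∈ {y | ∃ t, ∃ x ∈ L.I, y = 1 * x + (0 * t + c)}, y ≠ 0 := by
        rintro y ⟨t, x, hx, rfl⟩
        simpa using (h x hx).1
      obtain ⟨L', Φ, eF, eH, eε, eI, hfull, -⟩ := L.exists_affine_transformation (d := 1)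
        (l := 0) (e := c) one_ne_zero (F' := fun x => α * x⁻¹) (H' := fun x => β * (x ^ 2)⁻¹)
        (contDiffOn_const_mul_inv h0) (contDiffOn_const_mul_sq_inv h0)
        (fun t x hx => by rw [(h x hx).2.1, hμ]; simp)
        (fun t x hx => by rw [(h x hx).2.2, hμ]; simp)
      refine ⟨.case2 α β, L', Φ, ⟨hαβ, fun h1 => ?_, ?_, ?_⟩, eε, hfull⟩
      · rw [eI] at h1; exact h0 0 h1 rfl
      · rw [eF]; exact fun x _ => rfl
      · rw [eH]; exact fun x _ => rfl
    · obtain ⟨L', Φ, h2, hε, hfull, -⟩ := L.exists_case2_of_exp hμ hαβ h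
      exact ⟨_, L', Φ, h2, hε, hfull⟩
  · exact affine μ l γ h

end Equation

/-! ### Determining equations of point transformations -/

/-- The first component `T` of a map of the `(t, x, v)`-space. -/
def compT (f : Pt → Pt) (p : Pt) : ℝ := (f p).1

/-- The second component `X` of a map of the `(t, x, v)`-space. -/
def compX (f : Pt → Pt) (p : Pt) : ℝ := (f p).2.1

/-- The third component `V` of a map of the `(t, x, v)`-space. -/
def compV (f : Pt → Pt) (p : Pt) : ℝ := (f p).2.2

/-- The Jacobian determinant of a map of the `(t, x, v)`-space. -/
def jacobian (f : Pt → Pt) (p : Pt) : ℝ :=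
  pdt (compT f) p * (pdx (compX f) p * pdv (compV f) p - pdv (compX f) p * pdx (compV f) p)
    - pdx (compT f) p * (pdt (compX f) p * pdv (compV f) p - pdv (compX f) p * pdt (compV f) p)
    + pdv (compT f) p * (pdt (compX f) p * pdx (compV f) p - pdx (compX f) p * pdt (compV f) p)

/-- At a transversal jet the equations of the prolongation can be solved for the new jet, by
inverting the total Jacobian matrix of `(T, X)`. -/
lemma exists_prolongs {f : Pt → Pt} {p : Pt} {j : Jet} (h : Transversal f p j) :
    ∃ k, Prolongs f p j k := by
  have solve₁ : ∀ a b c d P R : ℝ, a * d - b * c ≠ 0 →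
      ∃ m n : ℝ, P = m * a + n * c ∧ R = m * b + n * d := by
    intro a b c d P R hΔ
    refine ⟨(P * d - R * c) / (a * d - b * c), (a * R - b * P) / (a * d - b * c), ?_, ?_⟩
    · rw [div_mul_eq_mul_div, div_mul_eq_mul_div, ← add_div, eq_div_iff hΔ]; ring
    · rw [div_mul_eq_mul_div, div_mul_eq_mul_div, ← add_div, eq_div_iff hΔ]; ring
  have solve₂ : ∀ a b c d A B C : ℝ, a * d - b * c ≠ 0 → ∃ m n q : ℝ,
      A = m * a ^ 2 + 2 * n * a * c + q * c ^ 2 ∧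
      B = m * a * b + n * (a * d + b * c) + q * c * d ∧
      C = m * b ^ 2 + 2 * n * b * d + q * d ^ 2 := by
    intro a b c d A B C hΔ
    obtain ⟨w, hw⟩ : ∃ w, w * (a * d - b * c) = 1 := ⟨_, inv_mul_cancel₀ hΔ⟩
    have hw2 : w ^ 2 * (a * d - b * c) ^ 2 = 1 := by rw [← mul_pow, hw, one_pow]
    refine ⟨(A * d ^ 2 - 2 * B * c * d + C * c ^ 2) * w ^ 2,
      (-A * b * d + B * (a * d + b * c) - C * a * c) * w ^ 2,
      (A * b ^ 2 - 2 * B * a * b + C * a ^ 2) * w ^ 2, ?_, ?_, ?_⟩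
    · linear_combination -A * hw2
    · linear_combination -B * hw2
    · linear_combination -C * hw2
  obtain ⟨kt, kx, h1, h2⟩ := solve₁ _ _ _ _ (Dt (fun q => (f q).2.2) p j)
    (Dx (fun q => (f q).2.2) p j) h
  obtain ⟨ktt, ktx, kxx, h3, h4, h5⟩ := solve₂ _ _ _ _
    (Dtt (fun q => (f q).2.2) p j - kt * Dtt (fun q => (f q).1) p j
      - kx * Dtt (fun q => (f q).2.1) p j)
    (Dtx (fun q => (f q).2.2) p j - kt * Dtx (fun q => (f q).1) p j
      - kx * Dtx (fun q => (f q).2.1) p j)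
    (Dxx (fun q => (f q).2.2) p j - kt * Dxx (fun q => (f q).1) p j
      - kx * Dxx (fun q => (f q).2.1) p j) h
  refine ⟨⟨kt, kx, ktt, ktx, kxx⟩, h1, h2, ?_, ?_, ?_⟩
  · linear_combination h3
  · linear_combination h4
  · linear_combination h5

/-- The contact condition: the Jacobian is the transversality determinant times the coefficient
with which the second derivatives of `v` enter. -/
lemma Prolongs.jacobian_eq {f : Pt → Pt} {p : Pt} {j k : Jet} (h : Prolongs f p j k) :
    (pdv (compV f) p - k.vt * pdv (compT f) p - k.vx * pdv (compX f) p) *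
      (Dt (compT f) p j * Dx (compX f) p j - Dx (compT f) p j * Dt (compX f) p j)
      = jacobian f p := by
  obtain ⟨h1, h2, -⟩ := h
  change Dt (compV f) p j = k.vt * Dt (compT f) p j + k.vx * Dt (compX f) p j at h1
  change Dx (compV f) p j = k.vt * Dx (compT f) p j + k.vx * Dx (compX f) p j at h2
  have hJ : jacobian f p = Dt (compT f) p j
      * (Dx (compX f) p j * pdv (compV f) p - pdv (compX f) p * Dx (compV f) p j)
      - Dx (compT f) p j
        * (Dt (compX f) p j * pdv (compV f) p - pdv (compX f) p * Dt (compV f) p j)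
      + pdv (compT f) p
        * (Dt (compX f) p j * Dx (compV f) p j - Dx (compX f) p j * Dt (compV f) p j) := by
    simp only [jacobian, Dt, Dx]; ring
  rw [hJ, h1, h2]; ring

lemma exists_box_subset {U : Set Pt} (hU : IsOpen U) {p : Pt} (hp : p ∈ U) :
    ∃ r > 0, (Metric.ball p.1 r ×ˢ Metric.ball p.2.1 r ×ˢ Metric.ball p.2.2 r : Set Pt) ⊆ U := by
  obtain ⟨r, hr, h⟩ := Metric.isOpen_iff.1 hU p hp
  refine ⟨r, hr, ?_⟩
  rwa [ball_prod_same, ball_prod_same]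

/-- If `A u + B + D e^u = C e^{a u}` near `u = 0` with `a, C ≠ 0`, then `a = 1` and `D = C`. -/
lemma exp_matching {A B C D a r : ℝ} (hr : 0 < r) (ha : a ≠ 0) (hC : C ≠ 0)
    (h : ∀ u ∈ Metric.ball (0 : ℝ) r, A * u + B + D * Real.exp u = C * Real.exp (a * u)) :
    a = 1 ∧ D = C := by
  have hd : ∀ f g : ℝ → ℝ, (∀ u ∈ Metric.ball (0 : ℝ) r, f u = g u) → ∀ f' g' : ℝ → ℝ,
      (∀ u, HasDerivAt f (f' u) u) → (∀ u, HasDerivAt g (g' u) u) →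
      ∀ u ∈ Metric.ball (0 : ℝ) r, f' u = g' u := by
    intro f g hfg f' g' hf hg u hu
    refine (hf u).unique ((hg u).congr_of_eventuallyEq ?_)
    filter_upwards [Metric.isOpen_ball.mem_nhds hu] with w hw using hfg w hw
  have dexp : ∀ (m b u : ℝ), HasDerivAt (fun u => m * Real.exp (b * u))
      (m * b * Real.exp (b * u)) u := fun m b u =>
    ((Equation.hasDerivAt_exp_mul b u).const_mul m).congr_deriv (by ring)
  have d1 := hd _ _ h (fun u => A + D * Real.exp u) (fun u => C * a * Real.exp (a * u))
    (fun u => by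
      simpa using ((((hasDerivAt_id u).const_mul A).add_const B).fun_add
        ((Real.hasDerivAt_exp u).const_mul D))) (dexp C a)
  have d2 := hd _ _ d1 (fun u => D * Real.exp u) (fun u => C * a * a * Real.exp (a * u))
    (fun u => ((Real.hasDerivAt_exp u).const_mul D).const_add A) (dexp _ a)
  have d3 := hd _ _ d2 (fun u => D * Real.exp u) (fun u => C * a * a * a * Real.exp (a * u))
    (fun u => (Real.hasDerivAt_exp u).const_mul D) (dexp _ a)
  have e2 := d2 0 (Metric.mem_ball_self hr)
  have e3 := d3 0 (Metric.mem_ball_self hr)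
  simp only [mul_zero, Real.exp_zero, mul_one] at e2 e3
  have ha1 : a = 1 := by
    have : C * a * a * (a - 1) = 0 := by linear_combination e2 - e3
    simpa [hC, ha, sub_eq_zero] using this
  subst ha1
  exact ⟨rfl, by linarith⟩

namespace Equation.IsPointTransformation

variable {L L' : Equation} {Φ : OpenPartialHomeomorph Pt Pt} {p : Pt}

lemma smooth_T (h : L.IsPointTransformation L' Φ) : ContDiffOn ℝ ∞ (compT Φ) Φ.source :=
  h.2.2.2.1.fst

lemma smooth_X (h : L.IsPointTransformation L' Φ) : ContDiffOn ℝ ∞ (compX Φ) Φ.source :=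
  h.2.2.2.1.snd.fst

lemma smooth_V (h : L.IsPointTransformation L' Φ) : ContDiffOn ℝ ∞ (compV Φ) Φ.source :=
  h.2.2.2.1.snd.snd

lemma mem_I (h : L.IsPointTransformation L' Φ) (hp : p ∈ Φ.source) : p.2.1 ∈ L.I := h.2.1 hp

lemma compX_mem_I (h : L.IsPointTransformation L' Φ) (hp : p ∈ Φ.source) : compX Φ p ∈ L'.I :=
  h.2.2.1 (Φ.map_source hp)

lemma jacobian_ne_zero (h : L.IsPointTransformation L' Φ) (hp : p ∈ Φ.source) :
    jacobian Φ p ≠ 0 := by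
  have hΦ : DifferentiableAt ℝ Φ p :=
    ((h.2.2.2.1 p hp).contDiffAt (Φ.open_source.mem_nhds hp)).differentiableAt (by simp)
  have hp' := Φ.map_source hp
  have hΨ : DifferentiableAt ℝ Φ.symm (Φ p) :=
    ((h.2.2.2.2.1 _ hp').contDiffAt (Φ.open_target.mem_nhds hp')).differentiableAt (by simp)
  have hcomp : ∀ e : Pt, fderiv ℝ Φ p (fderiv ℝ Φ.symm (Φ p) e) = e := by
    intro e
    have h1 : HasFDerivAt (Φ ∘ Φ.symm) ((fderiv ℝ Φ p).comp (fderiv ℝ Φ.symm (Φ p))) (Φ p) := by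
      refine HasFDerivAt.comp (Φ p) ?_ hΨ.hasFDerivAt
      rw [Φ.left_inv hp]; exact hΦ.hasFDerivAt
    have h2 : HasFDerivAt (Φ ∘ Φ.symm) (ContinuousLinearMap.id ℝ Pt) (Φ p) := by
      refine (hasFDerivAt_id (Φ p)).congr_of_eventuallyEq ?_
      filter_upwards [Φ.open_target.mem_nhds hp'] with q hq using Φ.right_inv hq
    exact congrArg (fun A : Pt →L[ℝ] Pt => A e) (h1.unique h2)
  have hT : ∀ w, fderiv ℝ (compT Φ) p w = (fderiv ℝ Φ p w).1 := fun w => by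
    have := hΦ.hasFDerivAt.fst.fderiv
    exact congrArg (fun A : Pt →L[ℝ] ℝ => A w) this
  have hX : ∀ w, fderiv ℝ (compX Φ) p w = (fderiv ℝ Φ p w).2.1 := fun w => by
    have := hΦ.hasFDerivAt.snd.fst.fderiv
    exact congrArg (fun A : Pt →L[ℝ] ℝ => A w) this
  have hV : ∀ w, fderiv ℝ (compV Φ) p w = (fderiv ℝ Φ p w).2.2 := fun w => by
    have := hΦ.hasFDerivAt.snd.snd.fderiv
    exact congrArg (fun A : Pt →L[ℝ] ℝ => A w) this
  have key : ∀ e : Pt, ∃ a b c : ℝ,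
      a * pdt (compT Φ) p + b * pdx (compT Φ) p + c * pdv (compT Φ) p = e.1 ∧
      a * pdt (compX Φ) p + b * pdx (compX Φ) p + c * pdv (compX Φ) p = e.2.1 ∧
      a * pdt (compV Φ) p + b * pdx (compV Φ) p + c * pdv (compV Φ) p = e.2.2 := by
    intro e
    obtain ⟨⟨a, b, c⟩, hw⟩ : ∃ w : Pt, fderiv ℝ Φ p w = e := ⟨_, hcomp e⟩
    refine ⟨a, b, c, ?_, ?_, ?_⟩
    · rw [← fderiv_eq_pd, hT, hw]
    · rw [← fderiv_eq_pd, hX, hw]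
    · rw [← fderiv_eq_pd, hV, hw]
  obtain ⟨a₁, b₁, c₁, t1, x1, v1⟩ := key (1, 0, 0)
  obtain ⟨a₂, b₂, c₂, t2, x2, v2⟩ := key (0, 1, 0)
  obtain ⟨a₃, b₃, c₃, t3, x3, v3⟩ := key (0, 0, 1)
  simp only at t1 x1 v1 t2 x2 v2 t3 x3 v3
  have hM : (!![pdt (compT Φ) p, pdx (compT Φ) p, pdv (compT Φ) p;
        pdt (compX Φ) p, pdx (compX Φ) p, pdv (compX Φ) p;
        pdt (compV Φ) p, pdx (compV Φ) p, pdv (compV Φ) p] : Matrix (Fin 3) (Fin 3) ℝ)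
      * !![a₁, a₂, a₃; b₁, b₂, b₃; c₁, c₂, c₃] = 1 := by
    ext i j
    fin_cases i <;> fin_cases j <;>
      simp [Matrix.mul_apply, Fin.sum_univ_three, mul_comm] <;> linarith
  have hdet := congrArg Matrix.det hM
  rw [Matrix.det_mul, Matrix.det_one] at hdet
  intro h0
  rw [Matrix.det_fin_three] at hdet
  simp only [jacobian] at h0
  simp at hdet
  refine one_ne_zero (α := ℝ) ?_
  rw [← hdet]
  refine mul_eq_zero_of_left ?_ _
  linear_combination h0

/-- `D_x T` vanishes: otherwise a change of `v_tt`, which leaves `L` satisfied, would change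
the second `x`-derivative in the new variables. -/
lemma Dx_T_eq_zero (h : L.IsPointTransformation L' Φ) (hp : p ∈ Φ.source) {j : Jet}
    (hj : L.Holds p j) (ht : Transversal Φ p j) : Dx (compT Φ) p j = 0 := by
  obtain ⟨k, hk⟩ := exists_prolongs ht
  have hJ := hk.jacobian_eq
  have hk' := (h.2.2.2.2.2 p hp j k ht hk).1 hj
  change Dt (compT Φ) p j * Dx (compX Φ) p j - Dx (compT Φ) p j * Dt (compX Φ) p j ≠ 0 at ht
  set a := Dt (compT Φ) p j with ha
  set b := Dx (compT Φ) p j with hb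
  set c := Dt (compX Φ) p j with hc
  set d := Dx (compX Φ) p j with hd
  set e := pdv (compV Φ) p - k.vt * pdv (compT Φ) p - k.vx * pdv (compX Φ) p with he
  have he0 : e ≠ 0 := fun h0 => h.jacobian_ne_zero hp (by rw [← hJ, h0, zero_mul])
  obtain ⟨m, hm⟩ : ∃ m, m * (a * d - b * c) ^ 2 = e :=
    ⟨e / (a * d - b * c) ^ 2, div_mul_cancel₀ _ (pow_ne_zero 2 ht)⟩
  have hm0 : m ≠ 0 := by rintro rfl; exact he0 (by rw [← hm, zero_mul])
  -- the solution of the prolongation formulas for the increment `1` of `v_tt`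
  let j' : Jet := { j with vtt := j.vtt + 1 }
  let k' : Jet := { k with
    vtt := k.vtt + m * d ^ 2, vtx := k.vtx - m * b * d, vxx := k.vxx + m * b ^ 2 }
  have hDtt : ∀ φ : Pt → ℝ, Dtt φ p j' = Dtt φ p j + pdv φ p := fun φ => by
    simp only [Dtt, j']; ring
  have hpro : Prolongs Φ p j' k' := by
    obtain ⟨h1, h2, h3, h4, h5⟩ := hk
    refine ⟨h1, h2, ?_, ?_, ?_⟩
    · change Dtt (compV Φ) p j' = k.vt * Dtt (compT Φ) p j' + k.vx * Dtt (compX Φ) p j'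
        + (k.vtt + m * d ^ 2) * a ^ 2 + 2 * (k.vtx - m * b * d) * a * c
        + (k.vxx + m * b ^ 2) * c ^ 2
      change Dtt (compV Φ) p j = k.vt * Dtt (compT Φ) p j + k.vx * Dtt (compX Φ) p j
        + k.vtt * a ^ 2 + 2 * k.vtx * a * c + k.vxx * c ^ 2 at h3
      simp only [hDtt]
      linear_combination h3 - hm + he
    · change Dtx (compV Φ) p j = k.vt * Dtx (compT Φ) p j + k.vx * Dtx (compX Φ) p j
        + (k.vtt + m * d ^ 2) * a * b + (k.vtx - m * b * d) * (a * d + b * c)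
        + (k.vxx + m * b ^ 2) * c * d
      change Dtx (compV Φ) p j = k.vt * Dtx (compT Φ) p j + k.vx * Dtx (compX Φ) p j
        + k.vtt * a * b + k.vtx * (a * d + b * c) + k.vxx * c * d at h4
      linear_combination h4
    · change Dxx (compV Φ) p j = k.vt * Dxx (compT Φ) p j + k.vx * Dxx (compX Φ) p j
        + (k.vtt + m * d ^ 2) * b ^ 2 + 2 * (k.vtx - m * b * d) * b * d
        + (k.vxx + m * b ^ 2) * d ^ 2
      change Dxx (compV Φ) p j = k.vt * Dxx (compT Φ) p j + k.vx * Dxx (compX Φ) p j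
        + k.vtt * b ^ 2 + 2 * k.vtx * b * d + k.vxx * d ^ 2 at h5
      linear_combination h5
  have hk'' := (h.2.2.2.2.2 p hp j' k' ht hpro).1 hj
  simp only [Holds, k'] at hk' hk''
  have : m * b ^ 2 = 0 := by linarith
  simpa [hm0] using this

/-- `T_x + vx T_v` vanishes for more than one value of `vx`. -/
lemma pd_T (h : L.IsPointTransformation L' Φ) (hp : p ∈ Φ.source) :
    pdx (compT Φ) p = 0 ∧ pdv (compT Φ) p = 0 := by
  have hJ := h.jacobian_ne_zero hp
  have hΔ : ∀ vt vx : ℝ, (pdt (compT Φ) p + vt * pdv (compT Φ) p)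
      * (pdx (compX Φ) p + vx * pdv (compX Φ) p) - (pdx (compT Φ) p + vx * pdv (compT Φ) p)
      * (pdt (compX Φ) p + vt * pdv (compX Φ) p) ≠ 0 →
      pdx (compT Φ) p + vx * pdv (compT Φ) p = 0 := fun vt vx h0 =>
    h.Dx_T_eq_zero hp (j := ⟨vt, vx, 0, 0,
      vt - (L.F p.2.1 * vx + L.ε * Real.exp p.2.2 + L.H p.2.1)⟩) (by simp only [Holds]; ring) h0
  simp only [jacobian] at hJ
  generalize pdt (compT Φ) p = Tt at *
  generalize pdx (compT Φ) p = Tx at *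
  generalize pdv (compT Φ) p = Tv at *
  generalize pdt (compX Φ) p = Xt at *
  generalize pdx (compX Φ) p = Xx at *
  generalize pdv (compX Φ) p = Xv at *
  -- some `(vt, vx)` is transversal since the three minors do not all vanish
  obtain ⟨vt, vx, h0⟩ : ∃ vt vx : ℝ,
      (Tt + vt * Tv) * (Xx + vx * Xv) - (Tx + vx * Tv) * (Xt + vt * Xv) ≠ 0 := by
    by_contra! hcon
    have e0 := hcon 0 0
    have e1 := hcon 1 0
    have e2 := hcon 0 1
    apply hJ
    linear_combination (pdv (compV Φ) p + pdt (compV Φ) p + pdx (compV Φ) p) * e0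
      - pdt (compV Φ) p * e1 - pdx (compV Φ) p * e2
  have hTv : Tv = 0 := by
    -- the transversality determinant is affine in `vx`, hence nonzero at `vx + 1` or `vx + 2`
    have e0 := hΔ vt vx h0
    by_cases h1 : (Tt + vt * Tv) * (Xx + (vx + 1) * Xv) - (Tx + (vx + 1) * Tv) * (Xt + vt * Xv) = 0
    · have h2 : (Tt + vt * Tv) * (Xx + (vx + 2) * Xv) - (Tx + (vx + 2) * Tv) * (Xt + vt * Xv)
          ≠ 0 := by
        intro h2; apply h0; linear_combination 2 * h1 - h2
      linarith [hΔ _ _ h2]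
    · linarith [hΔ _ _ h1]
  subst hTv
  exact ⟨by simpa using hΔ vt vx h0, rfl⟩

lemma pdt_T_ne_zero (h : L.IsPointTransformation L' Φ) (hp : p ∈ Φ.source) :
    pdt (compT Φ) p ≠ 0 := by
  intro h0
  apply h.jacobian_ne_zero hp
  simp only [jacobian, h.pd_T hp, h0]; ring

lemma Dxx_T (h : L.IsPointTransformation L' Φ) (hp : p ∈ Φ.source) (j : Jet) :
    Dxx (compT Φ) p j = 0 := by
  have z1 := pdx_eqOn_zero Φ.open_source (fun q hq => (h.pd_T hq).1) p hp
  have z2 := pdx_eqOn_zero Φ.open_source (fun q hq => (h.pd_T hq).2) p hp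
  have z3 := pdv_eqOn_zero Φ.open_source (fun q hq => (h.pd_T hq).2) p hp
  simp [Dxx, z1, z2, z3, h.pd_T hp]

/-- The prolongation formulas used, once `T` is known to depend on `t` only. -/
lemma prolongs_eqs (h : L.IsPointTransformation L' Φ) (hp : p ∈ Φ.source) {j k : Jet}
    (hk : Prolongs Φ p j k) :
    Dt (compV Φ) p j = k.vt * pdt (compT Φ) p + k.vx * Dt (compX Φ) p j ∧
    Dx (compV Φ) p j = k.vx * Dx (compX Φ) p j ∧
    Dxx (compV Φ) p j = k.vx * Dxx (compX Φ) p j + k.vxx * Dx (compX Φ) p j ^ 2 := by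
  obtain ⟨h1, h2, -, -, h5⟩ := hk
  change Dt (compV Φ) p j = k.vt * Dt (compT Φ) p j + k.vx * Dt (compX Φ) p j at h1
  change Dx (compV Φ) p j = k.vt * Dx (compT Φ) p j + k.vx * Dx (compX Φ) p j at h2
  change Dxx (compV Φ) p j = k.vt * Dxx (compT Φ) p j + k.vx * Dxx (compX Φ) p j
    + k.vtt * Dx (compT Φ) p j ^ 2 + 2 * k.vtx * Dx (compT Φ) p j * Dx (compX Φ) p j
    + k.vxx * Dx (compX Φ) p j ^ 2 at h5
  have hT : Dx (compT Φ) p j = 0 := by simp [Dx, h.pd_T hp]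
  have hT' : Dt (compT Φ) p j = pdt (compT Φ) p := by simp [Dt, h.pd_T hp]
  rw [hT'] at h1
  rw [hT] at h2 h5
  rw [h.Dxx_T hp] at h5
  exact ⟨h1, by linarith, by linarith⟩

lemma transversal_iff (h : L.IsPointTransformation L' Φ) (hp : p ∈ Φ.source) {j : Jet} :
    Transversal Φ p j ↔ pdx (compX Φ) p + j.vx * pdv (compX Φ) p ≠ 0 := by
  change Dt (compT Φ) p j * Dx (compX Φ) p j - Dx (compT Φ) p j * Dt (compX Φ) p j ≠ 0 ↔ _
  simp [Dt, Dx, h.pd_T hp, h.pdt_T_ne_zero hp]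

/-- Comparison of the coefficients of `v_t = v_xx + ⋯` in both equations. -/
lemma sq_Dx_X (h : L.IsPointTransformation L' Φ) (hp : p ∈ Φ.source) {vx : ℝ}
    (hvx : pdx (compX Φ) p + vx * pdv (compX Φ) p ≠ 0) :
    (pdx (compX Φ) p + vx * pdv (compX Φ) p) ^ 2 = pdt (compT Φ) p := by
  set E := L.F p.2.1 * vx + L.ε * Real.exp p.2.2 + L.H p.2.1 with hE
  let j : Jet := ⟨E, vx, 0, 0, 0⟩
  let j' : Jet := ⟨1 + E, vx, 0, 0, 1⟩
  have hj : L.Holds p j := by simp only [Holds, j]; rw [hE]; ring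
  have hj' : L.Holds p j' := by simp only [Holds, j']; rw [hE]; ring
  have ht : Transversal Φ p j := (h.transversal_iff hp).2 hvx
  have ht' : Transversal Φ p j' := (h.transversal_iff hp).2 hvx
  obtain ⟨k, hk⟩ := exists_prolongs ht
  obtain ⟨k', hk'⟩ := exists_prolongs ht'
  have hJ := hk.jacobian_eq
  have e := (h.2.2.2.2.2 p hp j k ht hk).1 hj
  have e' := (h.2.2.2.2.2 p hp j' k' ht' hk').1 hj'
  obtain ⟨h1, h2, h5⟩ := h.prolongs_eqs hp hk
  obtain ⟨h1', h2', h5'⟩ := h.prolongs_eqs hp hk'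
  have hc : pdv (compV Φ) p - k.vx * pdv (compX Φ) p ≠ 0 := by
    intro h0
    apply h.jacobian_ne_zero hp
    rw [← hJ, (h.pd_T hp).2, mul_zero, sub_zero, h0, zero_mul]
  simp only [Dt, Dx, Dxx, j, j'] at h1 h2 h5 h1' h2' h5'
  have hkx : k'.vx = k.vx := mul_right_cancel₀ hvx (by rw [← h2, ← h2'])
  simp only [Holds] at e e'
  rw [hkx] at h1' h5' e'
  have w1 : pdv (compV Φ) p - k.vx * pdv (compX Φ) p = (k'.vt - k.vt) * pdt (compT Φ) p := by
    linear_combination h1' - h1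
  have w2 : pdv (compV Φ) p - k.vx * pdv (compX Φ) p = (k'.vxx - k.vxx)
      * (pdx (compX Φ) p + vx * pdv (compX Φ) p) ^ 2 := by
    linear_combination h5' - h5
  have w3 : k'.vt - k.vt = k'.vxx - k.vxx := by linear_combination e' - e
  rw [← w3] at w2
  have w4 : k'.vt - k.vt ≠ 0 := by
    intro h0; apply hc; rw [w1, h0, zero_mul]
  exact mul_left_cancel₀ w4 (by rw [← w1, ← w2])

/-- If `X_v` did not vanish, `X_x + vx X_v` would take the values `1` and `2`, contradicting
`sq_Dx_X`. -/
lemma pd_X (h : L.IsPointTransformation L' Φ) (hp : p ∈ Φ.source) :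
    pdv (compX Φ) p = 0 ∧ pdx (compX Φ) p ^ 2 = pdt (compT Φ) p := by
  have hv : pdv (compX Φ) p = 0 := by
    by_contra h0
    have e1 : pdx (compX Φ) p + (1 - pdx (compX Φ) p) / pdv (compX Φ) p * pdv (compX Φ) p = 1 := by
      field_simp; ring
    have e2 : pdx (compX Φ) p + (2 - pdx (compX Φ) p) / pdv (compX Φ) p * pdv (compX Φ) p = 2 := by
      field_simp; ring
    have h1 := h.sq_Dx_X hp (by rw [e1]; norm_num)
    have h2 := h.sq_Dx_X hp (by rw [e2]; norm_num)
    rw [e1] at h1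
    rw [e2] at h2
    linarith
  have hx : pdx (compX Φ) p ≠ 0 := by
    intro h0
    apply h.jacobian_ne_zero hp
    simp only [jacobian, h.pd_T hp, hv, h0]; ring
  refine ⟨hv, ?_⟩
  simpa using h.sq_Dx_X hp (vx := 0) (by simpa using hx)

lemma pdx_X_ne_zero (h : L.IsPointTransformation L' Φ) (hp : p ∈ Φ.source) :
    pdx (compX Φ) p ≠ 0 := by
  intro h0
  apply h.pdt_T_ne_zero hp
  rw [← (h.pd_X hp).2, h0]; ring

lemma pdv_V_ne_zero (h : L.IsPointTransformation L' Φ) (hp : p ∈ Φ.source) :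
    pdv (compV Φ) p ≠ 0 := by
  intro h0
  apply h.jacobian_ne_zero hp
  simp only [jacobian, h.pd_T hp, h.pd_X hp, h0]; ring

lemma pdx_pdt_T (h : L.IsPointTransformation L' Φ) (hp : p ∈ Φ.source) :
    pdx (pdt (compT Φ)) p = 0 := by
  rw [pdx_pdt Φ.open_source h.smooth_T hp]
  exact pdt_eqOn_zero Φ.open_source (fun q hq => (h.pd_T hq).1) p hp

/-- `X_x² = T_t` does not depend on `x`. -/
lemma pdx_pdx_X (h : L.IsPointTransformation L' Φ) (hp : p ∈ Φ.source) :
    pdx (pdx (compX Φ)) p = 0 := by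
  obtain ⟨t, x, v⟩ := p
  have hU := Φ.open_source
  have d1 := hasDerivAt_slice_x
    (differentiableAt_of_contDiffOn hU (contDiffOn_pdx hU h.smooth_X) hp)
  have d2 := hasDerivAt_slice_x
    (differentiableAt_of_contDiffOn hU (contDiffOn_pdt hU h.smooth_T) hp)
  rw [h.pdx_pdt_T hp] at d2
  have hev : ∀ᶠ s in nhds x, ((t, s, v) : Pt) ∈ Φ.source :=
    (Continuous.continuousAt (by fun_prop : Continuous fun s : ℝ => ((t, s, v) : Pt))).eventually
      (hU.mem_nhds hp)
  have := (d1.fun_pow 2).unique (d2.congr_of_eventuallyEq (hev.mono fun s hs => (h.pd_X hs).2))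
  simpa [h.pdx_X_ne_zero hp] using this

/-- The transformed equation, compared as polynomials in `vx`. -/
lemma coeffs (h : L.IsPointTransformation L' Φ) (hp : p ∈ Φ.source) :
    pdv (pdv (compV Φ)) p = 0 ∧
    -pdv (compV Φ) p * pdt (compX Φ) p = pdx (compX Φ) p
        * (2 * pdx (pdv (compV Φ)) p - L.F p.2.1 * pdv (compV Φ) p)
      + pdx (compX Φ) p ^ 2 * L'.F (compX Φ p) * pdv (compV Φ) p ∧
    pdx (compX Φ) p * pdt (compV Φ) p - pdx (compV Φ) p * pdt (compX Φ) p
      = pdx (compX Φ) p * (pdx (pdx (compV Φ)) p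
        - (L.ε * Real.exp p.2.2 + L.H p.2.1) * pdv (compV Φ) p)
      + pdx (compX Φ) p ^ 2 * L'.F (compX Φ p) * pdx (compV Φ) p
      + pdx (compX Φ) p ^ 3 * (L'.ε * Real.exp (compV Φ p) + L'.H (compX Φ p)) := by
  have hx0 := h.pdx_X_ne_zero hp
  have hU := Φ.open_source
  have z1 := h.pdx_pdx_X hp
  have z2 := pdx_eqOn_zero hU (fun q hq => (h.pd_X hq).1) p hp
  have z3 := pdv_eqOn_zero hU (fun q hq => (h.pd_X hq).1) p hp
  have z4 := (h.pd_X hp).1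
  have key : ∀ vx : ℝ, pdx (compX Φ) p * pdt (compV Φ) p
      - (pdx (compV Φ) p + vx * pdv (compV Φ) p) * pdt (compX Φ) p
      = pdx (compX Φ) p * (pdx (pdx (compV Φ)) p + 2 * vx * pdx (pdv (compV Φ)) p
        + vx ^ 2 * pdv (pdv (compV Φ)) p
        - (L.F p.2.1 * vx + L.ε * Real.exp p.2.2 + L.H p.2.1) * pdv (compV Φ) p)
      + pdx (compX Φ) p ^ 2 * L'.F (compX Φ p) * (pdx (compV Φ) p + vx * pdv (compV Φ) p)
      + pdx (compX Φ) p ^ 3 * (L'.ε * Real.exp (compV Φ p) + L'.H (compX Φ p)) := by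
    intro vx
    let j : Jet := ⟨0, vx, 0, 0, -(L.F p.2.1 * vx + L.ε * Real.exp p.2.2 + L.H p.2.1)⟩
    have hj : L.Holds p j := by simp only [Holds, j]; ring
    have ht : Transversal Φ p j := (h.transversal_iff hp).2 (by simpa [z4] using hx0)
    obtain ⟨k, hk⟩ := exists_prolongs ht
    have e : k.vt = k.vxx + L'.F (compX Φ p) * k.vx + L'.ε * Real.exp (compV Φ p)
      + L'.H (compX Φ p) := (h.2.2.2.2.2 p hp j k ht hk).1 hj
    obtain ⟨h1, h2, h5⟩ := h.prolongs_eqs hp hk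
    simp only [Dt, Dx, Dxx, j, z1, z2, z3, z4, ← (h.pd_X hp).2] at h1 h2 h5
    linear_combination pdx (compX Φ) p * h1 - pdx (compX Φ) p * h5
      + pdx (compX Φ) p ^ 3 * e
      + (-pdt (compX Φ) p - pdx (compX Φ) p ^ 2 * L'.F (compX Φ p)) * h2
  have e0 := key 0
  have e1 := key 1
  have e2 := key (-1)
  refine ⟨?_, by linarith, by linarith⟩
  have : pdx (compX Φ) p * pdv (pdv (compV Φ)) p = 0 := by linarith
  exact (mul_eq_zero.1 this).resolve_left hx0

/-- Along the `v`-axis the last of the equations `coeffs` compares `e^v` with `e^V`, where `V` is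
affine in `v`. -/
lemma V_exp (h : L.IsPointTransformation L' Φ) (hp : p ∈ Φ.source) :
    L.ε * Real.exp p.2.2 = pdx (compX Φ) p ^ 2 * (L'.ε * Real.exp (compV Φ p)) := by
  obtain ⟨r, hr, hbox⟩ := exists_box_subset Φ.open_source hp
  obtain ⟨t, x, v⟩ := p
  simp only at hbox
  have hU := Φ.open_source
  have sV := h.smooth_V
  have sv := contDiffOn_pdv hU sV
  have ht := Metric.mem_ball_self (x := t) hr
  have hx := Metric.mem_ball_self (x := x) hr
  have hv := Metric.mem_ball_self (x := v) hr
  have hw : ∀ u ∈ Metric.ball (0 : ℝ) r, v + u ∈ Metric.ball v r := fun u hu => by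
    simpa [Real.dist_eq] using hu
  have hM : IsPreconnected (Metric.ball v r) := (convex_ball v r).isPreconnected
  have aff : ∀ φ : Pt → ℝ, ContDiffOn ℝ ∞ φ Φ.source → (∀ p ∈ Φ.source, pdv (pdv φ) p = 0) →
      ∀ u ∈ Metric.ball (0 : ℝ) r, φ (t, x, v + u) = φ (t, x, v) + pdv φ (t, x, v) * u := by
    intro φ hφ h0 u hu
    have := eq_affine_of_pdv_pdv_eq_zero (φ := φ) Metric.isOpen_ball hM
      (fun p hp => differentiableAt_of_contDiffOn hU hφ (hbox hp))
      (fun p hp => differentiableAt_of_contDiffOn hU (contDiffOn_pdv hU hφ) (hbox hp))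
      (fun p hp => h0 p (hbox hp)) ht hx hv (hw u hu)
    simpa using this
  have cst : ∀ φ : Pt → ℝ, ContDiffOn ℝ ∞ φ Φ.source → (∀ p ∈ Φ.source, pdv φ p = 0) →
      ∀ u ∈ Metric.ball (0 : ℝ) r, φ (t, x, v + u) = φ (t, x, v) := fun φ hφ h0 u hu =>
    eq_of_pdv_eq_zero Metric.isOpen_ball hM
      (fun p hp => differentiableAt_of_contDiffOn hU hφ (hbox hp))
      (fun p hp => h0 p (hbox hp)) ht hx (hw u hu) hv
  have hvv : ∀ p ∈ Φ.source, pdv (pdv (compV Φ)) p = 0 := fun p hp => (h.coeffs hp).1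
  have htv : ∀ p ∈ Φ.source, pdv (pdv (pdt (compV Φ))) p = 0 := fun p hp => by
    rw [pdv_eqOn hU (pdv_pdt hU sV) hp, pdv_pdt hU sv hp]
    exact pdt_eqOn_zero hU hvv p hp
  have hx1 : ∀ p ∈ Φ.source, pdv (pdv (pdx (compV Φ))) p = 0 := fun p hp => by
    rw [pdv_eqOn hU (pdv_pdx hU sV) hp, pdv_pdx hU sv hp]
    exact pdx_eqOn_zero hU hvv p hp
  have sx := contDiffOn_pdx hU sV
  have hx2 : ∀ p ∈ Φ.source, pdv (pdv (pdx (pdx (compV Φ)))) p = 0 := fun p hp => by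
    rw [pdv_eqOn hU (pdv_pdx hU sx) hp, pdv_pdx hU (contDiffOn_pdv hU sx) hp]
    exact pdx_eqOn_zero hU hx1 p hp
  have hXv : ∀ p ∈ Φ.source, pdv (compX Φ) p = 0 := fun p hp => (h.pd_X hp).1
  have cX := cst _ h.smooth_X hXv
  have cXt := cst _ (contDiffOn_pdt hU h.smooth_X) fun p hp => by
    rw [pdv_pdt hU h.smooth_X hp]; exact pdt_eqOn_zero hU hXv p hp
  have cXx := cst _ (contDiffOn_pdx hU h.smooth_X) fun p hp => by
    rw [pdv_pdx hU h.smooth_X hp]; exact pdx_eqOn_zero hU hXv p hp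
  have cv := cst _ sv hvv
  have hx0 := h.pdx_X_ne_zero hp
  set q : Pt := (t, x, v) with hq
  have key := exp_matching (r := r) (a := pdv (compV Φ) q)
    (A := pdx (compX Φ) q * (pdv (pdt (compV Φ)) q - pdv (pdx (pdx (compV Φ))) q)
      - pdv (pdx (compV Φ)) q * (pdt (compX Φ) q + pdx (compX Φ) q ^ 2 * L'.F (compX Φ q)))
    (B := pdx (compX Φ) q * (pdt (compV Φ) q - pdx (pdx (compV Φ)) q + L.H x * pdv (compV Φ) q)
      - pdx (compV Φ) q * (pdt (compX Φ) q + pdx (compX Φ) q ^ 2 * L'.F (compX Φ q))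
      - pdx (compX Φ) q ^ 3 * L'.H (compX Φ q))
    (D := pdx (compX Φ) q * L.ε * Real.exp v * pdv (compV Φ) q)
    (C := pdx (compX Φ) q ^ 3 * L'.ε * Real.exp (compV Φ q)) hr (h.pdv_V_ne_zero hp)
    (mul_ne_zero (mul_ne_zero (pow_ne_zero 3 hx0) L'.ε_ne_zero) (Real.exp_ne_zero _))
    (fun u hu => by
      have e := (h.coeffs (p := (t, x, v + u)) (hbox ⟨ht, hx, hw u hu⟩)).2.2
      rw [aff _ sV hvv u hu, aff _ (contDiffOn_pdt hU sV) htv u hu, aff _ sx hx1 u hu,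
        aff _ (contDiffOn_pdx hU sx) hx2 u hu, cX u hu, cXt u hu, cXx u hu, cv u hu] at e
      simp only [Real.exp_add] at e
      linear_combination e)
  obtain ⟨ha, hD⟩ := key
  rw [ha] at hD
  apply mul_left_cancel₀ hx0
  change _ * (L.ε * Real.exp v) = _
  linear_combination hD

lemma ε_eq (h : L.IsPointTransformation L' Φ) : L'.ε = L.ε := by
  obtain ⟨p, hp⟩ := h.1
  have e := h.V_exp hp
  have h1 := Real.exp_pos p.2.2
  have h2 := mul_pos (pow_pos (abs_pos.2 (h.pdx_X_ne_zero hp)) 2) (Real.exp_pos (compV Φ p))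
  rw [sq_abs] at h2
  rcases L.sign_ε with a | a <;> rcases L'.sign_ε with b | b <;> rw [a, b] at e <;>
    first | (rw [a, b]; done) | (exfalso; nlinarith)

/-- With `ε' = ε` and `X_x² = T_t`, the equation `V_exp` determines `V`. -/
lemma V_eq (h : L.IsPointTransformation L' Φ) (hp : p ∈ Φ.source) :
    compV Φ p = p.2.2 - Real.log (pdt (compT Φ) p) := by
  have e := h.V_exp hp
  rw [h.ε_eq, (h.pd_X hp).2] at e
  have h1 : Real.exp p.2.2 = pdt (compT Φ) p * Real.exp (compV Φ p) := by
    apply mul_left_cancel₀ L.ε_ne_zero; linear_combination e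
  have h2 := congrArg Real.log h1
  rw [Real.log_exp, Real.log_mul (h.pdt_T_ne_zero hp) (Real.exp_ne_zero _), Real.log_exp] at h2
  linarith

/-- The relations between the coefficients of two equations connected by a point
transformation. -/
theorem transform_coeffs (h : L.IsPointTransformation L' Φ) (hp : p ∈ Φ.source) :
    L.F p.2.1 = pdt (compX Φ) p / pdx (compX Φ) p + pdx (compX Φ) p * L'.F (compX Φ p) ∧
    L.H p.2.1 = pdt (pdt (compT Φ)) p / pdt (compT Φ) p
      + pdx (compX Φ) p ^ 2 * L'.H (compX Φ p) := by
  have hU := Φ.open_source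
  have sTt := contDiffOn_pdt hU h.smooth_T
  have hT0 := fun q (hq : q ∈ Φ.source) => h.pdt_T_ne_zero hq
  have vTt : ∀ q ∈ Φ.source, pdv (pdt (compT Φ)) q = 0 := fun q hq => by
    rw [pdv_pdt hU h.smooth_T hq]
    exact pdt_eqOn_zero hU (fun q hq => (h.pd_T hq).2) q hq
  have hev : ∀ q ∈ Φ.source, HasFDerivAt (compV Φ)
      ((ContinuousLinearMap.snd ℝ ℝ ℝ).comp (ContinuousLinearMap.snd ℝ ℝ (ℝ × ℝ))
        - (pdt (compT Φ) q)⁻¹ • fderiv ℝ (pdt (compT Φ)) q) q := by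
    intro q hq
    have h1 : HasFDerivAt (fun p : Pt => p.2.2) ((ContinuousLinearMap.snd ℝ ℝ ℝ).comp
        (ContinuousLinearMap.snd ℝ ℝ (ℝ × ℝ))) q := hasFDerivAt_snd.comp q hasFDerivAt_snd
    have h2 := (differentiableAt_of_contDiffOn hU sTt hq).hasFDerivAt.log (hT0 q hq)
    refine (h1.sub h2).congr_of_eventuallyEq ?_
    filter_upwards [hU.mem_nhds hq] with q' hq' using h.V_eq hq'
  have Vv : ∀ q ∈ Φ.source, pdv (compV Φ) q = 1 := fun q hq => by
    have h1 := vTt q hq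
    simp only [pdv] at h1 ⊢
    rw [(hev q hq).fderiv]; simp [h1]
  have Vx : ∀ q ∈ Φ.source, pdx (compV Φ) q = 0 := fun q hq => by
    have h1 := h.pdx_pdt_T hq
    simp only [pdx] at h1 ⊢
    rw [(hev q hq).fderiv]; simp [h1]
  have Vt : pdt (compV Φ) p = -pdt (pdt (compT Φ)) p / pdt (compT Φ) p := by
    simp only [pdt]
    rw [(hev p hp).fderiv]
    simp [pdt, div_eq_inv_mul]
  obtain ⟨-, e1, e0⟩ := h.coeffs hp
  have hexp := h.V_exp hp
  have hx0 := h.pdx_X_ne_zero hp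
  rw [pdx_eqOn_zero hU Vv p hp, Vv p hp] at e1
  rw [pdx_eqOn_zero hU Vx p hp, Vv p hp, Vx p hp, Vt] at e0
  constructor
  · apply mul_left_cancel₀ hx0
    rw [mul_add, mul_div_cancel₀ _ hx0]
    linear_combination e1
  · apply mul_left_cancel₀ hx0
    linear_combination e0 - pdx (compX Φ) p * hexp

end Equation.IsPointTransformation

/-! ### Local form of point transformations and inequivalence of the cases -/

/-- On the box `K × J × M` the `x`-component of the point transformation `Φ` from `L` to `L'` is
`δ(t) x + χ(t)`, and the coefficients of `L` and `L'` are related accordingly. -/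
structure HasAffineForm (L L' : Equation) (Φ : OpenPartialHomeomorph Pt Pt) (K J M : Set ℝ)
    (δ χ : ℝ → ℝ) : Prop where
  subset : (K ×ˢ J ×ˢ M : Set Pt) ⊆ Φ.source
  smooth_δ : ContDiffOn ℝ ∞ δ K
  smooth_χ : ContDiffOn ℝ ∞ χ K
  δ_ne : ∀ t ∈ K, δ t ≠ 0
  mem_I : ∀ t ∈ K, ∀ x ∈ J, x ∈ L.I ∧ δ t * x + χ t ∈ L'.I
  pdt_X : ∀ q ∈ (K ×ˢ J ×ˢ M : Set Pt), pdt (compX Φ) q = deriv δ q.1 * q.2.1 + deriv χ q.1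
  pdt_pdx_X : ∀ q ∈ (K ×ˢ J ×ˢ M : Set Pt), pdt (pdx (compX Φ)) q = deriv δ q.1
  F_eq : ∀ t ∈ K, ∀ x ∈ J,
    L.F x = (deriv δ t * x + deriv χ t) / δ t + δ t * L'.F (δ t * x + χ t)
  H_eq : ∀ t ∈ K, ∀ x ∈ J, L.H x = 2 * (deriv δ t / δ t) + δ t ^ 2 * L'.H (δ t * x + χ t)

lemma differentiableAt_of_contDiffOn_real {K : Set ℝ} (hK : IsOpen K) {f : ℝ → ℝ}
    (h : ContDiffOn ℝ ∞ f K) {t : ℝ} (ht : t ∈ K) : DifferentiableAt ℝ f t :=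
  ((h t ht).contDiffAt (hK.mem_nhds ht)).differentiableAt (by simp)

namespace Equation.IsPointTransformation

variable {L L' : Equation} {Φ : OpenPartialHomeomorph Pt Pt} {p : Pt}

/-- On a box `X` depends on `t` and `x` only and is affine in `x`. -/
theorem exists_affineForm (h : L.IsPointTransformation L' Φ) (hp : p ∈ Φ.source) :
    ∃ r > 0, ∃ δ χ : ℝ → ℝ, HasAffineForm L L' Φ (Metric.ball p.1 r) (Metric.ball p.2.1 r)
      (Metric.ball p.2.2 r) δ χ := by
  obtain ⟨r, hr, hbox⟩ := exists_box_subset Φ.open_source hp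
  obtain ⟨t₀, x₀, v₀⟩ := p
  simp only at hbox
  have hU := Φ.open_source
  have hJ : IsPreconnected (Metric.ball x₀ r) := (convex_ball x₀ r).isPreconnected
  have hM : IsPreconnected (Metric.ball v₀ r) := (convex_ball v₀ r).isPreconnected
  have hx₀ := Metric.mem_ball_self (x := x₀) hr
  have hv₀ := Metric.mem_ball_self (x := v₀) hr
  have sX := h.smooth_X
  have sXx := contDiffOn_pdx hU sX
  have hXv : ∀ p ∈ Φ.source, pdv (compX Φ) p = 0 := fun p hp => (h.pd_X hp).1
  have m0 : ∀ t ∈ Metric.ball t₀ r, ((t, x₀, v₀) : Pt) ∈ Φ.source :=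
    fun t ht => hbox ⟨ht, hx₀, hv₀⟩
  have slice : ∀ φ : Pt → ℝ, ContDiffOn ℝ ∞ φ Φ.source →
      ContDiffOn ℝ ∞ (fun t => φ (t, x₀, v₀)) (Metric.ball t₀ r) := fun φ hφ =>
    hφ.comp (contDiff_id.prodMk contDiff_const).contDiffOn m0
  have dslice : ∀ φ : Pt → ℝ, ContDiffOn ℝ ∞ φ Φ.source → ∀ t ∈ Metric.ball t₀ r,
      ∀ x ∈ Metric.ball x₀ r, ∀ v ∈ Metric.ball v₀ r,
      HasDerivAt (fun t => φ (t, x, v)) (pdt φ (t, x, v)) t := fun φ hφ t ht x hx v hv =>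
    hasDerivAt_slice_t (differentiableAt_of_contDiffOn hU hφ (hbox ⟨ht, hx, hv⟩))
  have hXx : ∀ t ∈ Metric.ball t₀ r, ∀ x ∈ Metric.ball x₀ r, ∀ v ∈ Metric.ball v₀ r,
      pdx (compX Φ) (t, x, v) = pdx (compX Φ) (t, x₀, v₀) := fun t ht x hx v hv =>
    eq_of_pdx_pdv_eq_zero Metric.isOpen_ball hJ Metric.isOpen_ball hM
      (fun p hp => differentiableAt_of_contDiffOn hU sXx (hbox hp))
      (fun p hp => h.pdx_pdx_X (hbox hp))
      (fun p hp => by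
        rw [pdv_pdx hU sX (hbox hp)]; exact pdx_eqOn_zero hU hXv p (hbox hp)) ht hx hv hx₀ hv₀
  have hX : ∀ t ∈ Metric.ball t₀ r, ∀ x ∈ Metric.ball x₀ r, ∀ v ∈ Metric.ball v₀ r,
      compX Φ (t, x, v) = pdx (compX Φ) (t, x₀, v₀) * x
        + (compX Φ (t, x₀, v₀) - pdx (compX Φ) (t, x₀, v₀) * x₀) := by
    intro t ht x hx v hv
    have h1 : compX Φ (t, x, v) = compX Φ (t, x, v₀) :=
      eq_of_pdv_eq_zero Metric.isOpen_ball hM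
        (fun p hp => differentiableAt_of_contDiffOn hU sX (hbox hp))
        (fun p hp => hXv p (hbox hp)) ht hx hv hv₀
    have hs : ∀ u ∈ Metric.ball x₀ r, HasDerivAt
        (fun u => compX Φ (t, u, v₀) - pdx (compX Φ) (t, x₀, v₀) * (u - x₀)) 0 u := by
      intro u hu
      have h2 := hasDerivAt_slice_x
        (differentiableAt_of_contDiffOn hU sX (hbox ⟨ht, hu, hv₀⟩))
      rw [hXx t ht u hu v₀ hv₀] at h2
      simpa using h2.fun_sub
        (((hasDerivAt_id u).sub_const x₀).const_mul (pdx (compX Φ) (t, x₀, v₀)))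
    have h3 := Metric.isOpen_ball.is_const_of_deriv_eq_zero hJ
      (fun u hu => (hs u hu).differentiableAt.differentiableWithinAt)
      (fun u hu => (hs u hu).deriv) hx hx₀
    simp only [sub_self, mul_zero, sub_zero] at h3
    rw [h1]; linarith
  have near : ∀ t ∈ Metric.ball t₀ r, ∀ᶠ s in nhds t, s ∈ Metric.ball t₀ r := fun t ht =>
    Metric.isOpen_ball.mem_nhds ht
  have dδ : ∀ t ∈ Metric.ball t₀ r, HasDerivAt (fun t => pdx (compX Φ) (t, x₀, v₀))
      (deriv (fun t => pdx (compX Φ) (t, x₀, v₀)) t) t := fun t ht =>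
    (differentiableAt_of_contDiffOn_real Metric.isOpen_ball (slice _ sXx) ht).hasDerivAt
  have sχ : ContDiffOn ℝ ∞ (fun t => compX Φ (t, x₀, v₀) - pdx (compX Φ) (t, x₀, v₀) * x₀)
      (Metric.ball t₀ r) := (slice _ sX).sub ((slice _ sXx).mul contDiffOn_const)
  have dχ : ∀ t ∈ Metric.ball t₀ r,
      HasDerivAt (fun t => compX Φ (t, x₀, v₀) - pdx (compX Φ) (t, x₀, v₀) * x₀)
      (deriv (fun t => compX Φ (t, x₀, v₀) - pdx (compX Φ) (t, x₀, v₀) * x₀) t) t := fun t ht =>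
    (differentiableAt_of_contDiffOn_real Metric.isOpen_ball sχ ht).hasDerivAt
  have hXt : ∀ q ∈ (Metric.ball t₀ r ×ˢ Metric.ball x₀ r ×ˢ Metric.ball v₀ r : Set Pt),
      pdt (compX Φ) q = deriv (fun t => pdx (compX Φ) (t, x₀, v₀)) q.1 * q.2.1
        + deriv (fun t => compX Φ (t, x₀, v₀) - pdx (compX Φ) (t, x₀, v₀) * x₀) q.1 := by
    rintro ⟨t, x, v⟩ ⟨ht, hx, hv⟩
    refine (dslice _ sX t ht x hx v hv).unique
      ((((dδ t ht).mul_const x).fun_add (dχ t ht)).congr_of_eventuallyEq ?_)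
    filter_upwards [near t ht] with s hs using hX s hs x hx v hv
  have hXxt : ∀ q ∈ (Metric.ball t₀ r ×ˢ Metric.ball x₀ r ×ˢ Metric.ball v₀ r : Set Pt),
      pdt (pdx (compX Φ)) q = deriv (fun t => pdx (compX Φ) (t, x₀, v₀)) q.1 := by
    rintro ⟨t, x, v⟩ ⟨ht, hx, hv⟩
    refine (dslice _ sXx t ht x hx v hv).unique ((dδ t ht).congr_of_eventuallyEq ?_)
    filter_upwards [near t ht] with s hs using hXx s hs x hx v hv
  refine ⟨r, hr, fun t => pdx (compX Φ) (t, x₀, v₀),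
    fun t => compX Φ (t, x₀, v₀) - pdx (compX Φ) (t, x₀, v₀) * x₀,
    hbox, slice _ sXx, sχ, fun t ht => h.pdx_X_ne_zero (m0 t ht), ?_, hXt, hXxt, ?_, ?_⟩
  · intro t ht x hx
    have hq := hbox (show (t, x, v₀) ∈ Metric.ball t₀ r ×ˢ Metric.ball x₀ r ×ˢ Metric.ball v₀ r from
      ⟨ht, hx, hv₀⟩)
    exact ⟨h.mem_I hq, by rw [← hX t ht x hx v₀ hv₀]; exact h.compX_mem_I hq⟩
  · intro t ht x hx
    have hm : ((t, x, v₀) : Pt) ∈ Metric.ball t₀ r ×ˢ Metric.ball x₀ r ×ˢ Metric.ball v₀ r :=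
      ⟨ht, hx, hv₀⟩
    have e := (h.transform_coeffs (hbox hm)).1
    rwa [hXt _ hm, hXx t ht x hx v₀ hv₀, hX t ht x hx v₀ hv₀] at e
  · intro t ht x hx
    have hm : ((t, x, v₀) : Pt) ∈ Metric.ball t₀ r ×ˢ Metric.ball x₀ r ×ˢ Metric.ball v₀ r :=
      ⟨ht, hx, hv₀⟩
    have e := (h.transform_coeffs (hbox hm)).2
    have hTtt : pdt (pdt (compT Φ)) (t, x, v₀)
        = 2 * pdx (compX Φ) (t, x, v₀) * pdt (pdx (compX Φ)) (t, x, v₀) := by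
      refine (dslice _ (contDiffOn_pdt hU h.smooth_T) t ht x hx v₀ hv₀).unique ?_
      refine (((dslice _ sXx t ht x hx v₀ hv₀).fun_pow 2).congr_deriv (by simp))
        |>.congr_of_eventuallyEq ?_
      filter_upwards [near t ht] with s hs using (h.pd_X (hbox ⟨hs, hx, hv₀⟩)).2.symm
    have hne := h.pdx_X_ne_zero (m0 t ht)
    rw [hTtt, ← (h.pd_X (hbox hm)).2, hXxt _ hm, hXx t ht x hx v₀ hv₀, hX t ht x hx v₀ hv₀] at e
    rw [e]
    congr 1
    field_simp

end Equation.IsPointTransformation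

namespace HasAffineForm

variable {L L' : Equation} {Φ : OpenPartialHomeomorph Pt Pt} {K J M : Set ℝ} {δ χ : ℝ → ℝ}

lemma hasDerivAt_δ (h : HasAffineForm L L' Φ K J M δ χ) (hK : IsOpen K) {t : ℝ} (ht : t ∈ K) :
    HasDerivAt δ (deriv δ t) t :=
  (differentiableAt_of_contDiffOn_real hK h.smooth_δ ht).hasDerivAt

lemma hasDerivAt_χ (h : HasAffineForm L L' Φ K J M δ χ) (hK : IsOpen K) {t : ℝ} (ht : t ∈ K) :
    HasDerivAt χ (deriv χ t) t :=
  (differentiableAt_of_contDiffOn_real hK h.smooth_χ ht).hasDerivAt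

/-- Equations with linear `F` and constant `H`: comparison of coefficients gives
`m = δ'/δ + δ² m'` and `g = 2 δ'/δ + δ² g'`; if `g ≠ 2 m`, then `δ²` is constant. -/
lemma linear_linear (h : HasAffineForm L L' Φ K J M δ χ) (hK : IsOpen K) (hK' : K.Nonempty)
    (hJ : IsOpen J) (hJ' : J.Nonempty) {m g m' g' : ℝ}
    (hL : L.HasCoeffs (fun x => m * x) fun _ => g)
    (hL' : L'.HasCoeffs (fun x => m' * x) fun _ => g') :
    ∃ d : ℝ, d ≠ 0 ∧ g - 2 * m = d ^ 2 * (g' - 2 * m') ∧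
      (g - 2 * m ≠ 0 → m = d ^ 2 * m' ∧ g = d ^ 2 * g') := by
  have key : ∀ t ∈ K, m = deriv δ t / δ t + δ t ^ 2 * m' ∧
      g = 2 * (deriv δ t / δ t) + δ t ^ 2 * g' := by
    intro t ht
    constructor
    · obtain ⟨-, -, h1, -⟩ := cubic_coeffs_eq_zero hJ hJ' (a := 0) (b := 0)
        (c := deriv δ t / δ t + δ t ^ 2 * m' - m) (d := deriv χ t / δ t + δ t * m' * χ t)
        fun x hx => by
          obtain ⟨h1, h2⟩ := h.mem_I t ht x hx
          have e := h.F_eq t ht x hx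
          rw [hL.1 h1, hL'.1 h2, add_div, mul_div_right_comm] at e
          linear_combination -e
      linarith
    · obtain ⟨x, hx⟩ := hJ'
      obtain ⟨h1, h2⟩ := h.mem_I t ht x hx
      have e := h.H_eq t ht x hx
      rwa [hL.2 h1, hL'.2 h2] at e
  obtain ⟨t, ht⟩ := hK'
  have hdiff : ∀ t ∈ K, g - 2 * m = δ t ^ 2 * (g' - 2 * m') := fun t ht => by
    obtain ⟨e1, e2⟩ := key t ht
    linear_combination e2 - 2 * e1
  refine ⟨δ t, h.δ_ne t ht, hdiff t ht, fun hne => ?_⟩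
  have hne' : g' - 2 * m' ≠ 0 := fun h0 => hne (by rw [hdiff t ht, h0, mul_zero])
  have hd : deriv δ t = 0 := by
    have h1 := (h.hasDerivAt_δ hK ht).fun_pow 2
    have h2 : HasDerivAt (fun t => δ t ^ 2) 0 t := by
      refine (hasDerivAt_const t ((g - 2 * m) / (g' - 2 * m'))).congr_of_eventuallyEq ?_
      filter_upwards [hK.mem_nhds ht] with s hs
      rw [hdiff s hs, mul_div_cancel_right₀ _ hne']
    have h3 := h1.unique h2
    simpa [h.δ_ne t ht] using h3
  obtain ⟨e1, e2⟩ := key t ht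
  rw [hd, zero_div] at e1 e2
  constructor
  · linarith
  · linarith

/-- A linear `F` and a constant `H` have no poles: after multiplication by the denominators
`δ x + χ` and `(δ x + χ)²` the comparison of coefficients gives `α = β = 0`. -/
lemma not_linear_case2 (h : HasAffineForm L L' Φ K J M δ χ) (hK' : K.Nonempty)
    (hJ : IsOpen J) (hJ' : J.Nonempty) {m g α β : ℝ}
    (hL : L.HasCoeffs (fun x => m * x) fun _ => g) (hL' : L'.IsOfCase (.case2 α β)) : False := by
  obtain ⟨hαβ, h0, hF, hH⟩ := hL'
  obtain ⟨t, ht⟩ := hK'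
  have hδ := h.δ_ne t ht
  have hmem := h.mem_I t ht
  have hF_eq := h.F_eq t ht
  have hH_eq := h.H_eq t ht
  generalize deriv δ t = δ' at *
  generalize deriv χ t = χ' at *
  generalize δ t = d at *
  generalize χ t = e at *
  obtain ⟨-, h2, h3, h4⟩ := cubic_coeffs_eq_zero hJ hJ' (a := 0) (b := (m - δ' / d) * d)
    (c := (m - δ' / d) * e - χ' / d * d) (d := -(χ' / d) * e - d * α) fun x hx => by
      obtain ⟨i1, i2⟩ := hmem x hx
      have hy : d * x + e ≠ 0 := fun hy => h0 (hy ▸ i2)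
      have eq := hF_eq x hx
      rw [hL.1 i1, hF i2, add_div, mul_div_right_comm] at eq
      have hinv := mul_inv_cancel₀ hy
      linear_combination (d * x + e) * eq + d * α * hinv
  obtain ⟨-, k2, k3, k4⟩ := cubic_coeffs_eq_zero hJ hJ' (a := 0) (b := (g - 2 * (δ' / d)) * d ^ 2)
    (c := (g - 2 * (δ' / d)) * (2 * d * e)) (d := (g - 2 * (δ' / d)) * e ^ 2 - d ^ 2 * β)
    fun x hx => by
      obtain ⟨i1, i2⟩ := hmem x hx
      have hy : d * x + e ≠ 0 := fun hy => h0 (hy ▸ i2)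
      have eq := hH_eq x hx
      rw [hL.2 i1, hH i2] at eq
      have hinv := mul_inv_cancel₀ (pow_ne_zero 2 hy)
      linear_combination (d * x + e) ^ 2 * eq + d ^ 2 * β * hinv
  have h2' := (mul_eq_zero.1 h2).resolve_right hδ
  have k2' := (mul_eq_zero.1 k2).resolve_right (pow_ne_zero 2 hδ)
  rw [h2', zero_mul, zero_sub, neg_eq_zero] at h3
  have h3' := (mul_eq_zero.1 h3).resolve_right hδ
  rw [h3', neg_zero, zero_mul, zero_sub, neg_eq_zero] at h4
  rw [k2', zero_mul, zero_sub, neg_eq_zero] at k4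
  exact hαβ ⟨(mul_eq_zero.1 h4).resolve_left hδ,
    (mul_eq_zero.1 k4).resolve_left (pow_ne_zero 2 hδ)⟩

lemma not_case2_linear (h : HasAffineForm L L' Φ K J M δ χ) (hK' : K.Nonempty)
    (hJ : IsOpen J) (hJ' : J.Nonempty) {m g α β : ℝ} (hL : L.IsOfCase (.case2 α β))
    (hL' : L'.HasCoeffs (fun x => m * x) fun _ => g) : False := by
  obtain ⟨hαβ, h0, hF, hH⟩ := hL
  obtain ⟨t, ht⟩ := hK'
  have hmem := h.mem_I t ht
  have hF_eq := h.F_eq t ht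
  have hH_eq := h.H_eq t ht
  generalize deriv δ t = δ' at *
  generalize deriv χ t = χ' at *
  generalize δ t = d at *
  generalize χ t = e at *
  obtain ⟨-, -, -, h4⟩ := cubic_coeffs_eq_zero hJ hJ' (a := 0) (b := δ' / d + d * m * d)
    (c := χ' / d + d * m * e) (d := -α) fun x hx => by
      obtain ⟨i1, i2⟩ := hmem x hx
      have hx0 : x ≠ 0 := fun hx0 => h0 (hx0 ▸ i1)
      have eq := hF_eq x hx
      rw [hF i1, hL'.1 i2, add_div, mul_div_right_comm] at eq
      have hinv := mul_inv_cancel₀ hx0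
      linear_combination -x * eq + α * hinv
  obtain ⟨-, -, -, k4⟩ := cubic_coeffs_eq_zero hJ hJ' (a := 0) (b := 2 * (δ' / d) + d ^ 2 * g)
    (c := 0) (d := -β) fun x hx => by
      obtain ⟨i1, i2⟩ := hmem x hx
      have hx0 : x ≠ 0 := fun hx0 => h0 (hx0 ▸ i1)
      have eq := hH_eq x hx
      rw [hH i1, hL'.2 i2] at eq
      have hinv := mul_inv_cancel₀ (pow_ne_zero 2 hx0)
      linear_combination -x ^ 2 * eq + β * hinv
  exact hαβ ⟨neg_eq_zero.1 h4, neg_eq_zero.1 k4⟩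

/-- Clearing denominators gives `δ' = χ' = 0` from the highest coefficients, then `α' = α` and
`β' = β`. -/
lemma case2_case2 (h : HasAffineForm L L' Φ K J M δ χ) (hK' : K.Nonempty)
    (hJ : IsOpen J) (hJ' : J.Nonempty) {α β α' β' : ℝ} (hL : L.IsOfCase (.case2 α β))
    (hL' : L'.IsOfCase (.case2 α' β')) : α' = α ∧ β' = β := by
  obtain ⟨-, h0, hF, hH⟩ := hL
  obtain ⟨-, h0', hF', hH'⟩ := hL'
  obtain ⟨t, ht⟩ := hK'
  have hδ := h.δ_ne t ht
  have hmem := h.mem_I t ht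
  have hF_eq := h.F_eq t ht
  have hH_eq := h.H_eq t ht
  generalize deriv δ t = δ' at *
  generalize deriv χ t = χ' at *
  generalize δ t = d at *
  generalize χ t = e at *
  obtain ⟨h1, h2, h3, -⟩ := cubic_coeffs_eq_zero hJ hJ' (a := δ' / d * d)
    (b := δ' / d * e + χ' / d * d) (c := χ' / d * e + d * α' - α * d) (d := -α * e) fun x hx => by
      obtain ⟨i1, i2⟩ := hmem x hx
      have hx0 : x ≠ 0 := fun hx0 => h0 (hx0 ▸ i1)
      have hy : d * x + e ≠ 0 := fun hy => h0' (hy ▸ i2)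
      have eq := hF_eq x hx
      rw [hF i1, hF' i2, add_div, mul_div_right_comm] at eq
      have hinv := mul_inv_cancel₀ hx0
      have hinv' := mul_inv_cancel₀ hy
      linear_combination -x * (d * x + e) * eq + α * (d * x + e) * hinv - d * α' * x * hinv'
  have h1' := (mul_eq_zero.1 h1).resolve_right hδ
  rw [h1', zero_mul, zero_add] at h2
  have h2' := (mul_eq_zero.1 h2).resolve_right hδ
  rw [h2'] at h3
  obtain ⟨-, k2, -, -⟩ := cubic_coeffs_eq_zero hJ hJ' (a := 0) (b := d ^ 2 * β' - d ^ 2 * β)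
    (c := -β * (2 * d * e)) (d := -β * e ^ 2) fun x hx => by
      obtain ⟨i1, i2⟩ := hmem x hx
      have hx0 : x ≠ 0 := fun hx0 => h0 (hx0 ▸ i1)
      have hy : d * x + e ≠ 0 := fun hy => h0' (hy ▸ i2)
      have eq := hH_eq x hx
      rw [hH i1, hH' i2, h1'] at eq
      have hinv := mul_inv_cancel₀ (pow_ne_zero 2 hx0)
      have hinv' := mul_inv_cancel₀ (pow_ne_zero 2 hy)
      linear_combination -x ^ 2 * (d * x + e) ^ 2 * eq + β * (d * x + e) ^ 2 * hinv
        - d ^ 2 * β' * x ^ 2 * hinv'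
  constructor
  · apply mul_left_cancel₀ hδ; linarith
  · apply mul_left_cancel₀ (pow_ne_zero 2 hδ); linarith

end HasAffineForm

namespace Equation

lemma IsOfCase.linear3 {L : Equation} {μ γ : ℝ} (h : L.IsOfCase (.case3 μ γ)) :
    L.HasCoeffs (fun x => μ * x) fun _ => γ := h.2.2

lemma IsOfCase.linear4 {L : Equation} {γ : ℝ} (h : L.IsOfCase (.case4 γ)) :
    L.HasCoeffs (fun x => 0 * x) fun _ => γ := by simpa using h.2

lemma IsOfCase.linear6 {L : Equation} (h : L.IsOfCase .case6) :
    L.HasCoeffs (fun x => 0 * x) fun _ => 0 := by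
  have : L.HasCoeffs (fun _ => 0) (fun _ => 0) := h
  simpa using this

theorem sameClass_of_isPointTransformation {L L' : Equation} {c c' : ExtCase}
    {Φ : OpenPartialHomeomorph Pt Pt} (hc : L.IsOfCase c) (hc' : L'.IsOfCase c')
    (h : L.IsPointTransformation L' Φ) : c.SameClass c' := by
  obtain ⟨p, hp⟩ := h.1
  obtain ⟨r, hr, δ, χ, hA⟩ := h.exists_affineForm hp
  have hK : (Metric.ball p.1 r).Nonempty := ⟨_, Metric.mem_ball_self hr⟩
  have hJ : (Metric.ball p.2.1 r).Nonempty := ⟨_, Metric.mem_ball_self hr⟩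
  have oK := Metric.isOpen_ball (x := p.1) (ε := r)
  have oJ := Metric.isOpen_ball (x := p.2.1) (ε := r)
  cases c with
  | case2 α β =>
    cases c' with
    | case2 α' β' => exact hA.case2_case2 hK oJ hJ hc hc'
    | case3 μ' γ' => exact (hA.not_case2_linear hK oJ hJ hc hc'.linear3).elim
    | case4 γ' => exact (hA.not_case2_linear hK oJ hJ hc hc'.linear4).elim
    | case6 => exact (hA.not_case2_linear hK oJ hJ hc hc'.linear6).elim
  | case3 μ γ =>
    have hμ : μ ≠ 0 := by rcases hc.1 with h | h <;> rw [h] <;> norm_num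
    have hγ : γ - 2 * μ ≠ 0 := sub_ne_zero.2 hc.2.1
    cases c' with
    | case2 α' β' => exact (hA.not_linear_case2 hK oJ hJ hc.linear3 hc').elim
    | case3 μ' γ' =>
      obtain ⟨d, hd, -, h2⟩ := hA.linear_linear oK hK oJ hJ hc.linear3 hc'.linear3
      obtain ⟨e1, e2⟩ := h2 hγ
      have hd2 : 0 < d ^ 2 := by positivity
      have h3 : μ' = μ ∧ d ^ 2 = 1 := by
        rcases hc.1 with a | a <;> rcases hc'.1 with b | b <;> rw [a, b] at e1 ⊢ <;>
          first | exact ⟨rfl, by linarith⟩ | (exfalso; linarith)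
      exact ⟨h3.1, by rw [e2, h3.2, one_mul]⟩
    | case4 γ' =>
      obtain ⟨d, hd, -, h2⟩ := hA.linear_linear oK hK oJ hJ hc.linear3 hc'.linear4
      exact (hμ (by rw [(h2 hγ).1, mul_zero])).elim
    | case6 =>
      obtain ⟨d, hd, -, h2⟩ := hA.linear_linear oK hK oJ hJ hc.linear3 hc'.linear6
      exact (hμ (by rw [(h2 hγ).1, mul_zero])).elim
  | case4 γ =>
    have hγ : γ - 2 * 0 ≠ 0 := by simpa using hc.1
    cases c' with
    | case2 α' β' => exact (hA.not_linear_case2 hK oJ hJ hc.linear4 hc').elim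
    | case3 μ' γ' =>
      obtain ⟨d, hd, -, h2⟩ := hA.linear_linear oK hK oJ hJ hc.linear4 hc'.linear3
      have h3 := (h2 hγ).1
      have hμ' : μ' = 0 := (mul_eq_zero.1 h3.symm).resolve_left (pow_ne_zero 2 hd)
      rcases hc'.1 with a | a <;> rw [a] at hμ' <;> norm_num at hμ'
    | case4 γ' =>
      obtain ⟨d, hd, -, h2⟩ := hA.linear_linear oK hK oJ hJ hc.linear4 hc'.linear4
      exact ⟨d, hd, by rw [(h2 hγ).2, inv_mul_cancel_left₀ (pow_ne_zero 2 hd)]⟩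
    | case6 =>
      obtain ⟨d, hd, -, h2⟩ := hA.linear_linear oK hK oJ hJ hc.linear4 hc'.linear6
      exact (hc.1 (by rw [(h2 hγ).2, mul_zero])).elim
  | case6 =>
    cases c' with
    | case2 α' β' => exact (hA.not_linear_case2 hK oJ hJ hc.linear6 hc').elim
    | case3 μ' γ' =>
      obtain ⟨d, hd, h1, -⟩ := hA.linear_linear oK hK oJ hJ hc.linear6 hc'.linear3
      simp only [mul_zero, sub_zero] at h1
      exact (hc'.2.1 (sub_eq_zero.1
        ((mul_eq_zero.1 h1.symm).resolve_left (pow_ne_zero 2 hd)))).elim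
    | case4 γ' =>
      obtain ⟨d, hd, h1, -⟩ := hA.linear_linear oK hK oJ hJ hc.linear6 hc'.linear4
      simp only [mul_zero, sub_zero] at h1
      exact (hc'.1 ((mul_eq_zero.1 h1.symm).resolve_left (pow_ne_zero 2 hd))).elim
    | case6 => trivial

end Equation

/-! ### Rigidity of point transformations of equations without symmetry extension -/

/-- Uniqueness for linear differential inequalities, in both time directions. -/
lemma eq_zero_of_abs_deriv_le {K : Set ℝ} (hK : IsPreconnected K) {f f' C : ℝ → ℝ}
    (hf : ∀ t ∈ K, HasDerivAt f (f' t) t) (hC : ContinuousOn C K)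
    (hbound : ∀ t ∈ K, |f' t| ≤ C t * |f t|) {a b : ℝ} (ha : a ∈ K) (hb : b ∈ K)
    (h0 : f a = 0) : f b = 0 := by
  have forward : ∀ (g g' : ℝ → ℝ) (m a b : ℝ), a ≤ b → (∀ t ∈ Icc a b, HasDerivAt g (g' t) t) →
      (∀ t ∈ Icc a b, |g' t| ≤ m * |g t|) → g a = 0 → g b = 0 := by
    intro g g' m a b hab hg hm ha
    exact eq_zero_of_abs_deriv_le_mul_abs_self_of_eq_zero_right
      (fun t ht => (hg t ht).continuousAt.continuousWithinAt)
      (fun t ht => (hg t (Ico_subset_Icc_self ht)).hasDerivWithinAt) ha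
      (fun t ht => hm t (Ico_subset_Icc_self ht)) b (right_mem_Icc.2 hab)
  have hbd : ∀ a ∈ K, ∀ b ∈ K, ∃ m, ∀ t ∈ Icc a b, |f' t| ≤ m * |f t| := by
    intro a ha b hb
    obtain ⟨m, hm⟩ := isCompact_Icc.exists_bound_of_continuousOn
      (hC.mono (hK.Icc_subset ha hb))
    exact ⟨m, fun t ht => (hbound t (hK.Icc_subset ha hb ht)).trans
      (mul_le_mul_of_nonneg_right ((le_abs_self _).trans (hm t ht)) (abs_nonneg _))⟩
  rcases le_total a b with hab | hba
  · obtain ⟨m, hm⟩ := hbd a ha b hb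
    exact forward f f' m a b hab (fun t ht => hf t (hK.Icc_subset ha hb ht)) hm h0
  · obtain ⟨m, hm⟩ := hbd b hb a ha
    have hneg : ∀ t ∈ Icc (-a) (-b), -t ∈ Icc b a := fun t ht =>
      ⟨by linarith [ht.2], by linarith [ht.1]⟩
    have := forward (fun t => f (-t)) (fun t => -f' (-t)) m (-a) (-b) (by linarith)
      (fun t ht => by
        have h1 := hf (-t) (hK.Icc_subset hb ha (hneg t ht))
        simpa [Function.comp_def] using h1.scomp t (hasDerivAt_neg t))
      (fun t ht => by simpa using hm _ (hneg t ht)) (by simpa using h0)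
    simpa using this

namespace HasAffineForm

variable {L L' : Equation} {Φ : OpenPartialHomeomorph Pt Pt} {K J M : Set ℝ} {δ χ : ℝ → ℝ}

lemma hasDerivAt_logDeriv (h : HasAffineForm L L' Φ K J M δ χ) (hK : IsOpen K) {t : ℝ}
    (ht : t ∈ K) :
    HasDerivAt (fun t => deriv δ t / δ t) (deriv (fun t => deriv δ t / δ t) t) t ∧
      HasDerivAt (fun t => deriv χ t / δ t) (deriv (fun t => deriv χ t / δ t) t) t := by
  have h1 : ContDiffOn ℝ ∞ (deriv δ) K := h.smooth_δ.deriv_of_isOpen hK (by simp)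
  have h2 : ContDiffOn ℝ ∞ (deriv χ) K := h.smooth_χ.deriv_of_isOpen hK (by simp)
  exact ⟨(differentiableAt_of_contDiffOn_real hK (h1.div h.smooth_δ h.δ_ne) ht).hasDerivAt,
    (differentiableAt_of_contDiffOn_real hK (h2.div h.smooth_δ h.δ_ne) ht).hasDerivAt⟩

/-- Since `F` and `H` do not depend on `t`, differentiating the relations between the
coefficients with respect to `t`, and eliminating `L'` by their `x`-derivatives, gives
relations for `F` and `H` alone. -/
lemma symRel (h : HasAffineForm L L' Φ K J M δ χ) (hK : IsOpen K) (hJ : IsOpen J) {t : ℝ}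
    (ht : t ∈ K) :
    SymRel L.F L.H J (deriv δ t / δ t) (deriv χ t / δ t)
      (2 * (deriv δ t / δ t) ^ 2 - deriv (fun t => deriv δ t / δ t) t)
      (2 * (deriv δ t / δ t) * (deriv χ t / δ t) - deriv (fun t => deriv χ t / δ t) t) := by
  intro x hx
  obtain ⟨hxI, hyI⟩ := h.mem_I t ht x hx
  have hδ := h.δ_ne t ht
  obtain ⟨dk, dl⟩ := h.hasDerivAt_logDeriv hK ht
  have dδ := h.hasDerivAt_δ hK ht
  have dχ := h.hasDerivAt_χ hK ht
  have dF' := (L'.differentiableAt_F hyI).hasDerivAt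
  have dH' := (L'.differentiableAt_H hyI).hasDerivAt
  have dy : HasDerivAt (fun t => δ t * x + χ t) (deriv δ t * x + deriv χ t) t :=
    (dδ.mul_const x).fun_add dχ
  have dyx : HasDerivAt (fun x => δ t * x + χ t) (δ t) x := by
    simpa using ((hasDerivAt_id x).const_mul (δ t)).add_const (χ t)
  have eF : ∀ t ∈ K, ∀ x ∈ J, L.F x = deriv δ t / δ t * x + deriv χ t / δ t
      + δ t * L'.F (δ t * x + χ t) := fun t ht x hx => by
    rw [h.F_eq t ht x hx, add_div, mul_div_right_comm]
  -- derivatives with respect to `t`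
  have t1 := ((dk.mul_const x).fun_add dl).fun_add (dδ.fun_mul (dF'.comp t dy))
  have t1' := t1.unique ((hasDerivAt_const t (L.F x)).congr_of_eventuallyEq (by
    filter_upwards [hK.mem_nhds ht] with s hs using (eF s hs x hx).symm))
  have t2 := (dk.const_mul 2).fun_add ((dδ.fun_pow 2).fun_mul (dH'.comp t dy))
  have t2' := t2.unique ((hasDerivAt_const t (L.H x)).congr_of_eventuallyEq (by
    filter_upwards [hK.mem_nhds ht] with s hs using (h.H_eq s hs x hx).symm))
  -- derivatives with respect to `x`
  have x1 := (((hasDerivAt_id x).const_mul (deriv δ t / δ t)).add_const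
    (deriv χ t / δ t)).fun_add ((dF'.comp x dyx).const_mul (δ t))
  have x1' := x1.unique ((L.differentiableAt_F hxI).hasDerivAt.congr_of_eventuallyEq (by
    filter_upwards [hJ.mem_nhds hx] with y hy using (eF t ht y hy).symm))
  have x2 := ((dH'.comp x dyx).const_mul (δ t ^ 2)).const_add (2 * (deriv δ t / δ t))
  have x2' := x2.unique ((L.differentiableAt_H hxI).hasDerivAt.congr_of_eventuallyEq (by
    filter_upwards [hJ.mem_nhds hx] with y hy using (h.H_eq t ht y hy).symm))
  have f0 := eF t ht x hx
  have h0 := h.H_eq t ht x hx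
  simp only [Function.comp_def, Nat.cast_ofNat, Nat.add_one_sub_one, pow_one, mul_one]
    at t1' t2' x1' x2'
  obtain ⟨k, hk⟩ : ∃ k, k = deriv δ t / δ t := ⟨_, rfl⟩
  obtain ⟨l, hl⟩ : ∃ l, l = deriv χ t / δ t := ⟨_, rfl⟩
  have ek : deriv δ t = k * δ t := by rw [hk]; field_simp
  have el : deriv χ t = l * δ t := by rw [hl]; field_simp
  rw [← hk] at x1' f0 h0 ⊢
  rw [← hl] at f0 ⊢
  rw [ek, el] at t1' t2'
  constructor
  · rw [← x1', f0]
    linear_combination t1'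
  · rw [← x2', h0]
    linear_combination t2'

/-- `δ'` and `χ'` vanish simultaneously either everywhere or nowhere: they solve a system of
ordinary differential equations whose right-hand side vanishes at the origin. -/
lemma stationary_of_stationary (h : HasAffineForm L L' Φ K J M δ χ) (hK : IsOpen K)
    (hK' : IsPreconnected K) (hJ : IsOpen J) (hJ' : J.Nonempty) {t₁ t₂ : ℝ} (h1 : t₁ ∈ K)
    (h2 : t₂ ∈ K) (h0 : deriv δ t₁ = 0 ∧ deriv χ t₁ = 0) :
    deriv δ t₂ = 0 ∧ deriv χ t₂ = 0 := by
  obtain ⟨x, hx⟩ := hJ'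
  obtain ⟨k, hk⟩ : ∃ k : ℝ → ℝ, k = fun t => deriv δ t / δ t := ⟨_, rfl⟩
  obtain ⟨l, hl⟩ : ∃ l : ℝ → ℝ, l = fun t => deriv χ t / δ t := ⟨_, rfl⟩
  have dk : ∀ t ∈ K, HasDerivAt k (deriv k t) t := fun t ht => by
    rw [hk]; exact (h.hasDerivAt_logDeriv hK ht).1
  have dl : ∀ t ∈ K, HasDerivAt l (deriv l t) t := fun t ht => by
    rw [hl]; exact (h.hasDerivAt_logDeriv hK ht).2
  have hrel : ∀ t ∈ K, _ := fun t ht => h.symRel hK hJ ht x hx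
  rw [← hk, ← hl] at hrel
  have hkt : ∀ t, deriv δ t / δ t = k t := fun t => by rw [hk]
  have hlt : ∀ t, deriv χ t / δ t = l t := fun t => by rw [hl]
  simp only [hkt, hlt] at hrel
  have hsq : ∀ y : ℝ, |k y ^ 2 + l y ^ 2| = k y ^ 2 + l y ^ 2 := fun y =>
    abs_of_nonneg (by positivity)
  -- the coefficients of the quadratic form in `k`, `l` that `(k² + l²)'` contains besides the
  -- cubic term `4 k (k² + l²)`
  obtain ⟨a, ha⟩ : ∃ a, a = -(2 * L.H x + x * deriv L.H x) := ⟨_, rfl⟩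
  obtain ⟨b, hb⟩ : ∃ b, b = -deriv L.H x + x * (2 * L.H x + x * deriv L.H x)
    - 2 * (L.F x + x * deriv L.F x) := ⟨_, rfl⟩
  obtain ⟨c, hc⟩ : ∃ c, c = x * deriv L.H x - 2 * deriv L.F x := ⟨_, rfl⟩
  have hz : k t₂ ^ 2 + l t₂ ^ 2 = 0 := by
    -- the relations at a fixed `x` express `k'`, `l'` through `k`, `l`, which bounds `(k² + l²)'`
    refine eq_zero_of_abs_deriv_le hK' (f := fun t => k t ^ 2 + l t ^ 2)
      (f' := fun t => 2 * k t * deriv k t + 2 * l t * deriv l t)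
      (C := fun t => 4 * |k t| + (|a| + |b| + |c|)) (fun t ht => ?_) ?_ (fun t ht => ?_) h1 h2 ?_
    · simpa using ((dk t ht).fun_pow 2).fun_add ((dl t ht).fun_pow 2)
    · have hkc : ContinuousOn k K := fun t ht => (dk t ht).continuousAt.continuousWithinAt
      exact (continuousOn_const.mul hkc.abs).add continuousOn_const
    · obtain ⟨e1, e2⟩ := hrel t ht
      have e3 : 2 * k t * deriv k t + 2 * l t * deriv l t = 4 * k t * (k t ^ 2 + l t ^ 2)
          + (a * k t ^ 2 + b * (k t * l t) + c * l t ^ 2) := by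
        rw [ha, hb, hc]
        linear_combination 2 * l t * e1 - (x * l t - k t) * e2
      have hkl : |k t * l t| ≤ k t ^ 2 + l t ^ 2 := by
        rw [abs_le]
        constructor <;> nlinarith [sq_nonneg (k t + l t), sq_nonneg (k t - l t)]
      have q1 : |a * k t ^ 2| ≤ |a| * (k t ^ 2 + l t ^ 2) := by
        rw [abs_mul, abs_of_nonneg (sq_nonneg (k t))]
        exact mul_le_mul_of_nonneg_left (by linarith [sq_nonneg (l t)]) (abs_nonneg a)
      have q2 : |b * (k t * l t)| ≤ |b| * (k t ^ 2 + l t ^ 2) := by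
        rw [abs_mul]; exact mul_le_mul_of_nonneg_left hkl (abs_nonneg b)
      have q3 : |c * l t ^ 2| ≤ |c| * (k t ^ 2 + l t ^ 2) := by
        rw [abs_mul, abs_of_nonneg (sq_nonneg (l t))]
        exact mul_le_mul_of_nonneg_left (by linarith [sq_nonneg (k t)]) (abs_nonneg c)
      have q0 : |4 * k t * (k t ^ 2 + l t ^ 2)| = 4 * |k t| * (k t ^ 2 + l t ^ 2) := by
        rw [abs_mul, hsq, abs_mul]; norm_num
      rw [e3, hsq]
      calc _ ≤ |4 * k t * (k t ^ 2 + l t ^ 2)|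
            + (|a * k t ^ 2| + |b * (k t * l t)| + |c * l t ^ 2|) :=
            (abs_add_le _ _).trans (add_le_add_right (abs_add_three _ _ _) _)
        _ ≤ _ := by rw [q0]; linarith
    · simp [hk, hl, h0]
  have hk0 : k t₂ = 0 := by nlinarith [sq_nonneg (k t₂), sq_nonneg (l t₂)]
  have hl0 : l t₂ = 0 := by nlinarith [sq_nonneg (k t₂), sq_nonneg (l t₂)]
  rw [← hkt] at hk0
  rw [← hlt] at hl0
  have hδ := h.δ_ne t₂ h2
  exact ⟨(div_eq_zero_iff.1 hk0).resolve_right hδ, (div_eq_zero_iff.1 hl0).resolve_right hδ⟩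

end HasAffineForm

namespace HasSpecialForm

variable {F H : ℝ → ℝ} {J : Set ℝ}

lemma analyticAt (h : HasSpecialForm F H J) (hJ : IsOpen J) {x : ℝ} (hx : x ∈ J) :
    AnalyticAt ℝ F x ∧ AnalyticAt ℝ H x := by
  have hnear := hJ.mem_nhds hx
  rcases h with ⟨c, α, β, μ, h⟩ | ⟨μ, l, γ, h⟩
  · have hxc := (h x hx).1
    have h0 : AnalyticAt ℝ (fun x => x + c) x := analyticAt_id.add analyticAt_const
    constructor
    · refine ((analyticAt_const.mul (h0.inv hxc)).add (analyticAt_const.mul h0)).congr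
        (f := fun x => α * (x + c)⁻¹ + μ * (x + c)) ?_
      filter_upwards [hnear] with y hy using (h y hy).2.1.symm
    · refine ((analyticAt_const.mul ((h0.pow 2).inv (pow_ne_zero 2 hxc))).add
        analyticAt_const).congr (f := fun x => β * ((x + c) ^ 2)⁻¹ + 2 * μ) ?_
      filter_upwards [hnear] with y hy using (h y hy).2.2.symm
  · constructor
    · refine ((analyticAt_const.mul analyticAt_id).add analyticAt_const).congr
        (f := fun x => μ * x + l) ?_
      filter_upwards [hnear] with y hy using (h y hy).1.symm
    · refine (analyticAt_const (v := γ)).congr ?_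
      filter_upwards [hnear] with y hy using (h y hy).2.symm

/-- The special form holds on an interval as soon as it holds near each of its points, by the
identity theorem for analytic functions. -/
theorem of_local {I : Set ℝ} (hI : IsConnected I)
    (h : ∀ x ∈ I, ∃ J, IsOpen J ∧ x ∈ J ∧ HasSpecialForm F H J) : HasSpecialForm F H I := by
  have aF : AnalyticOnNhd ℝ F I := fun x hx => by
    obtain ⟨J, hJ, hxJ, hS⟩ := h x hx
    exact (hS.analyticAt hJ hxJ).1
  have aH : AnalyticOnNhd ℝ H I := fun x hx => by
    obtain ⟨J, hJ, hxJ, hS⟩ := h x hx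
    exact (hS.analyticAt hJ hxJ).2
  obtain ⟨x₀, hx₀⟩ := hI.nonempty
  obtain ⟨J, hJ, hxJ, hS⟩ := h x₀ hx₀
  have hnear := hJ.mem_nhds hxJ
  have ident : ∀ f g : ℝ → ℝ, AnalyticOnNhd ℝ f I → AnalyticOnNhd ℝ g I →
      (∀ x ∈ J, f x = g x) → ∀ x ∈ I, f x = g x := fun f g hf hg hfg =>
    hf.eqOn_of_preconnected_of_eventuallyEq hg hI.isPreconnected hx₀
      (by filter_upwards [hnear] with y hy using hfg y hy)
  have aconst : ∀ c : ℝ, AnalyticOnNhd ℝ (fun _ => c) I := fun c => analyticOnNhd_const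
  have aid : AnalyticOnNhd ℝ (fun x => x) I := analyticOnNhd_id
  rcases hS with ⟨c, α, β, μ, hS⟩ | ⟨μ, l, γ, hS⟩
  · have axc : AnalyticOnNhd ℝ (fun x => x + c) I := aid.add (aconst c)
    have hF := ident (fun x => (x + c) * F x) (fun x => α + μ * (x + c) ^ 2) (axc.mul aF)
      ((aconst α).add ((aconst μ).mul (axc.pow 2))) fun x hx => by
        obtain ⟨hxc, e, -⟩ := hS x hx
        rw [e]; field_simp
    have hH := ident (fun x => (x + c) ^ 2 * H x) (fun x => β + 2 * μ * (x + c) ^ 2)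
      ((axc.pow 2).mul aH) ((aconst β).add ((aconst (2 * μ)).mul (axc.pow 2))) fun x hx => by
        obtain ⟨hxc, -, e⟩ := hS x hx
        rw [e]; field_simp
    by_cases hc : -c ∈ I
    · -- there is no pole in this case
      have hα : α = 0 := by simpa using (hF _ hc).symm
      have hβ : β = 0 := by simpa using (hH _ hc).symm
      subst hα hβ
      right
      refine ⟨μ, μ * c, 2 * μ, fun x hx => ⟨?_, ?_⟩⟩
      · exact ident F (fun x => μ * x + μ * c) aF (((aconst μ).mul aid).add (aconst _))
          (fun y hy => by rw [(hS y hy).2.1]; ring) x hx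
      · exact ident H (fun x => 2 * μ) aH (aconst _)
          (fun y hy => by rw [(hS y hy).2.2]; ring) x hx
    · left
      refine ⟨c, α, β, μ, fun x hx => ?_⟩
      have hxc : x + c ≠ 0 := fun h0 => hc (by rwa [← eq_neg_of_add_eq_zero_left h0])
      have e1 := hF x hx
      have e2 := hH x hx
      refine ⟨hxc, ?_, ?_⟩
      · field_simp; linear_combination e1
      · field_simp; linear_combination e2
  · right
    exact ⟨μ, l, γ, fun x hx => ⟨ident F (fun x => μ * x + l) aF
      (((aconst μ).mul aid).add (aconst l)) (fun y hy => (hS y hy).1) x hx,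
      ident H (fun _ => γ) aH (aconst γ) (fun y hy => (hS y hy).2) x hx⟩⟩

lemma of_isOfCase {L : Equation} {c : ExtCase} (h : L.IsOfCase c) :
    HasSpecialForm L.F L.H L.I := by
  cases c with
  | case2 α β =>
    refine Or.inl ⟨0, α, β, 0, fun x hx => ⟨fun h0 => h.2.1 ?_, ?_, ?_⟩⟩
    · rw [add_zero] at h0; rwa [← h0]
    · rw [h.2.2.1 hx]; simp
    · rw [h.2.2.2 hx]; simp
  | case3 μ γ =>
    exact Or.inr ⟨μ, 0, γ, fun x hx => ⟨by rw [h.linear3.1 hx]; simp, h.linear3.2 hx⟩⟩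
  | case4 γ =>
    exact Or.inr ⟨0, 0, γ, fun x hx => ⟨by rw [h.linear4.1 hx]; simp, h.linear4.2 hx⟩⟩
  | case6 =>
    exact Or.inr ⟨0, 0, 0, fun x hx => ⟨by rw [h.linear6.1 hx]; simp, h.linear6.2 hx⟩⟩

lemma comp_affine {F' H' : ℝ → ℝ} {I I' : Set ℝ} {d e : ℝ} (hd : d ≠ 0)
    (h : HasSpecialForm F' H' I') (hI : ∀ x ∈ I, d * x + e ∈ I')
    (hF : ∀ x ∈ I, F x = d * F' (d * x + e)) (hH : ∀ x ∈ I, H x = d ^ 2 * H' (d * x + e)) :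
    HasSpecialForm F H I := by
  rcases h with ⟨c, α, β, μ, h⟩ | ⟨μ, l, γ, h⟩
  · refine Or.inl ⟨(e + c) / d, α, β, d ^ 2 * μ, fun x hx => ?_⟩
    obtain ⟨h1, h2, h3⟩ := h _ (hI x hx)
    have hx' : x + (e + c) / d = (d * x + e + c) / d := by field_simp; ring
    rw [hF x hx, hH x hx, h2, h3, hx']
    refine ⟨div_ne_zero h1 hd, ?_, ?_⟩
    · field_simp
    · field_simp
  · refine Or.inr ⟨d ^ 2 * μ, d * (μ * e + l), d ^ 2 * γ, fun x hx => ?_⟩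
    obtain ⟨h1, h2⟩ := h _ (hI x hx)
    rw [hF x hx, hH x hx, h1, h2]
    constructor <;> ring

end HasSpecialForm

/-- A function with constant first derivatives on a connected open set is affine. -/
lemma exists_eq_affine {U : Set Pt} (hU : IsOpen U) (hU' : IsPreconnected U) {φ : Pt → ℝ}
    (hφ : ContDiffOn ℝ ∞ φ U) {a b c : ℝ}
    (h : ∀ p ∈ U, pdt φ p = a ∧ pdx φ p = b ∧ pdv φ p = c) :
    ∃ d, ∀ p ∈ U, φ p = a * p.1 + b * p.2.1 + c * p.2.2 + d := by
  have hl : ∀ p : Pt, HasFDerivAt (fun p : Pt => a * p.1 + b * p.2.1 + c * p.2.2)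
      (a • ContinuousLinearMap.fst ℝ ℝ (ℝ × ℝ)
        + b • (ContinuousLinearMap.fst ℝ ℝ ℝ).comp (ContinuousLinearMap.snd ℝ ℝ (ℝ × ℝ))
        + c • (ContinuousLinearMap.snd ℝ ℝ ℝ).comp (ContinuousLinearMap.snd ℝ ℝ (ℝ × ℝ))) p :=
    fun p => ((hasFDerivAt_fst.const_mul a).add
      (hasFDerivAt_snd.fst.const_mul b)).add (hasFDerivAt_snd.snd.const_mul c)
  obtain ⟨d, hd⟩ := hU.exists_eq_add_of_fderiv_eq hU' (hφ.differentiableOn (by simp))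
    (fun p _ => (hl p).differentiableAt.differentiableWithinAt) (fun p hp => by
      rw [(hl p).fderiv]
      refine ContinuousLinearMap.ext fun w => ?_
      obtain ⟨w1, w2, w3⟩ := w
      rw [fderiv_eq_pd, (h p hp).1, (h p hp).2.1, (h p hp).2.2]
      simp [mul_comm])
  exact ⟨d, fun p hp => hd hp⟩

namespace Equation.IsPointTransformation

variable {L L' : Equation} {Φ : OpenPartialHomeomorph Pt Pt}

/-- A point transformation of an equation without symmetry extension has `X_t = X_{tx} = 0`. The
set of points where this holds is open and closed in the domain, and where it fails `F` and `H`
have the special form. -/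
theorem stationary_of_isCase0 (h : L.IsPointTransformation L' Φ) (h0 : L.IsCase0)
    (hconn : IsConnected Φ.source) (hproj : (fun p : Pt => p.2.1) '' Φ.source = L.I) :
    ∀ p ∈ Φ.source, pdt (pdx (compX Φ)) p = 0 ∧ pdt (compX Φ) p = 0 := by
  have hloc : ∀ p ∈ Φ.source, ∃ N : Set Pt, IsOpen N ∧ p ∈ N ∧ N ⊆ Φ.source ∧
      ((∀ q ∈ N, pdt (pdx (compX Φ)) q = 0 ∧ pdt (compX Φ) q = 0) ∨
        ((∀ q ∈ N, ¬(pdt (pdx (compX Φ)) q = 0 ∧ pdt (compX Φ) q = 0)) ∧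
          ∃ J, IsOpen J ∧ p.2.1 ∈ J ∧ HasSpecialForm L.F L.H J)) := by
    intro p hp
    obtain ⟨r, hr, δ, χ, hA⟩ := h.exists_affineForm hp
    have hK : IsPreconnected (Metric.ball p.1 r) := (convex_ball _ _).isPreconnected
    have hJ : IsConnected (Metric.ball p.2.1 r) :=
      ⟨⟨_, Metric.mem_ball_self hr⟩, (convex_ball _ _).isPreconnected⟩
    have hiff : ∀ q ∈ Metric.ball p.1 r ×ˢ Metric.ball p.2.1 r ×ˢ Metric.ball p.2.2 r,
        (pdt (pdx (compX Φ)) q = 0 ∧ pdt (compX Φ) q = 0) ↔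
          (deriv δ q.1 = 0 ∧ deriv χ q.1 = 0) := by
      intro q hq
      rw [hA.pdt_pdx_X q hq, hA.pdt_X q hq]
      constructor
      · rintro ⟨e1, e2⟩
        rw [e1] at e2
        exact ⟨e1, by simpa using e2⟩
      · rintro ⟨e1, e2⟩
        simp [e1, e2]
    have hp1 := Metric.mem_ball_self (x := p.1) hr
    refine ⟨_, isOpen_box Metric.isOpen_ball Metric.isOpen_ball Metric.isOpen_ball,
      ⟨hp1, Metric.mem_ball_self hr, Metric.mem_ball_self hr⟩, hA.subset, ?_⟩
    by_cases hs : deriv δ p.1 = 0 ∧ deriv χ p.1 = 0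
    · left
      intro q hq
      exact (hiff q hq).2 (hA.stationary_of_stationary Metric.isOpen_ball hK Metric.isOpen_ball
        hJ.nonempty hp1 hq.1 hs)
    · right
      refine ⟨fun q hq hz => hs (hA.stationary_of_stationary Metric.isOpen_ball hK
        Metric.isOpen_ball hJ.nonempty hq.1 hp1 ((hiff q hq).1 hz)), Metric.ball p.2.1 r,
        Metric.isOpen_ball, Metric.mem_ball_self hr, ?_⟩
      have hδ := hA.δ_ne p.1 hp1
      refine hasSpecialForm_of_curve Metric.isOpen_ball hJ
        (fun x hx => L.differentiableAt_F (hA.mem_I p.1 hp1 x hx).1)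
        (fun x hx => L.differentiableAt_H (hA.mem_I p.1 hp1 x hx).1) Metric.isOpen_ball 2
        (fun t ht => (hA.hasDerivAt_logDeriv Metric.isOpen_ball ht).1)
        (fun t ht => (hA.hasDerivAt_logDeriv Metric.isOpen_ball ht).2)
        (fun t ht => hA.symRel Metric.isOpen_ball Metric.isOpen_ball ht) hp1 ?_
      by_contra hz
      push Not at hz
      exact hs ⟨(div_eq_zero_iff.1 hz.1).resolve_right hδ,
        (div_eq_zero_iff.1 hz.2).resolve_right hδ⟩
  set Z : Set Pt := {p ∈ Φ.source | pdt (pdx (compX Φ)) p = 0 ∧ pdt (compX Φ) p = 0} with hZ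
  set W : Set Pt := {p ∈ Φ.source | ¬(pdt (pdx (compX Φ)) p = 0 ∧ pdt (compX Φ) p = 0)} with hW
  have oZ : IsOpen Z := isOpen_iff_mem_nhds.2 fun p hp => by
    obtain ⟨N, oN, pN, sN, hN | ⟨hN, -⟩⟩ := hloc p hp.1
    · exact Filter.mem_of_superset (oN.mem_nhds pN) fun q hq => ⟨sN hq, hN q hq⟩
    · exact (hN p pN hp.2).elim
  have oW : IsOpen W := isOpen_iff_mem_nhds.2 fun p hp => by
    obtain ⟨N, oN, pN, sN, hN | ⟨hN, -⟩⟩ := hloc p hp.1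
    · exact (hp.2 (hN p pN)).elim
    · exact Filter.mem_of_superset (oN.mem_nhds pN) fun q hq => ⟨sN hq, hN q hq⟩
  have hdisj : Disjoint Z W := disjoint_left.2 fun p hp hp' => hp'.2 hp.2
  have hcover : Φ.source ⊆ Z ∪ W := fun p hp => by
    by_cases hs : pdt (pdx (compX Φ)) p = 0 ∧ pdt (compX Φ) p = 0
    · exact Or.inl ⟨hp, hs⟩
    · exact Or.inr ⟨hp, hs⟩
  rcases hconn.isPreconnected.subset_or_subset oZ oW hdisj hcover with hs | hs
  · exact fun p hp => (hs hp).2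
  · exfalso
    refine not_isCase0_of_hasSpecialForm (HasSpecialForm.of_local L.isConnected_I fun x hx => ?_) h0
    rw [← hproj] at hx
    obtain ⟨p, hp, rfl⟩ := hx
    obtain ⟨N, oN, pN, sN, hN | ⟨-, hN⟩⟩ := hloc p hp
    · exact ((hs hp).2 (hN p pN)).elim
    · exact hN

/-- With `X_t = X_{tx} = 0` the derivatives of `T` and `X` are constant on the connected domain. -/
theorem exists_equivGroupMap (h : L.IsPointTransformation L' Φ) (h0 : L.IsCase0)
    (hconn : IsConnected Φ.source) (hproj : (fun p : Pt => p.2.1) '' Φ.source = L.I) :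
    ∃ δ₁ δ₂ δ₃ : ℝ, δ₁ ≠ 0 ∧ EqOn Φ (equivGroupMap δ₁ δ₂ δ₃) Φ.source ∧
      L.EquivGroupRelated L' δ₁ δ₃ := by
  have hst := h.stationary_of_isCase0 h0 hconn hproj
  have hU := Φ.open_source
  have hXv : ∀ p ∈ Φ.source, pdv (compX Φ) p = 0 := fun p hp => (h.pd_X hp).1
  obtain ⟨d, hd⟩ := exists_eq_affine hU hconn.isPreconnected (contDiffOn_pdx hU h.smooth_X)
    (a := 0) (b := 0) (c := 0) fun p hp => ⟨(hst p hp).1, h.pdx_pdx_X hp, by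
      rw [pdv_pdx hU h.smooth_X hp]; exact pdx_eqOn_zero hU hXv p hp⟩
  simp only [zero_mul, zero_add] at hd
  have hTt : ∀ p ∈ Φ.source, pdt (compT Φ) p = d ^ 2 := fun p hp => by
    rw [← (h.pd_X hp).2, hd p hp]
  obtain ⟨e, he⟩ := exists_eq_affine hU hconn.isPreconnected h.smooth_X
    (a := 0) (b := d) (c := 0) fun p hp => ⟨(hst p hp).2, hd p hp, hXv p hp⟩
  obtain ⟨f, hf⟩ := exists_eq_affine hU hconn.isPreconnected h.smooth_T
    (a := d ^ 2) (b := 0) (c := 0) fun p hp => ⟨hTt p hp, h.pd_T hp⟩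
  simp only [zero_mul, zero_add, add_zero] at he hf
  have hd0 : d ≠ 0 := by
    obtain ⟨p, hp⟩ := h.1
    rw [← hd p hp]; exact h.pdx_X_ne_zero hp
  refine ⟨d, f, e, hd0, fun p hp => ?_, h.ε_eq, fun x hx => ?_⟩
  · refine Prod.ext (hf p hp) (Prod.ext (he p hp) ?_)
    have := h.V_eq hp
    rw [hTt p hp] at this
    exact this
  · rw [← hproj] at hx
    obtain ⟨p, hp, rfl⟩ := hx
    obtain ⟨e1, e2⟩ := h.transform_coeffs hp
    have hmem := h.compX_mem_I hp
    rw [(hst p hp).2, hd p hp, zero_div, zero_add, he p hp] at e1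
    rw [pdt_eqOn_zero hU hTt p hp, hd p hp, zero_div, zero_add, he p hp] at e2
    rw [he p hp] at hmem
    refine ⟨hmem, ?_, ?_⟩
    · simp only [e1, inv_mul_cancel_left₀ hd0]
    · simp only [e2, inv_mul_cancel_left₀ (pow_ne_zero 2 hd0)]

end Equation.IsPointTransformation

lemma Equation.not_isOfCase_of_equivGroupRelated {L L' : Equation} {d e : ℝ} (hd : d ≠ 0)
    (h0 : L.IsCase0) (h : L.EquivGroupRelated L' d e) (c : ExtCase) : ¬L'.IsOfCase c := fun hc =>
  not_isCase0_of_hasSpecialForm ((HasSpecialForm.of_isOfCase hc).comp_affine hd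
    (fun x hx => (h.2 x hx).1)
    (fun x hx => by rw [(h.2 x hx).2.1, mul_inv_cancel_left₀ hd])
    (fun x hx => by rw [(h.2 x hx).2.2, mul_inv_cancel_left₀ (pow_ne_zero 2 hd)])) h0

end ReactionDiffusion

end

theorem mainTheorem3 :
    -- the cases of the list have the listed maximal Lie invariance algebras
    (∀ (L : ReactionDiffusion.Equation) (c : ReactionDiffusion.ExtCase),
      L.IsOfCase c → L.HasListedBasis c) ∧
    -- the list is exhaustive up to point equivalence
    (∀ L : ReactionDiffusion.Equation, L.IsCase0 ∨
      ∃ (c : ReactionDiffusion.ExtCase) (L' : ReactionDiffusion.Equation)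
        (Φ : OpenPartialHomeomorph ReactionDiffusion.Pt ReactionDiffusion.Pt),
        L'.IsOfCase c ∧ L'.ε = L.ε ∧ L.IsFullPointTransformation L' Φ) ∧
    -- the additional equivalence 1 → 2
    (∀ (L : ReactionDiffusion.Equation) (α β μ : ℝ), μ ≠ 0 → ¬(α = 0 ∧ β = 0) → (0 : ℝ) ∉ L.I →
      L.HasCoeffs (fun x => α * x⁻¹ + μ * x) (fun x => β * (x ^ 2)⁻¹ + 2 * μ) →
      ∃ (L' : ReactionDiffusion.Equation)
        (Φ : OpenPartialHomeomorph ReactionDiffusion.Pt ReactionDiffusion.Pt),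
        L'.IsOfCase (.case2 α β) ∧ L'.ε = L.ε ∧ L.IsFullPointTransformation L' Φ ∧
        Set.EqOn Φ (ReactionDiffusion.expMap μ) Φ.source) ∧
    -- the additional equivalence 5 → 6 with λ = 0
    (∀ (L : ReactionDiffusion.Equation) (μ : ℝ), μ ≠ 0 →
      L.HasCoeffs (fun x => μ * x) (fun _ => 2 * μ) →
      ∃ (L' : ReactionDiffusion.Equation)
        (Φ : OpenPartialHomeomorph ReactionDiffusion.Pt ReactionDiffusion.Pt),
        L'.IsOfCase .case6 ∧ L'.ε = L.ε ∧ L.IsFullPointTransformation L' Φ ∧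
        Set.EqOn Φ (ReactionDiffusion.expMap μ) Φ.source) ∧
    -- the additional equivalences 4 → 4 with λ = 0 and 6 → 6 with λ = 0
    (∀ (L : ReactionDiffusion.Equation) (l γ : ℝ),
      L.HasCoeffs (fun _ => l) (fun _ => γ) →
      ∃ (L' : ReactionDiffusion.Equation)
        (Φ : OpenPartialHomeomorph ReactionDiffusion.Pt ReactionDiffusion.Pt),
        (γ ≠ 0 → L'.IsOfCase (.case4 γ)) ∧ (γ = 0 → L'.IsOfCase .case6) ∧ L'.ε = L.ε ∧
        L.IsFullPointTransformation L' Φ ∧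
        Set.EqOn Φ (ReactionDiffusion.galileiMap l) Φ.source) ∧
    -- the cases of extension in the list are inequivalent, also within parameterized cases
    (∀ (L L' : ReactionDiffusion.Equation) (c c' : ReactionDiffusion.ExtCase)
      (Φ : OpenPartialHomeomorph ReactionDiffusion.Pt ReactionDiffusion.Pt),
      L.IsOfCase c → L'.IsOfCase c' → L.IsPointTransformation L' Φ →
      L'.ε = L.ε ∧ c.SameClass c') ∧
    -- case 0 is inequivalent to the other ones, and has no additional equivalences within itself
    (∀ (L L' : ReactionDiffusion.Equation)
      (Φ : OpenPartialHomeomorph ReactionDiffusion.Pt ReactionDiffusion.Pt),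
      L.IsCase0 → L.IsPointTransformation L' Φ → IsConnected Φ.source →
      (fun p : ReactionDiffusion.Pt => p.2.1) '' Φ.source = L.I →
      (∀ c : ReactionDiffusion.ExtCase, ¬ L'.IsOfCase c) ∧
      ∃ δ₁ δ₂ δ₃ : ℝ, δ₁ ≠ 0 ∧
        Set.EqOn Φ (ReactionDiffusion.equivGroupMap δ₁ δ₂ δ₃) Φ.source ∧
        L.EquivGroupRelated L' δ₁ δ₃) := by
  open ReactionDiffusion Equation in
  refine ⟨fun L c h => hasListedBasis h, fun L => ?_, fun L α β μ hμ hαβ h0 h => ?_,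
    fun L μ hμ h => ?_, fun L l γ h => L.exists_galilei h,
    fun L L' c c' Φ hc hc' h => ⟨h.ε_eq, sameClass_of_isPointTransformation hc hc' h⟩,
    fun L L' Φ h0 h hconn hproj => ?_⟩
  · rcases L.isCase0_or_hasSpecialForm with h | h
    · exact Or.inl h
    · exact Or.inr (L.exists_transformation_of_hasSpecialForm h)
  · obtain ⟨L', Φ, h2, hε, hfull, hΦ⟩ := L.exists_case2_of_exp (c := 0) hμ hαβ fun x hx =>
      ⟨by rw [add_zero]; exact fun hx0 => h0 (hx0 ▸ hx), by rw [h.1 hx, add_zero],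
        by rw [h.2 hx, add_zero]⟩
    exact ⟨L', Φ, h2, hε, hfull, fun p _ => by rw [hΦ p]; simp [expMap]⟩
  · obtain ⟨L', Φ, h6, hε, hfull, hΦ⟩ := L.exists_case6_of_exp (c := 0) hμ fun x hx =>
      ⟨by rw [h.1 hx, add_zero], h.2 hx⟩
    exact ⟨L', Φ, h6, hε, hfull, fun p _ => by rw [hΦ p]; simp [expMap]⟩
  · obtain ⟨δ₁, δ₂, δ₃, hδ, hΦ, hrel⟩ := h.exists_equivGroupMap h0 hconn hproj
    exact ⟨not_isOfCase_of_equivGroupRelated hδ h0 hrel, δ₁, δ₂, δ₃, hδ, hΦ, hrel⟩
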